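/- Let $(M^n,g,\mu)$ be a complete (connected) weighted Riemannian manifold, $d\mu=e^f\,d\mathrm{vol}_g$ with $f$ smooth, that is non-parabolic: there is no sequence $\chi_\ell\in\mathcal C^\infty_c(M)$ with $0\le\chi_\ell\le1$, $\chi_\ell\to1$ uniformly on compact sets and $\int_M|d\chi_\ell|_g^2\,d\mu\to0$. Let $\Delta\ge 0$ be the self-adjoint operator on $L^2_\mu(M)$ given by $\int_M\langle d\varphi,d\phi\rangle_g\,d\mu=\int_M\varphi\,\Delta\phi\,d\mu$ for $\varphi,\phi\in\mathcal C^\infty_c(M)$, and let $\mathring H^1(M)\subset L^2_{loc}(M)$ be the completion of $\mathcal C_c^\infty(M)$ for the norm $\|d\varphi\|_{L^2_\mu}=\|\Delta^{1/2}\varphi\|_{L^2_\mu}$. Then $\Delta^{1/2}$ extends to an isometry of $\mathring H^1(M)$ onto $L^2_\mu(M)$, whose inverse is denoted $\Delta^{-1/2}\colon L^2_\mu(M)\to\mathring H^1(M)$. For a locally integrable function $\rho$, we say that $\Delta^{-1/2}\rho=w\in L^2_\mu(M)$ if for every $v\in L^2_\mu(M)$ the function $\rho\,\Delta^{-1/2}v$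 is integrable and $\langle w,v\rangle_{L^2_\mu}=\int_M\rho\,\Delta^{-1/2}v\,d\mu$; if there is no such $w$, we set $\int_M|\Delta^{-1/2}\rho|^2d\mu=+\infty$. For a bounded open set $\mathcal U\subset M$ let $$\mathrm{cap}(\mathcal U)=\inf\Big\{\int_M|d\varphi|_g^2\,d\mu\ :\ \varphi\in\mathcal C^\infty_c(M),\ \varphi=1\text{ on }\mathcal U\Big\}.$$ Let $q\ge0$ be a locally integrable function on $M$. Then the following properties are equivalent: i) there is a constant $C_1\ge0$ such that $\int_M q\varphi^2\,d\mu\le C_1\int_M|d\varphi|_g^2\,d\mu$ for all $\varphi\in\mathcal C^\infty_c(M)$; ii) the operator $\sqrt q\,\Delta^{-1/2}$ is bounded from $L^2_\mu(M)$ to $L^2_\mu(M)$; iii) there is a constant $C_3\ge0$ such that $\int_{\mathcal U}q\,d\mu\le C_3\,\mathrm{cap}(\mathcal U)$ for every bounded open set $\mathcal U\subset M$; iv) there is a constant $C_4\ge0$ such that $\int_M|\Delta^{-1/2}(q\mathbf 1_{\mathcal U})|^2\,d\mu\le C_4\int_{\mathcal U}q\,d\mu$ for every bounded open set $\mathcal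 U\subset M$; v) there is a constant $C_5\ge0$ such that $\int_M|\Delta^{-1/2}(q\mathbf 1_{\mathcal U})|^2\,d\mu\le C_5^2\,\mathrm{cap}(\mathcal U)$ for every bounded open set $\mathcal U\subset M$. Moreover the constants are mutually controlled as follows: if i) holds with $C_1$, then ii) holds with $\|\sqrt q\,\Delta^{-1/2}\|^2\le C_1$; if ii) holds, then iv) holds with $C_4=\|\sqrt q\,\Delta^{-1/2}\|^2$; if iv) holds with $C_4$, then v) holds with $C_5=C_4$; if v) holds with $C_5$, then iii) holds with $C_3=C_5$; if iii) holds with $C_3$, then i) holds with $C_1=4C_3$. -/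

import Mathlib

open MeasureTheory Filter Topology Manifold Bundle Set
open scoped ContDiff ENNReal InnerProductSpace

noncomputable section

section Manifold

variable (n : ℕ) (M : Type*) [MetricSpace M] [ChartedSpace (EuclideanSpace ℝ (Fin n)) M]

/-- The space `C_c^∞(M)` of smooth real functions with compact support. -/
def testFunctions : Submodule ℝ (M → ℝ) where
  carrier := {φ | ContMDiff (𝓡 n) 𝓘(ℝ, ℝ) ∞ φ ∧ HasCompactSupport φ}
  add_mem' h₁ h₂ := ⟨h₁.1.add h₂.1, h₁.2.add h₂.2⟩
  zero_mem' := ⟨contMDiff_const, HasCompactSupport.zero⟩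
  smul_mem' c φ h := by
    refine ⟨?_, h.2.smul_left (f := fun _ => c)⟩
    have hc : ContMDiff (𝓡 n) 𝓘(ℝ, ℝ) ∞ (fun _ : M => c) := contMDiff_const
    exact hc.smul h.1

end Manifold

section Riemannian

variable (n : ℕ) {M : Type*} [MetricSpace M] [ChartedSpace (EuclideanSpace ℝ (Fin n)) M]
  [RiemannianBundle (fun x : M => TangentSpace (𝓡 n) x)]

instance completeSpace_tangentSpace (x : M) : CompleteSpace (TangentSpace (𝓡 n) x) :=
  haveI : FiniteDimensional ℝ (TangentSpace (𝓡 n) x) :=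
    inferInstanceAs (FiniteDimensional ℝ (EuclideanSpace ℝ (Fin n)))
  FiniteDimensional.complete ℝ _

/-- The scalar product `⟨α, β⟩_g` on the cotangent space `T_x^*M` that is dual to `g_x`. -/
def cotangentInner {x : M} (α β : TangentSpace (𝓡 n) x →L[ℝ] ℝ) : ℝ :=
  ⟪(InnerProductSpace.toDual ℝ (TangentSpace (𝓡 n) x)).symm α,
    (InnerProductSpace.toDual ℝ (TangentSpace (𝓡 n) x)).symm β⟫_ℝ

theorem cotangentInner_add_left {x : M} (α β γ : TangentSpace (𝓡 n) x →L[ℝ] ℝ) :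
    cotangentInner n (α + β) γ = cotangentInner n α γ + cotangentInner n β γ := by
  simp [cotangentInner, inner_add_left]

theorem cotangentInner_smul_left {x : M} (c : ℝ) (α γ : TangentSpace (𝓡 n) x →L[ℝ] ℝ) :
    cotangentInner n (c • α) γ = c * cotangentInner n α γ := by
  simp [cotangentInner, inner_smul_left]

theorem cotangentInner_comm {x : M} (α β : TangentSpace (𝓡 n) x →L[ℝ] ℝ) :
    cotangentInner n α β = cotangentInner n β α := real_inner_comm _ _

theorem cotangentInner_zero_left {x : M} (β : TangentSpace (𝓡 n) x →L[ℝ] ℝ) :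
    cotangentInner n 0 β = 0 := by
  simp [cotangentInner]

/-- The Gram matrix `g(∂_i, ∂_j)` of the Riemannian metric in the chart `e`, at the point of `M`
with coordinates `y`. -/
def chartGram (e : OpenPartialHomeomorph M (EuclideanSpace ℝ (Fin n)))
    (y : EuclideanSpace ℝ (Fin n)) : Matrix (Fin n) (Fin n) ℝ :=
  Matrix.gram ℝ fun i =>
    (mfderiv (𝓡 n) (𝓡 n) e.symm y (EuclideanSpace.single i 1) : TangentSpace (𝓡 n) (e.symm y))

/-- `μ` is a weighted Riemannian measure `dμ = e^f dvol_g` with `f` smooth: in every chart of the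
atlas it has the density `e^f √(det g_ij)` with respect to Lebesgue measure. -/
class IsWeightedMeasure [MeasurableSpace M] (μ : Measure M) : Prop where
  exists_density : ∃ f : M → ℝ, ContMDiff (𝓡 n) 𝓘(ℝ, ℝ) ∞ f ∧
    ∀ e ∈ atlas (EuclideanSpace ℝ (Fin n)) M, ∀ A : Set M, MeasurableSet A → A ⊆ e.source →
      μ A = ∫⁻ y in e.target ∩ e.symm ⁻¹' A,
        ENNReal.ofReal (Real.exp (f (e.symm y)) * √(chartGram n e y).det)

/-- The energy `∫ |dφ|_g² dμ`. -/
def energy [MeasurableSpace M] (μ : Measure M) (φ : M → ℝ) : ℝ :=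
  ∫ x, ‖mvfderiv (𝓡 n) φ x‖ ^ 2 ∂μ

/-- The polarized energy `∫ ⟨dφ, dψ⟩_g dμ`. -/
def energyForm [MeasurableSpace M] (μ : Measure M) (φ ψ : M → ℝ) : ℝ :=
  ∫ x, cotangentInner n (mvfderiv (𝓡 n) φ x) (mvfderiv (𝓡 n) ψ x) ∂μ

theorem energyForm_self [MeasurableSpace M] (μ : Measure M) (φ : M → ℝ) :
    energyForm n μ φ φ = energy n μ φ := by
  simp [energyForm, energy, cotangentInner]

/-- Parabolicity: constants are approximated by test functions of small energy. -/
def IsParabolic [MeasurableSpace M] (μ : Measure M) : Prop :=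
  ∃ χ : ℕ → M → ℝ, (∀ k, χ k ∈ testFunctions n M) ∧ (∀ k x, 0 ≤ χ k x ∧ χ k x ≤ 1) ∧
    (∀ K : Set M, IsCompact K → TendstoUniformlyOn χ (fun _ => 1) atTop K) ∧
    Tendsto (fun k => energy n μ (χ k)) atTop (𝓝 0)

/-- The capacity of a bounded open set `U`. -/
def capacity [MeasurableSpace M] (μ : Measure M) (U : Set M) : ℝ :=
  sInf {c | ∃ φ ∈ testFunctions n M, (∀ x ∈ U, φ x = 1) ∧ c = energy n μ φ}

theorem energyForm_smul_left [MeasurableSpace M] (μ : Measure M) (c : ℝ) {φ : M → ℝ}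
    (hφ : φ ∈ testFunctions n M) (χ : M → ℝ) :
    energyForm n μ (c • φ) χ = c * energyForm n μ φ χ := by
  rw [energyForm, energyForm, ← integral_const_mul]
  refine integral_congr_ae (.of_forall fun x => ?_)
  have h : mvfderiv (𝓡 n) (c • φ) x = c • mvfderiv (𝓡 n) φ x := by
    have h1 := mvfderiv_smul (I := 𝓡 n) (a := fun _ : M => c) (x := x)
      (mdifferentiableAt_const) ((hφ.1.mdifferentiable (by simp)) x)
    have h2 : (fun _ : M => c) • φ = c • φ := rfl
    rw [h2] at h1
    rw [h1]
    ext v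
    simp [mvfderiv_const]
  simp only [h, cotangentInner_smul_left]

end Riemannian

section Continuity

variable (n : ℕ) {M : Type*} [MetricSpace M] [ChartedSpace (EuclideanSpace ℝ (Fin n)) M]
  [IsManifold (𝓡 n) ∞ M]

/-- The inverse of the trivialization of `TM` around `x₀`, on the fiber over `x`. -/
abbrev frameAt (x₀ x : M) : EuclideanSpace ℝ (Fin n) →L[ℝ] TangentSpace (𝓡 n) x :=
  (trivializationAt (EuclideanSpace ℝ (Fin n)) (fun x : M => TangentSpace (𝓡 n) x) x₀).symmL ℝ x

theorem continuousAt_frameAt (x₀ x : M)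
    (hx : x ∈ (chartAt (EuclideanSpace ℝ (Fin n)) x₀).source) (v : EuclideanSpace ℝ (Fin n)) :
    ContinuousAt (fun x : M => (⟨x, frameAt n x₀ x v⟩ :
      TotalSpace (EuclideanSpace ℝ (Fin n)) (fun x : M => TangentSpace (𝓡 n) x))) x := by
  set e := trivializationAt (EuclideanSpace ℝ (Fin n)) (fun x : M => TangentSpace (𝓡 n) x) x₀
    with he
  have hb : x ∈ e.baseSet := by simpa [e] using hx
  have h1 : ContinuousAt (fun y : M => e.toOpenPartialHomeomorph.symm (y, v)) x := by
    apply ContinuousAt.comp (f := fun y : M => (y, v)) (x := x)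
    · apply e.toOpenPartialHomeomorph.continuousAt_symm
      simpa [e.mem_target] using hb
    · fun_prop
  apply h1.congr
  filter_upwards [e.open_baseSet.mem_nhds hb] with y hy
  have h2 := e.mk_symm hy v
  rw [← h2]
  simp only [frameAt, Trivialization.symmL_apply, ← he, hy]

theorem continuousAt_mvfderiv_frameAt {φ : M → ℝ} (hφ : ContMDiff (𝓡 n) 𝓘(ℝ, ℝ) ∞ φ) (x₀ x : M)
    (hx : x ∈ (chartAt (EuclideanSpace ℝ (Fin n)) x₀).source) (v : EuclideanSpace ℝ (Fin n)) :
    ContinuousAt (fun x : M => mvfderiv (𝓡 n) φ x (frameAt n x₀ x v)) x := by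
  have h1 := (hφ.continuous_tangentMap (by simp)).continuousAt.comp (continuousAt_frameAt n x₀ x hx v)
  have h2 := ((tangentBundleModelSpaceHomeomorph 𝓘(ℝ, ℝ)).continuous.continuousAt).comp h1
  have h3 : Continuous (fun p : ModelProd ℝ ℝ => p.2) := continuous_snd
  exact h3.continuousAt.comp h2

variable [RiemannianBundle (fun x : M => TangentSpace (𝓡 n) x)]

theorem chartGram_chartAt (x₀ : M) {y : EuclideanSpace ℝ (Fin n)}
    (hy : y ∈ (chartAt (EuclideanSpace ℝ (Fin n)) x₀).target) :
    chartGram n (chartAt (EuclideanSpace ℝ (Fin n)) x₀) y =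
      Matrix.of fun i j =>
        ⟪frameAt n x₀ ((chartAt (EuclideanSpace ℝ (Fin n)) x₀).symm y) (EuclideanSpace.single i 1),
        frameAt n x₀ ((chartAt (EuclideanSpace ℝ (Fin n)) x₀).symm y)
          (EuclideanSpace.single j 1)⟫_ℝ := by
  set e := chartAt (EuclideanSpace ℝ (Fin n)) x₀ with he
  have key : ∀ v : EuclideanSpace ℝ (Fin n), frameAt n x₀ (e.symm y) v =
      (mfderiv (𝓡 n) (𝓡 n) e.symm y v : TangentSpace (𝓡 n) (e.symm y)) := by
    intro v
    have h1 := TangentBundle.symmL_trivializationAt (𝕜 := ℝ) (I := 𝓡 n) (x₀ := x₀)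
      (x := e.symm y) (e.map_target hy)
    have h2 : extChartAt (𝓡 n) x₀ (e.symm y) = y := by
      simp [extChartAt, ← he, e.right_inv hy]
    have h3 : ∀ q, q = y → (mfderivWithin (𝓡 n) (𝓡 n) (extChartAt (𝓡 n) x₀).symm
        (range (𝓡 n)) q v : EuclideanSpace ℝ (Fin n)) =
        (mfderiv (𝓡 n) (𝓡 n) e.symm y v : EuclideanSpace ℝ (Fin n)) := by
      rintro _ rfl
      simp [extChartAt, mfderivWithin_univ]
      rfl
    have h4 := h3 _ h2
    have h5 := congrArg (fun L => L v) h1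
    exact h5.trans h4
  ext i j
  simp only [chartGram, Matrix.gram_apply, Matrix.of_apply, key]

variable [IsContMDiffRiemannianBundle (𝓡 n) ∞ (EuclideanSpace ℝ (Fin n))
    (fun x : M => TangentSpace (𝓡 n) x)]

theorem continuousAt_inner_frameAt (x₀ x : M)
    (hx : x ∈ (chartAt (EuclideanSpace ℝ (Fin n)) x₀).source) (v w : EuclideanSpace ℝ (Fin n)) :
    ContinuousAt (fun x : M => ⟪frameAt n x₀ x v, frameAt n x₀ x w⟫_ℝ) x := by
  have : IsContinuousRiemannianBundle (EuclideanSpace ℝ (Fin n))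
      (fun x : M => TangentSpace (𝓡 n) x) := by
    obtain ⟨g, hg, h⟩ := IsContMDiffRiemannianBundle.exists_contMDiff (IB := 𝓡 n) (n := ∞)
      (F := EuclideanSpace ℝ (Fin n)) (E := (fun x : M => TangentSpace (𝓡 n) x))
    exact ⟨g, hg.continuous, h⟩
  exact ContinuousAt.inner_bundle (continuousAt_frameAt n x₀ x hx v)
    (continuousAt_frameAt n x₀ x hx w)


theorem continuous_cotangentInner {φ ψ : M → ℝ} (hφ : ContMDiff (𝓡 n) 𝓘(ℝ, ℝ) ∞ φ)
    (hψ : ContMDiff (𝓡 n) 𝓘(ℝ, ℝ) ∞ ψ) :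
    Continuous fun x : M => cotangentInner n (mvfderiv (𝓡 n) φ x) (mvfderiv (𝓡 n) ψ x) := by
  rw [continuous_iff_continuousAt]
  intro x₀
  let E := EuclideanSpace ℝ (Fin n)
  let a : M → E →L[ℝ] ℝ := fun x => (mvfderiv (𝓡 n) φ x).comp (frameAt n x₀ x)
  let b : M → E →L[ℝ] ℝ := fun x => (mvfderiv (𝓡 n) ψ x).comp (frameAt n x₀ x)
  let G : M → E →L[ℝ] E →L[ℝ] ℝ := fun x =>
    (innerSL ℝ (E := TangentSpace (𝓡 n) x)).bilinearComp (frameAt n x₀ x) (frameAt n x₀ x)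
  have hx₀ : x₀ ∈ (chartAt (EuclideanSpace ℝ (Fin n)) x₀).source := mem_chart_source _ _
  have ha : ContinuousAt a x₀ := continuousAt_clm_apply.2 fun v =>
    continuousAt_mvfderiv_frameAt n hφ x₀ x₀ hx₀ v
  have hb : ContinuousAt b x₀ := continuousAt_clm_apply.2 fun v =>
    continuousAt_mvfderiv_frameAt n hψ x₀ x₀ hx₀ v
  have hG : ContinuousAt G x₀ := continuousAt_clm_apply.2 fun v => continuousAt_clm_apply.2 fun w =>
    continuousAt_inner_frameAt n x₀ x₀ hx₀ v w
  have hmem : ∀ x ∈ (chartAt (EuclideanSpace ℝ (Fin n)) x₀).source, ∃ A : E ≃L[ℝ] TangentSpace (𝓡 n) x,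
      ∀ v, A v = frameAt n x₀ x v := by
    intro x hx
    have hb : x ∈ (trivializationAt E (fun x : M => TangentSpace (𝓡 n) x) x₀).baseSet := by
      simpa using hx
    refine ⟨((trivializationAt E (fun x : M => TangentSpace (𝓡 n) x) x₀).continuousLinearEquivAt
      ℝ x hb).symm, fun v => ?_⟩
    rw [frameAt, ← Trivialization.symm_continuousLinearEquivAt_eq _ hb]
  have hinv : ∀ x ∈ (chartAt (EuclideanSpace ℝ (Fin n)) x₀).source, (G x).IsInvertible := by
    intro x hx
    obtain ⟨A, hA⟩ := hmem x hx
    have hinj : Function.Injective (G x).toLinearMap := by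
      rw [injective_iff_map_eq_zero]
      intro v hv
      have h1 : G x v v = 0 := by
        have : G x v = 0 := hv
        rw [this]; rfl
      have h2 : ⟪A v, A v⟫_ℝ = 0 := by rw [hA]; exact h1
      exact (map_eq_zero_iff A A.injective).1 (inner_self_eq_zero.1 h2)
    have hdim : Module.finrank ℝ E = Module.finrank ℝ (E →L[ℝ] ℝ) :=
      (InnerProductSpace.toDual ℝ E).toLinearEquiv.finrank_eq
    refine ⟨(LinearEquiv.ofInjectiveOfFinrankEq _ hinj hdim).toContinuousLinearEquiv, ?_⟩
    ext v w
    rfl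
  have hGi : ContinuousAt (fun x => (G x).inverse) x₀ :=
    ContinuousAt.comp (g := ContinuousLinearMap.inverse) (f := G)
      (((hinv x₀ hx₀).contDiffAt_map_inverse (n := 0)).continuousAt) hG
  have hcont : ContinuousAt (fun x => a x ((G x).inverse (b x))) x₀ :=
    ha.clm_apply (hGi.clm_apply hb)
  apply hcont.congr
  filter_upwards [(chartAt (EuclideanSpace ℝ (Fin n)) x₀).open_source.mem_nhds hx₀] with x hx
  obtain ⟨A, hA⟩ := hmem x hx
  obtain ⟨F, hF⟩ := hinv x hx
  have hGF : (G x) ((G x).inverse (b x)) = b x := by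
    rw [← hF, ContinuousLinearMap.inverse_equiv]
    exact F.apply_symm_apply _
  have hgrad : (InnerProductSpace.toDual ℝ (TangentSpace (𝓡 n) x)).symm (mvfderiv (𝓡 n) ψ x) =
      A ((G x).inverse (b x)) := by
    apply ext_inner_right ℝ
    intro w
    rw [InnerProductSpace.toDual_symm_apply]
    obtain ⟨w, rfl⟩ := A.surjective w
    have := congrArg (fun L => L w) hGF
    rw [hA, hA]
    exact this.symm
  rw [cotangentInner, hgrad, InnerProductSpace.toDual_symm_apply, hA]
  rfl

theorem IsWeightedMeasure.isLocallyFiniteMeasure [MeasurableSpace M] [BorelSpace M] (μ : Measure M)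
    [h : IsWeightedMeasure n μ] : IsLocallyFiniteMeasure μ := by
  refine ⟨fun x₀ => ?_⟩
  obtain ⟨f, hf, hμ⟩ := h.exists_density
  set e := chartAt (EuclideanSpace ℝ (Fin n)) x₀ with he
  have hx₀ : x₀ ∈ e.source := mem_chart_source _ _
  let ρ : M → ℝ := fun x => Real.exp (f x) * √(Matrix.of fun i j : Fin n =>
      ⟪frameAt n x₀ x (EuclideanSpace.single i 1),
        frameAt n x₀ x (EuclideanSpace.single j 1)⟫_ℝ).det
  have hρ : ContinuousAt ρ x₀ := by
    refine (Real.continuous_exp.comp hf.continuous).continuousAt.mul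
      (Real.continuous_sqrt.continuousAt.comp ?_)
    exact ContinuousAt.comp (g := Matrix.det) (continuous_id.matrix_det.continuousAt)
      (continuousAt_pi.2 fun i => continuousAt_pi.2 fun j =>
        continuousAt_inner_frameAt n x₀ x₀ hx₀ _ _)
  have h1 : ∀ᶠ x in 𝓝 x₀, ρ x < ρ x₀ + 1 := hρ.eventually_lt continuousAt_const (by simp)
  have h2 : ∀ᶠ x in 𝓝 x₀, e x ∈ Metric.ball (e x₀) 1 :=
    (e.continuousAt hx₀).eventually (Metric.ball_mem_nhds _ one_pos)
  obtain ⟨V, hV, hVo, hxV⟩ := eventually_nhds_iff.1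
    ((h1.and h2).and (e.open_source.mem_nhds hx₀))
  refine ⟨V, hVo.mem_nhds hxV, ?_⟩
  rw [hμ e (chart_mem_atlas _ _) V hVo.measurableSet fun x hx => (hV x hx).2]
  have hS : MeasurableSet (e.target ∩ e.symm ⁻¹' V) :=
    (e.isOpen_inter_preimage_symm hVo).measurableSet
  calc ∫⁻ y in e.target ∩ e.symm ⁻¹' V,
        ENNReal.ofReal (Real.exp (f (e.symm y)) * √(chartGram n e y).det)
      ≤ ∫⁻ _ in e.target ∩ e.symm ⁻¹' V, ENNReal.ofReal (ρ x₀ + 1) := by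
        refine setLIntegral_mono' hS fun y hy => ENNReal.ofReal_le_ofReal ?_
        rw [he, chartGram_chartAt n x₀ hy.1]
        exact (hV _ hy.2).1.1.le
    _ = ENNReal.ofReal (ρ x₀ + 1) * volume (e.target ∩ e.symm ⁻¹' V) := setLIntegral_const _ _
    _ ≤ ENNReal.ofReal (ρ x₀ + 1) * volume (Metric.ball (e x₀) 1) := by
        gcongr
        intro y hy
        have := (hV _ hy.2).1.2
        rwa [e.right_inv hy.1] at this
    _ < ⊤ := ENNReal.mul_lt_top ENNReal.ofReal_lt_top measure_ball_lt_top

end Continuity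

section SquareRoot

variable {H : Type*} [NormedAddCommGroup H] [InnerProductSpace ℝ H] [CompleteSpace H]

/-- The positive square root of a positive bounded operator `A` on a Hilbert space, that is, the
unique positive operator `B` with `B² = A`. -/
def posSqrt (A : H →L[ℝ] H) : H →L[ℝ] H :=
  Classical.epsilon fun B => B.IsPositive ∧ B ∘L B = A

end SquareRoot

section TestSpace

variable (n : ℕ) {M : Type*} [MetricSpace M] [ChartedSpace (EuclideanSpace ℝ (Fin n)) M]
  [MeasurableSpace M] (μ : Measure M)

/-- `C_c^∞(M)`, with the scalar product `∫ φ ψ dμ + ∫ ⟨dφ, dψ⟩_g dμ`. -/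
def TestSpace (_μ : Measure M) : Type _ := testFunctions n M

instance : AddCommGroup (TestSpace n μ) := inferInstanceAs (AddCommGroup (testFunctions n M))

instance : Module ℝ (TestSpace n μ) := inferInstanceAs (Module ℝ (testFunctions n M))

/-- The function on `M` underlying an element of `TestSpace`. -/
def TestSpace.toFun : TestSpace n μ →ₗ[ℝ] (M → ℝ) := (testFunctions n M).subtype

theorem TestSpace.toFun_mem (φ : TestSpace n μ) : TestSpace.toFun n μ φ ∈ testFunctions n M := φ.2

end TestSpace

section Laplacian

variable (n : ℕ) {M : Type*} [MetricSpace M] [ChartedSpace (EuclideanSpace ℝ (Fin n)) M]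
  [IsManifold (𝓡 n) ∞ M] [RiemannianBundle (fun x : M => TangentSpace (𝓡 n) x)]
  [IsContMDiffRiemannianBundle (𝓡 n) ∞ (EuclideanSpace ℝ (Fin n))
    (fun x : M => TangentSpace (𝓡 n) x)]
  [MeasurableSpace M] [BorelSpace M] (μ : Measure M) [IsWeightedMeasure n μ]

theorem testFunctions_memLp {φ : M → ℝ} (hφ : φ ∈ testFunctions n M) : MemLp φ 2 μ := by
  have := IsWeightedMeasure.isLocallyFiniteMeasure n μ
  exact hφ.1.continuous.memLp_of_hasCompactSupport hφ.2

theorem testFunctions_integrable_mul {φ ψ : M → ℝ} (hφ : φ ∈ testFunctions n M)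
    (hψ : ψ ∈ testFunctions n M) : Integrable (fun x => φ x * ψ x) μ :=
  (testFunctions_memLp n μ hφ).integrable_mul (testFunctions_memLp n μ hψ)

theorem testFunctions_integrable_cotangentInner {φ ψ : M → ℝ} (hφ : φ ∈ testFunctions n M)
    (hψ : ψ ∈ testFunctions n M) :
    Integrable (fun x => cotangentInner n (mvfderiv (𝓡 n) φ x) (mvfderiv (𝓡 n) ψ x)) μ := by
  have := IsWeightedMeasure.isLocallyFiniteMeasure n μ
  refine (continuous_cotangentInner n hφ.1 hψ.1).integrable_of_hasCompactSupport ?_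
  refine hφ.2.mono' fun x hx => ?_
  by_contra hxs
  apply hx
  have h0 : φ =ᶠ[𝓝 x] fun _ => 0 := notMem_tsupport_iff_eventuallyEq.1 hxs
  have h1 : mvfderiv (𝓡 n) φ x = 0 := by
    have h2 : mfderiv (𝓡 n) 𝓘(ℝ, ℝ) φ x = 0 := by
      rw [h0.mfderiv_eq, mfderiv_const]
      rfl
    ext v
    simp [mvfderiv, h2]
  simp only [h1, cotangentInner_zero_left]

theorem energyForm_add_left {φ ψ χ : M → ℝ} (hφ : φ ∈ testFunctions n M)
    (hψ : ψ ∈ testFunctions n M) (hχ : χ ∈ testFunctions n M) :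
    energyForm n μ (φ + ψ) χ = energyForm n μ φ χ + energyForm n μ ψ χ := by
  rw [energyForm, energyForm, energyForm, ← integral_add
    (testFunctions_integrable_cotangentInner n μ hφ hχ)
    (testFunctions_integrable_cotangentInner n μ hψ hχ)]
  refine integral_congr_ae (.of_forall fun x => ?_)
  have h := mvfderiv_add ((hφ.1.mdifferentiable (by simp)) x) ((hψ.1.mdifferentiable (by simp)) x)
  simp only [h, cotangentInner_add_left]

/-- The scalar product `∫ φ ψ dμ + ∫ ⟨dφ, dψ⟩_g dμ` on test functions. -/
@[reducible]
def TestSpace.core : PreInnerProductSpace.Core ℝ (TestSpace n μ) where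
  inner φ ψ := (∫ x, TestSpace.toFun n μ φ x * TestSpace.toFun n μ ψ x ∂μ) +
    energyForm n μ (TestSpace.toFun n μ φ) (TestSpace.toFun n μ ψ)
  conj_inner_symm φ ψ := by
    simp only [energyForm, conj_trivial, mul_comm, cotangentInner_comm n (mvfderiv (𝓡 n)
      (TestSpace.toFun n μ ψ) _)]
  re_inner_nonneg φ := by
    simp only [energyForm_self, energy, RCLike.re_to_real]
    exact add_nonneg (integral_nonneg fun x => mul_self_nonneg _)
      (integral_nonneg fun x => sq_nonneg _)
  add_left φ ψ χ := by
    rw [map_add, energyForm_add_left n μ (TestSpace.toFun_mem n μ φ) (TestSpace.toFun_mem n μ ψ)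
      (TestSpace.toFun_mem n μ χ)]
    simp only [Pi.add_apply, add_mul]
    rw [integral_add (testFunctions_integrable_mul n μ (TestSpace.toFun_mem n μ φ)
      (TestSpace.toFun_mem n μ χ)) (testFunctions_integrable_mul n μ (TestSpace.toFun_mem n μ ψ)
      (TestSpace.toFun_mem n μ χ))]
    ring
  smul_left φ ψ c := by
    rw [map_smul, energyForm_smul_left n μ c (TestSpace.toFun_mem n μ φ)]
    simp only [Pi.smul_apply, smul_eq_mul, mul_assoc, integral_const_mul]
    simp [mul_add]

instance : SeminormedAddCommGroup (TestSpace n μ) :=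
  InnerProductSpace.Core.toSeminormedAddCommGroup (c := TestSpace.core n μ)

instance : InnerProductSpace ℝ (TestSpace n μ) := InnerProductSpace.ofCore (TestSpace.core n μ)

/-- The class of a test function in `L²(μ)`. -/
def TestSpace.toLp : TestSpace n μ →L[ℝ] Lp ℝ 2 μ :=
  LinearMap.mkContinuous
    { toFun := fun φ => (testFunctions_memLp n μ (TestSpace.toFun_mem n μ φ)).toLp
      map_add' := fun φ ψ => rfl
      map_smul' := fun c φ => rfl } 1 (by
    intro φ
    have h1 : ‖(testFunctions_memLp n μ (TestSpace.toFun_mem n μ φ)).toLp‖ ^ 2 =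
        ∫ x, TestSpace.toFun n μ φ x * TestSpace.toFun n μ φ x ∂μ := by
      rw [← real_inner_self_eq_norm_sq, L2.inner_def]
      refine integral_congr_ae ?_
      filter_upwards [(testFunctions_memLp n μ (TestSpace.toFun_mem n μ φ)).coeFn_toLp] with x hx
      simp [hx, sq]
    have h2 : ‖φ‖ ^ 2 = (∫ x, TestSpace.toFun n μ φ x * TestSpace.toFun n μ φ x ∂μ) +
        energyForm n μ (TestSpace.toFun n μ φ) (TestSpace.toFun n μ φ) :=
      (real_inner_self_eq_norm_sq φ).symm
    rw [energyForm_self] at h2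
    have h3 : 0 ≤ energy n μ (TestSpace.toFun n μ φ) := integral_nonneg fun x => sq_nonneg _
    rw [one_mul]
    refine (abs_le_of_sq_le_sq' ?_ (norm_nonneg _)).2
    exact (h1.trans_le (le_add_of_nonneg_right h3)).trans_eq h2.symm)

/-- The Sobolev space `W_0^{1,2}(M)`. -/
abbrev SobolevSpace : Type _ := UniformSpace.Completion (TestSpace n μ)

/-- The canonical map `W_0^{1,2}(M) → L²(μ)`. -/
def sobolevToLp : SobolevSpace n μ →L[ℝ] Lp ℝ 2 μ := (TestSpace.toLp n μ).fromCompletion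

/-- The resolvent `(1 + Δ)⁻¹` on `L²(μ)`: `u = (1 + Δ)⁻¹ f` is the element of `W_0^{1,2}(M)` with
`∫ u ψ dμ + ∫ ⟨du, dψ⟩ dμ = ∫ f ψ dμ` for all test functions `ψ`. Accordingly the self-adjoint
operator `Δ` on `L²(μ)` is `(laplacianResolvent n μ)⁻¹ - 1`. -/
def laplacianResolvent : Lp ℝ 2 μ →L[ℝ] Lp ℝ 2 μ :=
  sobolevToLp n μ ∘L ContinuousLinearMap.adjoint (sobolevToLp n μ)

/-- The operator `(laplacianResolvent n μ)⁻¹ - 1` extends the Laplacian on test functions that is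
defined by the Green formula `∫ ⟨dφ, dψ⟩ dμ = ∫ (Δφ) ψ dμ`. -/
theorem laplacianResolvent_add_laplacian (φ Δφ : TestSpace n μ)
    (h : ∀ ψ : TestSpace n μ, energyForm n μ (TestSpace.toFun n μ φ) (TestSpace.toFun n μ ψ) =
      ∫ x, TestSpace.toFun n μ Δφ x * TestSpace.toFun n μ ψ x ∂μ) :
    laplacianResolvent n μ (TestSpace.toLp n μ φ + TestSpace.toLp n μ Δφ) =
      TestSpace.toLp n μ φ := by
  have hLp : ∀ ξ ψ : TestSpace n μ, ⟪TestSpace.toLp n μ ξ, TestSpace.toLp n μ ψ⟫_ℝ =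
      ∫ x, TestSpace.toFun n μ ξ x * TestSpace.toFun n μ ψ x ∂μ := by
    intro ξ ψ
    rw [L2.inner_def]
    refine integral_congr_ae ?_
    filter_upwards [(testFunctions_memLp n μ (TestSpace.toFun_mem n μ ξ)).coeFn_toLp,
      (testFunctions_memLp n μ (TestSpace.toFun_mem n μ ψ)).coeFn_toLp] with x hx hy
    change ⟪(testFunctions_memLp n μ (TestSpace.toFun_mem n μ ξ)).toLp _ x,
      (testFunctions_memLp n μ (TestSpace.toFun_mem n μ ψ)).toLp _ x⟫_ℝ = _
    rw [hx, hy]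
    exact mul_comm _ _
  have key : ContinuousLinearMap.adjoint (sobolevToLp n μ)
      (TestSpace.toLp n μ φ + TestSpace.toLp n μ Δφ) = (φ : SobolevSpace n μ) := by
    refine ext_inner_right ℝ fun w => ?_
    rw [ContinuousLinearMap.adjoint_inner_left]
    induction w using UniformSpace.Completion.induction_on with
    | hp => exact isClosed_eq (by fun_prop) (by fun_prop)
    | ih ψ =>
      rw [sobolevToLp, ContinuousLinearMap.fromCompletion_apply_coe, inner_add_left, hLp, hLp,
        ← h, UniformSpace.Completion.inner_coe]
      rfl
  rw [laplacianResolvent, ContinuousLinearMap.comp_apply, key, sobolevToLp,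
    ContinuousLinearMap.fromCompletion_apply_coe]

/-- `v = Δ^{1/2} u` in `L²(μ)`. In terms of `R = (1 + Δ)⁻¹` the functional calculus gives
`Δ^{1/2} = (1 - R)^{1/2} R^{-1/2}`, so that the graph of `Δ^{1/2}` consists of the pairs
`(R^{1/2} w, (1 - R)^{1/2} w)`. -/
def IsSqrtLaplacian (u v : Lp ℝ 2 μ) : Prop :=
  ∃ w : Lp ℝ 2 μ, posSqrt (laplacianResolvent n μ) w = u ∧
    posSqrt (1 - laplacianResolvent n μ) w = v

/-- `u = Δ^{-1/2} f` for `f ∈ L²(μ)`, where `Δ^{-1/2}` is the inverse of the extension of `Δ^{1/2}`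
to the homogeneous Sobolev space, the completion of `C_c^∞(M)` for the norm
`‖dφ‖ = ‖Δ^{1/2} φ‖`, embedded into the functions that are locally in `L²`: there are test
functions `φ_k → u` in `L²_loc` with `Δ^{1/2} φ_k → f` in `L²(μ)`. -/
def IsInvSqrtLaplacian (f : Lp ℝ 2 μ) (u : M → ℝ) : Prop :=
  AEStronglyMeasurable u μ ∧ ∃ (φ : ℕ → TestSpace n μ) (g : ℕ → Lp ℝ 2 μ),
    (∀ k, IsSqrtLaplacian n μ (TestSpace.toLp n μ (φ k)) (g k)) ∧
    Tendsto g atTop (𝓝 f) ∧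
    ∀ K : Set M, IsCompact K →
      Tendsto (fun k => eLpNorm (fun x => TestSpace.toFun n μ (φ k) x - u x) 2 (μ.restrict K))
        atTop (𝓝 0)

/-- `w = Δ^{-1/2} ρ` in `L²(μ)` for a function `ρ` that need not be square integrable; here
`Δ^{-1/2}` is extended by symmetry, `⟨Δ^{-1/2} ρ, f⟩ = ⟨ρ, Δ^{-1/2} f⟩` for all `f ∈ L²(μ)`. -/
def IsDualInvSqrtLaplacian (ρ : M → ℝ) (w : Lp ℝ 2 μ) : Prop :=
  ∀ (f : Lp ℝ 2 μ) (u : M → ℝ), IsInvSqrtLaplacian n μ f u →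
    Integrable (fun x => ρ x * u x) μ ∧ ⟪w, f⟫_ℝ = ∫ x, ρ x * u x ∂μ

/-- `T` is the operator `√q Δ^{-1/2}`, bounded on `L²(μ)`. -/
def IsSqrtMulInvSqrtLaplacian (q : M → ℝ) (T : Lp ℝ 2 μ →L[ℝ] Lp ℝ 2 μ) : Prop :=
  ∀ f : Lp ℝ 2 μ, ∃ u : M → ℝ, IsInvSqrtLaplacian n μ f u ∧ T f =ᵐ[μ] fun x => √(q x) * u x

/-- `∫ |Δ^{-1/2}(q 1_U)|² dμ ≤ b U` for all bounded open sets `U`. -/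
def TestingCondition (q : M → ℝ) (b : Set M → ℝ) : Prop :=
  ∀ U : Set M, IsOpen U → Bornology.IsBounded U →
    ∃ w : Lp ℝ 2 μ, IsDualInvSqrtLaplacian n μ (U.indicator q) w ∧ ∫ x, w x ^ 2 ∂μ ≤ b U

end Laplacian

section Conditions

variable (n : ℕ) {M : Type*} [MetricSpace M] [ChartedSpace (EuclideanSpace ℝ (Fin n)) M]
  [RiemannianBundle (fun x : M => TangentSpace (𝓡 n) x)] [MeasurableSpace M] (μ : Measure M)

/-- `∫ q φ² dμ ≤ C ∫ |dφ|² dμ` for all test functions `φ`. -/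
def TraceInequality (q : M → ℝ) (C : ℝ) : Prop :=
  ∀ φ ∈ testFunctions n M, ∫ x, q x * φ x ^ 2 ∂μ ≤ C * energy n μ φ

/-- `∫_U q dμ ≤ C cap(U)` for all bounded open sets `U`. -/
def CapacityCondition (q : M → ℝ) (C : ℝ) : Prop :=
  ∀ U : Set M, IsOpen U → Bornology.IsBounded U → ∫ x in U, q x ∂μ ≤ C * capacity n μ U

end Conditions

end

/-!
# The trace inequality on a non-parabolic weighted Riemannian manifold

Write `E(φ) = ∫ |dφ|² dμ` for test functions `φ`, and `R = S S* = (1 + Δ)⁻¹`, where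
`S : W_0^{1,2}(M) → L²(μ)` is the canonical map.

*The function spaces.* Complete Riemannian manifolds are proper (`properSpace_of_exists_between`),
so bounded open sets are relatively compact. In small coordinate balls `μ` and the metric are
comparable with their Euclidean counterparts (`exists_isComparisonBall`), which transfers two facts
from `ℝⁿ`: the closability of the energy (`tendsto_energy_of_cauchy`), so that `S` is injective, and
the Poincaré inequality. Since `M` is connected, the latter propagates from ball to ball, and on
every compact set the `L²` distance of `φ` to its mean `m(φ)` over one fixed ball is controlled by
`E(φ)` (`exists_lintegral_sub_average_le`). On a non-parabolic manifold `m(φ)² ≤ A E(φ)`: test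
functions of mean `1` and small energy could be modified to be `1` on a given compact set
(`exists_enorm_average_sq_le`). Hence `∫ φ² dν ≤ E(φ)` for a measure `ν` that is bounded below by a
multiple of `μ` on each compact set (`exists_hardy_measure`).

*The operators.* The polar decomposition of `S*` identifies `Δ^{1/2} = (1 - R)^{1/2} R^{-1/2}` on
`W_0^{1,2}(M)` with a bounded operator `D` into `L²(μ)` satisfying `‖D φ‖² = E(φ)`, with dense range
because the energy is positive definite (`exists_sqrt_form_operator`). The square roots exist by the
binomial series. By the Hardy inequality the map `D φ ↦ φ` extends to a bounded operator
`P : L²(μ) → L²(ν)`, and `u = Δ^{-1/2} f` means exactly that `u = P f` almost everywhere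
(`exists_invSqrtLaplacian`).

*The implications.* The trace inequality says that `D φ ↦ √q φ` extends to a bounded operator `T` on
`L²(μ)`, and `T f = √q P f`. Given `T`, the function `T* (√q 1_U)` is `Δ^{-1/2}(q 1_U)`. If
`w = Δ^{-1/2}(q 1_U)` and `φ` is a test function equal to `1` on `U`, then
`∫_U q dμ = ⟨w, D φ⟩ ≤ ‖w‖ E(φ)^{1/2}` (`sq_setIntegral_le_mul_energy`); taking the infimum over `φ`
gives the two implications that involve both the testing conditions and the capacity. Finally, the
truncation `G(φ² / t²)`, with `G` of slope nearly `1`, bounds the capacity of `{|φ| > t}` by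
`∫_{|φ| ≤ t} 4 φ² |dφ|² t⁻⁴ dμ` (`ofReal_capacity_lt_abs_le`). Integrating this against `2 t dt` gives
the trace inequality with the constant `4`, because `∫_{|φ|}^∞ 8 φ² t⁻³ dt = 4`.
-/


noncomputable section

/-! ### Square roots of positive contractions -/

section SquareRootExistence

/-- The coefficients of `1 - √(1 - x) = ∑ a_k x ^ (k + 1)`. -/
def sqrtCoeff (k : ℕ) : ℝ := catalan k / 2 ^ (2 * k + 1)

theorem sqrtCoeff_nonneg (k : ℕ) : 0 ≤ sqrtCoeff k := by
  unfold sqrtCoeff; positivity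

theorem sqrtCoeff_zero : sqrtCoeff 0 = 1 / 2 := by simp [sqrtCoeff]

/-- The coefficients satisfy the recursion expressed by `y = (x + y²) / 2`. -/
theorem sqrtCoeff_succ (k : ℕ) : 2 * sqrtCoeff (k + 1) =
    ∑ p ∈ Finset.HasAntidiagonal.antidiagonal k, sqrtCoeff p.1 * sqrtCoeff p.2 := by
  have h : ∀ p ∈ Finset.HasAntidiagonal.antidiagonal k, sqrtCoeff p.1 * sqrtCoeff p.2 =
      (catalan p.1 * catalan p.2 : ℝ) / 2 ^ (2 * k + 2) := by
    intro p hp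
    rw [Finset.HasAntidiagonal.mem_antidiagonal] at hp
    rw [sqrtCoeff, sqrtCoeff, div_mul_div_comm, ← pow_add, ← hp]
    congr 2
    ring
  rw [Finset.sum_congr rfl h, ← Finset.sum_div, sqrtCoeff, catalan_succ']
  push_cast
  rw [show 2 * (k + 1) + 1 = (2 * k + 2) + 1 by ring, pow_succ]
  field_simp

/-- By the recursion, `s ↦ (1 + s²) / 2` bounds each partial sum in terms of the previous one, so
that the partial sums stay below the fixed point `1`. -/
theorem sum_sqrtCoeff_le (N : ℕ) : ∑ k ∈ Finset.range N, sqrtCoeff k ≤ 1 := by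
  induction N with
  | zero => simp
  | succ N ih =>
    rw [Finset.sum_range_succ']
    have h0 : 0 ≤ ∑ k ∈ Finset.range N, sqrtCoeff k :=
      Finset.sum_nonneg fun k _ => sqrtCoeff_nonneg k
    have h1 : 2 * ∑ k ∈ Finset.range N, sqrtCoeff (k + 1) ≤
        (∑ k ∈ Finset.range N, sqrtCoeff k) * ∑ k ∈ Finset.range N, sqrtCoeff k := by
      rw [Finset.mul_sum, Finset.sum_congr rfl fun k _ => sqrtCoeff_succ k,
        Finset.sum_mul_sum, ← Finset.sum_product', ← Finset.sum_biUnion]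
      · refine Finset.sum_le_sum_of_subset_of_nonneg (fun p hp => ?_) fun p _ _ =>
          mul_nonneg (sqrtCoeff_nonneg _) (sqrtCoeff_nonneg _)
        simp only [Finset.mem_biUnion, Finset.mem_range,
          Finset.HasAntidiagonal.mem_antidiagonal] at hp
        obtain ⟨k, hk, rfl⟩ := hp
        simp only [Finset.mem_product, Finset.mem_range]
        omega
      · intro i _ j _ hij
        refine Finset.disjoint_left.2 fun p hp hp' => hij ?_
        rw [Finset.HasAntidiagonal.mem_antidiagonal] at hp hp'
        rw [← hp, ← hp']
    rw [sqrtCoeff_zero]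
    nlinarith

theorem summable_sqrtCoeff : Summable sqrtCoeff :=
  summable_of_sum_range_le sqrtCoeff_nonneg sum_sqrtCoeff_le

theorem tsum_sqrtCoeff_le : ∑' k, sqrtCoeff k ≤ 1 :=
  Real.tsum_le_of_sum_range_le sqrtCoeff_nonneg sum_sqrtCoeff_le

variable {H : Type*} [NormedAddCommGroup H] [InnerProductSpace ℝ H] [CompleteSpace H]

/-- The binomial series of `√(1 - X)` converges for `‖X‖ ≤ 1`. This yields square roots over the
real numbers, where the continuous functional calculus is not available. -/
theorem exists_isPositive_sqrt_one_sub {X : H →L[ℝ] H} (hX : IsSelfAdjoint X) (hX1 : ‖X‖ ≤ 1) :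
    ∃ B : H →L[ℝ] H, B.IsPositive ∧ B ∘L B = 1 - X := by
  set t : ℕ → H →L[ℝ] H := fun k => sqrtCoeff k • X ^ (k + 1) with ht
  have htn : ∀ k, ‖t k‖ ≤ sqrtCoeff k := fun k => by
    rw [ht, norm_smul, Real.norm_of_nonneg (sqrtCoeff_nonneg k)]
    refine mul_le_of_le_one_right (sqrtCoeff_nonneg k) ?_
    exact (norm_pow_le' X k.succ_pos).trans (pow_le_one₀ (norm_nonneg _) hX1)
  have hsn : Summable fun k => ‖t k‖ :=
    Summable.of_nonneg_of_le (fun _ => norm_nonneg _) htn summable_sqrtCoeff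
  have hs : Summable t := hsn.of_norm
  set Y := ∑' k, t k with hY
  have hYn : ‖Y‖ ≤ 1 := (tsum_of_norm_bounded summable_sqrtCoeff.hasSum htn).trans tsum_sqrtCoeff_le
  have hYs : IsSelfAdjoint Y := by
    rw [IsSelfAdjoint, hY, tsum_star]
    congr 1
    ext1 k
    simp [ht, hX.star_eq]
  have hYY : Y * Y = 2 • Y - X := by
    have h1 : Y * Y = ∑' k, (2 : ℝ) • t (k + 1) := by
      rw [hY, tsum_mul_tsum_eq_tsum_sum_antidiagonal_of_summable_norm hsn hsn]
      congr 1
      ext1 k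
      rw [ht]
      simp only [smul_smul]
      rw [sqrtCoeff_succ, Finset.sum_smul]
      refine Finset.sum_congr rfl fun p hp => ?_
      rw [Finset.HasAntidiagonal.mem_antidiagonal] at hp
      rw [smul_mul_smul_comm, ← pow_add, ← hp]
      congr 2
      ring
    have h2 : Y = t 0 + ∑' k, t (k + 1) := hs.tsum_eq_zero_add
    have h3 : t 0 = (1 / 2 : ℝ) • X := by simp [ht, sqrtCoeff_zero]
    rw [h1, tsum_const_smul'', ← sub_eq_iff_eq_add'.2 h2, h3]
    rw [smul_sub, smul_smul, two_smul, two_smul]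
    norm_num
  refine ⟨1 - Y, ?_, ?_⟩
  · refine ContinuousLinearMap.isPositive_def'.2 ⟨(IsSelfAdjoint.one _).sub hYs, fun x => ?_⟩
    have h1 : ⟪Y x, x⟫_ℝ ≤ ‖x‖ * ‖x‖ := (real_inner_le_norm _ _).trans
      (mul_le_mul_of_nonneg_right ((Y.le_of_opNorm_le hYn x).trans_eq (one_mul _))
        (norm_nonneg x))
    have h2 : (1 - Y).reApplyInnerSelf x = ‖x‖ * ‖x‖ - ⟪Y x, x⟫_ℝ := by
      rw [ContinuousLinearMap.reApplyInnerSelf_apply]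
      simp [inner_sub_left, sq]
    linarith
  · change (1 - Y) * (1 - Y) = 1 - X
    rw [sub_mul, mul_sub, mul_sub, hYY]
    simp only [one_mul, mul_one, two_smul]
    abel

/-- The choice in the definition of `posSqrt` finds a square root. -/
theorem posSqrt_one_sub_spec {X : H →L[ℝ] H} (hX : IsSelfAdjoint X) (hX1 : ‖X‖ ≤ 1) :
    (posSqrt (1 - X)).IsPositive ∧ posSqrt (1 - X) ∘L posSqrt (1 - X) = 1 - X :=
  Classical.epsilon_spec (exists_isPositive_sqrt_one_sub hX hX1)

end SquareRootExistence

/-! ### The square root of a form operator -/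

section FormOperator

open ContinuousLinearMap

variable {W H : Type*} [NormedAddCommGroup W] [InnerProductSpace ℝ W] [CompleteSpace W]
  [NormedAddCommGroup H] [InnerProductSpace ℝ H] [CompleteSpace H]

theorem norm_sq_adjoint_apply (S : W →L[ℝ] H) (x : H) :
    ‖adjoint S x‖ ^ 2 = ⟪(S ∘L adjoint S) x, x⟫_ℝ := by
  rw [← real_inner_self_eq_norm_sq, adjoint_inner_left, real_inner_comm]
  rfl

theorem norm_comp_adjoint_le_one {S : W →L[ℝ] H} (hS : ‖S‖ ≤ 1) : ‖S ∘L adjoint S‖ ≤ 1 := by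
  refine (opNorm_comp_le _ _).trans ?_
  rw [LinearIsometryEquiv.norm_map]
  exact mul_le_one₀ hS (norm_nonneg _) hS

theorem norm_one_sub_comp_adjoint_le_one {S : W →L[ℝ] H} (hS : ‖S‖ ≤ 1) :
    ‖1 - S ∘L adjoint S‖ ≤ 1 := by
  refine opNorm_le_bound _ zero_le_one fun x => ?_
  rw [one_mul]
  refine (sq_le_sq₀ (norm_nonneg _) (norm_nonneg _)).1 ?_
  have h1 := norm_sq_adjoint_apply S x
  have h2 : ‖(S ∘L adjoint S) x‖ ≤ ‖adjoint S x‖ := (S.le_of_opNorm_le hS _).trans_eq (one_mul _)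
  have h3 : ‖(1 - S ∘L adjoint S) x‖ ^ 2 = ‖x‖ ^ 2 - 2 * ⟪(S ∘L adjoint S) x, x⟫_ℝ +
      ‖(S ∘L adjoint S) x‖ ^ 2 := by
    rw [sub_apply, one_apply_eq_self, norm_sub_sq_real, real_inner_comm]
  rw [h3, ← h1]
  nlinarith [norm_nonneg ((S ∘L adjoint S) x), sq_nonneg ‖adjoint S x‖]

theorem dense_range_of_isSelfAdjoint_of_injective {A : H →L[ℝ] H} (hA : IsSelfAdjoint A)
    (h : ∀ x, A x = 0 → x = 0) : DenseRange A := by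
  have h1 : A.rangeᗮ = ⊥ := by
    rw [orthogonal_range, hA.adjoint_eq, Submodule.eq_bot_iff]
    exact h
  have h2 := Submodule.topologicalClosure_eq_top_iff.2 h1
  exact dense_iff_closure_eq.2 (congrArg (fun K : Submodule ℝ H => (K : Set H)) h2)

/-- Let `S : W → H` be an injective contraction of Hilbert spaces with dense range and
`R = S S*`, so that `Δ = R⁻¹ - 1` is the operator of the closed form `‖h‖² - ‖S h‖²` on `W`.
If this form is positive definite then the functional calculus expression
`(1 - R)^{1/2} R^{-1/2}` of `Δ^{1/2}` is defined on the range of `S`, where it satisfies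
`‖Δ^{1/2} S h‖² = ‖h‖² - ‖S h‖²`, and it has dense range. -/
theorem exists_sqrt_form_operator {S : W →L[ℝ] H} (hS : ‖S‖ ≤ 1) (hinj : ∀ h, S h = 0 → h = 0)
    (hdense : DenseRange S) (hpos : ∀ h, ‖S h‖ = ‖h‖ → h = 0) :
    ∃ D : W →L[ℝ] H, (∀ h, ‖D h‖ ^ 2 = ‖h‖ ^ 2 - ‖S h‖ ^ 2) ∧ DenseRange D ∧
      ∀ h v, (∃ w, posSqrt (S ∘L adjoint S) w = S h ∧
        posSqrt (1 - S ∘L adjoint S) w = v) ↔ v = D h := by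
  set R := S ∘L adjoint S with hR
  have hRs : IsSelfAdjoint R := (isPositive_self_comp_adjoint S).isSelfAdjoint
  obtain ⟨hA, hAA⟩ : (posSqrt R).IsPositive ∧ posSqrt R ∘L posSqrt R = R := by
    have := posSqrt_one_sub_spec ((IsSelfAdjoint.one _).sub hRs)
      (norm_one_sub_comp_adjoint_le_one hS)
    rwa [sub_sub_cancel] at this
  obtain ⟨hB, hBB⟩ := posSqrt_one_sub_spec hRs (norm_comp_adjoint_le_one hS)
  set A := posSqrt R
  set B := posSqrt (1 - R)
  have hRA : ∀ x, A (A x) = R x := fun x => congrArg (fun T : H →L[ℝ] H => T x) hAA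
  have hRB : ∀ x, B (B x) = x - R x := fun x => congrArg (fun T : H →L[ℝ] H => T x) hBB
  have hRx : ∀ x, S (adjoint S x) = R x := fun x => rfl
  have hAn : ∀ x, ‖A x‖ ^ 2 = ⟪R x, x⟫_ℝ := fun x => by
    rw [← real_inner_self_eq_norm_sq, ← hRA, hA.inner_left_eq_inner_right, real_inner_comm]
  have hBn : ∀ x, ‖B x‖ ^ 2 = ‖x‖ ^ 2 - ‖A x‖ ^ 2 := fun x => by
    rw [hAn, ← real_inner_self_eq_norm_sq, ← real_inner_self_eq_norm_sq, ← inner_sub_left, ← hRB,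
      hB.inner_left_eq_inner_right, real_inner_comm]
  have hSA : ∀ x, ‖adjoint S x‖ = ‖A x‖ := fun x =>
    (sq_eq_sq₀ (norm_nonneg _) (norm_nonneg _)).1 (by rw [hAn, norm_sq_adjoint_apply])
  have hSd : ∀ x, adjoint S x = 0 → x = 0 := fun x hx => by
    refine hdense.eq_zero_of_inner_left ℝ fun h => ?_
    rw [← adjoint_inner_left, hx, inner_zero_left]
  have hAi : ∀ x, A x = 0 → x = 0 := fun x hx => hSd x (by rw [← norm_eq_zero, hSA, hx, norm_zero])
  have hAd : DenseRange A := dense_range_of_isSelfAdjoint_of_injective hA.isSelfAdjoint hAi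
  -- the partial isometry `V` of the polar decomposition `S* = V A` is unitary
  set V : H →L[ℝ] W := (adjoint S : H →ₗ[ℝ] W).extendOfNorm (A : H →ₗ[ℝ] H) with hV
  have hVA : ∀ x, V (A x) = adjoint S x := fun x =>
    LinearMap.extendOfNorm_eq (f := (adjoint S : H →ₗ[ℝ] W)) (e := (A : H →ₗ[ℝ] H)) hAd
      ⟨1, fun y => by simp [hSA]⟩ x
  have hVn : ∀ x, ‖V x‖ = ‖x‖ := fun x => by
    refine hAd.induction_on (p := fun x => ‖V x‖ = ‖x‖) x
      (isClosed_eq (by fun_prop) (by fun_prop)) fun y => ?_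
    rw [hVA, hSA]
  have hVV : ∀ x, adjoint V (V x) = x := fun x => by
    refine ext_inner_right ℝ fun y => ?_
    rw [adjoint_inner_left]
    exact (LinearMap.norm_map_iff_inner_map_map (V : H →ₗ[ℝ] W)).1 hVn x y
  have hSV : ∀ h, A (adjoint V h) = S h := fun h => by
    refine ext_inner_right ℝ fun y => ?_
    rw [hA.inner_left_eq_inner_right, adjoint_inner_left, hVA, adjoint_inner_right]
  have hVi : ∀ h, adjoint V h = 0 → h = 0 := fun h hh => hinj h (by rw [← hSV, hh, map_zero])
  have hVV' : ∀ h, V (adjoint V h) = h := fun h => by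
    refine sub_eq_zero.1 (hVi _ ?_)
    rw [map_sub, hVV, sub_self]
  have hVn' : ∀ h, ‖adjoint V h‖ = ‖h‖ := fun h => by rw [← hVn, hVV']
  have hBi : ∀ x, B x = 0 → x = 0 := fun x hx => by
    have h1 : R x = x := by
      rw [eq_comm, ← sub_eq_zero, ← hRB, hx, map_zero]
    have h2 : adjoint S x = 0 := by
      refine hpos _ ((sq_eq_sq₀ (norm_nonneg _) (norm_nonneg _)).1 ?_)
      rw [hRx, norm_sq_adjoint_apply, ← hR, h1, real_inner_self_eq_norm_sq]
    exact hSd x h2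
  refine ⟨B ∘L adjoint V, fun h => ?_, ?_, fun h v => ⟨?_, ?_⟩⟩
  · rw [comp_apply, hBn, hSV, hVn']
  · exact (dense_range_of_isSelfAdjoint_of_injective hB.isSelfAdjoint hBi).comp
      (Function.Surjective.denseRange fun x => ⟨V x, hVV x⟩) B.continuous
  · rintro ⟨w, hw, rfl⟩
    have : w = adjoint V h := sub_eq_zero.1 (hAi _ (by rw [map_sub, hw, hSV, sub_self]))
    rw [this, comp_apply]
  · rintro rfl
    exact ⟨adjoint V h, hSV h, rfl⟩

end FormOperator

/-! ### The Hopf–Rinow theorem -/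

section HopfRinow

/-- In a complete locally compact length space, closed balls are compact. The set of radii `r` for
which the ball around `p` is compact contains its supremum, since the ball is then totally bounded,
and it is open to the right by local compactness. -/
theorem properSpace_of_exists_between {X : Type*} [MetricSpace X] [CompleteSpace X]
    [LocallyCompactSpace X]
    (h : ∀ (x y : X) (s t : ℝ), 0 ≤ s → 0 < t → dist x y < s + t →
      ∃ z, dist x z ≤ s ∧ dist z y < t) : ProperSpace X := by
  refine ⟨fun p r₀ => ?_⟩
  by_contra hr₀
  set S : Set ℝ := {r | 0 ≤ r ∧ IsCompact (Metric.closedBall p r)} with hS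
  have hmono : ∀ r ∈ S, r ≤ r₀ := by
    intro r hr
    by_contra! hlt
    exact hr₀ (hr.2.of_isClosed_subset Metric.isClosed_closedBall
      (Metric.closedBall_subset_closedBall hlt.le))
  have h0 : (0 : ℝ) ∈ S := ⟨le_rfl, by simp⟩
  have hbdd : BddAbove S := ⟨r₀, hmono⟩
  set R := sSup S
  have hR0 : 0 ≤ R := le_csSup hbdd h0
  have hRc : IsCompact (Metric.closedBall p R) := by
    refine isCompact_iff_totallyBounded_isComplete.2
      ⟨Metric.totallyBounded_iff.2 fun ε hε => ?_, Metric.isClosed_closedBall.isComplete⟩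
    obtain ⟨r, hrS, hr⟩ := exists_lt_of_lt_csSup ⟨0, h0⟩ (show R - ε / 2 < R by linarith)
    obtain ⟨t, ht, hcov⟩ := Metric.totallyBounded_iff.1 hrS.2.totallyBounded (ε / 2) (by linarith)
    refine ⟨t, ht, fun x hx => ?_⟩
    rw [Metric.mem_closedBall, dist_comm] at hx
    obtain ⟨z, hz, hzx⟩ := h p x r (ε / 2) hrS.1 (by linarith) (by linarith)
    have hz' : z ∈ Metric.closedBall p r := by rwa [Metric.mem_closedBall, dist_comm]
    obtain ⟨y, hy, hzy⟩ := mem_iUnion₂.1 (hcov hz')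
    refine mem_iUnion₂.2 ⟨y, hy, ?_⟩
    rw [Metric.mem_ball] at hzy ⊢
    have := dist_triangle x z y
    rw [dist_comm x z] at this
    linarith
  obtain ⟨δ, hδ, hδc⟩ := hRc.exists_isCompact_cthickening
  have hmem : R + δ / 2 ∈ S := by
    refine ⟨by linarith, hδc.of_isClosed_subset Metric.isClosed_closedBall fun x hx => ?_⟩
    rw [Metric.mem_closedBall, dist_comm] at hx
    obtain ⟨z, hz, hzx⟩ := h p x R δ hR0 hδ (by linarith)
    refine Metric.mem_cthickening_of_dist_le x z δ _ ?_ ?_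
    · rwa [Metric.mem_closedBall, dist_comm]
    · rw [dist_comm]; exact hzx.le
  have := le_csSup hbdd hmem
  linarith

/-- Points of a path from `x` to `y` that is nearly of minimal length divide the distance. -/
theorem exists_between_of_isRiemannianManifold (n : ℕ) {M : Type*} [MetricSpace M]
    [ChartedSpace (EuclideanSpace ℝ (Fin n)) M] [IsManifold (𝓡 n) ∞ M]
    [RiemannianBundle (fun x : M => TangentSpace (𝓡 n) x)] [IsRiemannianManifold (𝓡 n) M]
    (x y : M) (s t : ℝ) (hs : 0 ≤ s) (ht : 0 < t)
    (h : dist x y < s + t) : ∃ z, dist x z ≤ s ∧ dist z y < t := by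
  by_cases hxy : dist x y ≤ s
  · exact ⟨y, hxy, by simpa using ht⟩
  push Not at hxy
  have h1 : riemannianEDist (𝓡 n) x y < ENNReal.ofReal (s + t) := by
    rw [← IsRiemannianManifold.out (I := 𝓡 n), edist_dist]
    exact (ENNReal.ofReal_lt_ofReal_iff (by linarith)).2 h
  obtain ⟨γ, hγ0, hγ1, hγ, hlen⟩ := exists_lt_of_riemannianEDist_lt h1
  have hc : ContinuousOn (fun τ => dist x (γ τ)) (Icc 0 1) :=
    (continuous_const.dist continuous_id).comp_continuousOn hγ.continuousOn
  obtain ⟨τ, hτ, hτs⟩ := intermediate_value_Icc zero_le_one hc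
    (show s ∈ Icc (dist x (γ 0)) (dist x (γ 1)) by
      rw [hγ0, hγ1, dist_self]; exact ⟨hs, hxy.le⟩)
  refine ⟨γ τ, hτs.le, ?_⟩
  have e1 : edist x (γ τ) ≤ pathELength (𝓡 n) γ 0 τ := by
    rw [IsRiemannianManifold.out (I := 𝓡 n)]
    exact riemannianEDist_le_pathELength (hγ.mono (Icc_subset_Icc le_rfl hτ.2)) hγ0 rfl hτ.1
  have e2 : edist (γ τ) y ≤ pathELength (𝓡 n) γ τ 1 := by
    rw [IsRiemannianManifold.out (I := 𝓡 n)]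
    exact riemannianEDist_le_pathELength (hγ.mono (Icc_subset_Icc hτ.1 le_rfl)) rfl hγ1 hτ.2
  rw [← pathELength_add hτ.1 hτ.2] at hlen
  have e3 := (add_le_add e1 e2).trans_lt hlen
  rw [edist_dist, edist_dist, ← ENNReal.ofReal_add dist_nonneg dist_nonneg,
    ENNReal.ofReal_lt_ofReal_iff (by linarith)] at e3
  simp only at hτs
  linarith

theorem properSpace_of_isRiemannianManifold (n : ℕ) (M : Type*) [MetricSpace M]
    [ChartedSpace (EuclideanSpace ℝ (Fin n)) M] [IsManifold (𝓡 n) ∞ M]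
    [RiemannianBundle (fun x : M => TangentSpace (𝓡 n) x)] [IsRiemannianManifold (𝓡 n) M]
    [CompleteSpace M] : ProperSpace M :=
  haveI : LocallyCompactSpace M := ChartedSpace.locallyCompactSpace (EuclideanSpace ℝ (Fin n)) M
  properSpace_of_exists_between (exists_between_of_isRiemannianManifold n)

/-- The distance in a metric space is finite, so any two points are joined by a path. -/
theorem preconnectedSpace_of_isRiemannianManifold (n : ℕ) (M : Type*) [MetricSpace M]
    [ChartedSpace (EuclideanSpace ℝ (Fin n)) M] [IsManifold (𝓡 n) ∞ M]
    [RiemannianBundle (fun x : M => TangentSpace (𝓡 n) x)] [IsRiemannianManifold (𝓡 n) M] :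
    PreconnectedSpace M := by
  refine ⟨isPreconnected_of_forall_pair fun x _ y _ => ?_⟩
  have h1 : riemannianEDist (𝓡 n) x y < ⊤ := by
    rw [← IsRiemannianManifold.out (I := 𝓡 n)]
    exact edist_lt_top x y
  obtain ⟨γ, hγ0, hγ1, hγ, -⟩ := exists_lt_of_riemannianEDist_lt h1
  exact ⟨γ '' Icc 0 1, subset_univ _, ⟨0, by simp, hγ0⟩, ⟨1, by simp, hγ1⟩,
    isPreconnected_Icc.image γ hγ.continuousOn⟩

end HopfRinow

/-! ### Comparison with Euclidean balls in charts -/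

section Chart

variable (n : ℕ) {M : Type*} [MetricSpace M] [ChartedSpace (EuclideanSpace ℝ (Fin n)) M]

/-- The coordinate ball of radius `r` around `x₀`, in the preferred chart at `x₀`. -/
def chartBall (x₀ : M) (r : ℝ) : Set M :=
  (chartAt (EuclideanSpace ℝ (Fin n)) x₀).source ∩
    chartAt (EuclideanSpace ℝ (Fin n)) x₀ ⁻¹'
      Metric.ball (chartAt (EuclideanSpace ℝ (Fin n)) x₀ x₀) r

/-- The Euclidean ball that the chart at `x₀` identifies with `chartBall n x₀ r`. -/
abbrev coordBall (x₀ : M) (r : ℝ) : Set (EuclideanSpace ℝ (Fin n)) :=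
  Metric.ball (chartAt (EuclideanSpace ℝ (Fin n)) x₀ x₀) r

theorem isOpen_chartBall (x₀ : M) (r : ℝ) : IsOpen (chartBall n x₀ r) :=
  (chartAt (EuclideanSpace ℝ (Fin n)) x₀).isOpen_inter_preimage Metric.isOpen_ball

theorem mem_chartBall_self (x₀ : M) {r : ℝ} (hr : 0 < r) : x₀ ∈ chartBall n x₀ r :=
  ⟨mem_chart_source _ _, Metric.mem_ball_self hr⟩

theorem chartBall_mono (x₀ : M) {r s : ℝ} (h : r ≤ s) : chartBall n x₀ r ⊆ chartBall n x₀ s :=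
  inter_subset_inter_right _ (preimage_mono (Metric.ball_subset_ball h))

variable [IsManifold (𝓡 n) ∞ M]

/-- The inverse of a chart is smooth on its target. -/
theorem contMDiffAt_chartAt_symm (x₀ : M) {y : EuclideanSpace ℝ (Fin n)}
    (hy : y ∈ (chartAt (EuclideanSpace ℝ (Fin n)) x₀).target) :
    ContMDiffAt (𝓡 n) (𝓡 n) ∞ (chartAt (EuclideanSpace ℝ (Fin n)) x₀).symm y :=
  (contMDiffOn_chart_symm (I := 𝓡 n) (x := x₀)).contMDiffAt
    ((chartAt (EuclideanSpace ℝ (Fin n)) x₀).open_target.mem_nhds hy)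

theorem contDiffAt_comp_chartAt_symm {φ : M → ℝ} (hφ : ContMDiff (𝓡 n) 𝓘(ℝ, ℝ) ∞ φ) (x₀ : M)
    {y : EuclideanSpace ℝ (Fin n)} (hy : y ∈ (chartAt (EuclideanSpace ℝ (Fin n)) x₀).target) :
    ContDiffAt ℝ ∞ (φ ∘ (chartAt (EuclideanSpace ℝ (Fin n)) x₀).symm) y :=
  contMDiffAt_iff_contDiffAt.1 (hφ.contMDiffAt.comp y (contMDiffAt_chartAt_symm n x₀ hy))

/-- The frame of the tangent bundle that the trivialization at `x₀` provides is the coordinate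
frame. -/
theorem frameAt_chartAt_symm (x₀ : M) {y : EuclideanSpace ℝ (Fin n)}
    (hy : y ∈ (chartAt (EuclideanSpace ℝ (Fin n)) x₀).target) (v : EuclideanSpace ℝ (Fin n)) :
    frameAt n x₀ ((chartAt (EuclideanSpace ℝ (Fin n)) x₀).symm y) v =
      (mfderiv (𝓡 n) (𝓡 n) (chartAt (EuclideanSpace ℝ (Fin n)) x₀).symm y v :
        TangentSpace (𝓡 n) ((chartAt (EuclideanSpace ℝ (Fin n)) x₀).symm y)) := by
  set e := chartAt (EuclideanSpace ℝ (Fin n)) x₀ with he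
  have h1 := TangentBundle.symmL_trivializationAt (𝕜 := ℝ) (I := 𝓡 n) (x₀ := x₀)
    (x := e.symm y) (e.map_target hy)
  have h2 : extChartAt (𝓡 n) x₀ (e.symm y) = y := by
    simp [extChartAt, ← he, e.right_inv hy]
  have h3 : ∀ q, q = y → (mfderivWithin (𝓡 n) (𝓡 n) (extChartAt (𝓡 n) x₀).symm
      (range (𝓡 n)) q v : EuclideanSpace ℝ (Fin n)) =
      (mfderiv (𝓡 n) (𝓡 n) e.symm y v : EuclideanSpace ℝ (Fin n)) := by
    rintro _ rfl
    simp [extChartAt, mfderivWithin_univ]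
    rfl
  exact (congrArg (fun L => L v) h1).trans (h3 _ h2)

theorem fderiv_comp_chartAt_symm {φ : M → ℝ} (hφ : ContMDiff (𝓡 n) 𝓘(ℝ, ℝ) ∞ φ) (x₀ : M)
    {y : EuclideanSpace ℝ (Fin n)} (hy : y ∈ (chartAt (EuclideanSpace ℝ (Fin n)) x₀).target) :
    fderiv ℝ (φ ∘ (chartAt (EuclideanSpace ℝ (Fin n)) x₀).symm) y =
      (mvfderiv (𝓡 n) φ ((chartAt (EuclideanSpace ℝ (Fin n)) x₀).symm y)).comp
        (frameAt n x₀ ((chartAt (EuclideanSpace ℝ (Fin n)) x₀).symm y)) := by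
  ext v
  have h1 := mvfderiv_comp_apply (I := 𝓡 n) (I' := 𝓡 n) (g := φ)
    (f := (chartAt (EuclideanSpace ℝ (Fin n)) x₀).symm) y
    ((hφ.mdifferentiable (by simp)) _)
    ((contMDiffAt_chartAt_symm n x₀ hy).mdifferentiableAt (by simp)) v
  rw [ContinuousLinearMap.comp_apply, frameAt_chartAt_symm n x₀ hy, ← mfderiv_eq_fderiv]
  exact h1

variable [RiemannianBundle (fun x : M => TangentSpace (𝓡 n) x)]

/-- In the coordinate ball of radius `r` around `x₀`, which is contained in the domain of the
chart, the measure `μ` and the Riemannian norm of differentials agree with their Euclidean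
counterparts up to the factor `C`. -/
structure IsComparisonBall [MeasurableSpace M] (μ : Measure M) (x₀ : M) (r : ℝ) (C : NNReal) :
    Prop where
  pos : 0 < r
  subset_target : coordBall n x₀ r ⊆ (chartAt (EuclideanSpace ℝ (Fin n)) x₀).target
  enorm_fderiv_le : ∀ y ∈ coordBall n x₀ r, ∀ φ : M → ℝ, ContMDiff (𝓡 n) 𝓘(ℝ, ℝ) ∞ φ →
    ‖fderiv ℝ (φ ∘ (chartAt (EuclideanSpace ℝ (Fin n)) x₀).symm) y‖ₑ ≤
      C * ‖mvfderiv (𝓡 n) φ ((chartAt (EuclideanSpace ℝ (Fin n)) x₀).symm y)‖ₑ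
  enorm_mvfderiv_le : ∀ y ∈ coordBall n x₀ r, ∀ φ : M → ℝ, ContMDiff (𝓡 n) 𝓘(ℝ, ℝ) ∞ φ →
    ‖mvfderiv (𝓡 n) φ ((chartAt (EuclideanSpace ℝ (Fin n)) x₀).symm y)‖ₑ ≤
      C * ‖fderiv ℝ (φ ∘ (chartAt (EuclideanSpace ℝ (Fin n)) x₀).symm) y‖ₑ
  lintegral_le : ∀ F : M → ℝ≥0∞, Measurable F → ∫⁻ x in chartBall n x₀ r, F x ∂μ ≤
      C * ∫⁻ y in coordBall n x₀ r, F ((chartAt (EuclideanSpace ℝ (Fin n)) x₀).symm y)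
  le_lintegral : ∀ F : M → ℝ≥0∞, Measurable F →
      ∫⁻ y in coordBall n x₀ r, F ((chartAt (EuclideanSpace ℝ (Fin n)) x₀).symm y) ≤
        C * ∫⁻ x in chartBall n x₀ r, F x ∂μ

theorem det_chartGram_pos (x₀ : M) {y : EuclideanSpace ℝ (Fin n)}
    (hy : y ∈ (chartAt (EuclideanSpace ℝ (Fin n)) x₀).target) :
    0 < (chartGram n (chartAt (EuclideanSpace ℝ (Fin n)) x₀) y).det := by
  set e := chartAt (EuclideanSpace ℝ (Fin n)) x₀ with he
  let b := (EuclideanSpace.basisFun (Fin n) ℝ).toBasis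
  have hb : e.symm y ∈ (trivializationAt (EuclideanSpace ℝ (Fin n))
      (fun x : M => TangentSpace (𝓡 n) x) x₀).baseSet := by
    simpa using e.map_target hy
  let A := ((trivializationAt (EuclideanSpace ℝ (Fin n))
    (fun x : M => TangentSpace (𝓡 n) x) x₀).continuousLinearEquivAt ℝ (e.symm y) hb).symm
  have hA : ∀ v, A v = frameAt n x₀ (e.symm y) v := fun v => by
    rw [frameAt, ← Trivialization.symm_continuousLinearEquivAt_eq _ hb]
  have hli : LinearIndependent ℝ fun i : Fin n =>
      (mfderiv (𝓡 n) (𝓡 n) e.symm y (EuclideanSpace.single i 1) :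
        TangentSpace (𝓡 n) (e.symm y)) := by
    have h1 := b.linearIndependent.map' (A : EuclideanSpace ℝ (Fin n) →ₗ[ℝ]
      TangentSpace (𝓡 n) (e.symm y)) (LinearMap.ker_eq_bot.2 A.injective)
    have h2 : (fun i : Fin n => (mfderiv (𝓡 n) (𝓡 n) e.symm y (EuclideanSpace.single i 1) :
        TangentSpace (𝓡 n) (e.symm y))) = A ∘ b := by
      ext1 i
      rw [← frameAt_chartAt_symm n x₀ hy, ← hA]
      simp [b]
    rw [h2]
    exact h1
  exact (Matrix.posDef_gram_of_linearIndependent hli).det_pos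

variable [IsContMDiffRiemannianBundle (𝓡 n) ∞ (EuclideanSpace ℝ (Fin n))
    (fun x : M => TangentSpace (𝓡 n) x)]

theorem isContinuousRiemannianBundle :
    IsContinuousRiemannianBundle (EuclideanSpace ℝ (Fin n))
      (fun x : M => TangentSpace (𝓡 n) x) := by
  obtain ⟨g, hg, h⟩ := IsContMDiffRiemannianBundle.exists_contMDiff (IB := 𝓡 n) (n := ∞)
    (F := EuclideanSpace ℝ (Fin n)) (E := (fun x : M => TangentSpace (𝓡 n) x))
  exact ⟨g, hg.continuous, h⟩

/-- Every point has a comparison ball, by continuity of the metric and of the density of `μ`. -/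
theorem exists_isComparisonBall [MeasurableSpace M] [BorelSpace M] (μ : Measure M)
    [hμ : IsWeightedMeasure n μ] (x₀ : M) : ∃ r C, IsComparisonBall n μ x₀ r C := by
  have := isContinuousRiemannianBundle n (M := M)
  obtain ⟨f, hf, hdens⟩ := hμ.exists_density
  set E := EuclideanSpace ℝ (Fin n)
  set e := chartAt E x₀ with he
  have hx₀ : x₀ ∈ e.source := mem_chart_source _ _
  let ρ : M → ℝ := fun x => Real.exp (f x) * √(Matrix.of fun i j : Fin n =>
      ⟪frameAt n x₀ x (EuclideanSpace.single i 1),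
        frameAt n x₀ x (EuclideanSpace.single j 1)⟫_ℝ).det
  have hρ : ContinuousAt ρ x₀ := by
    refine (Real.continuous_exp.comp hf.continuous).continuousAt.mul
      (Real.continuous_sqrt.continuousAt.comp ?_)
    exact ContinuousAt.comp (g := Matrix.det) (continuous_id.matrix_det.continuousAt)
      (continuousAt_pi.2 fun i => continuousAt_pi.2 fun j =>
        continuousAt_inner_frameAt n x₀ x₀ hx₀ _ _)
  have hρe : ∀ y ∈ e.target, Real.exp (f (e.symm y)) * √(chartGram n e y).det = ρ (e.symm y) := by
    intro y hy
    rw [he, chartGram_chartAt n x₀ hy]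
  have hρ0 : 0 < ρ x₀ := by
    have h1 := hρe (e x₀) (e.map_source hx₀)
    rw [e.left_inv hx₀] at h1
    rw [← h1]
    exact mul_pos (Real.exp_pos _) (Real.sqrt_pos.2 (det_chartGram_pos n x₀ (e.map_source hx₀)))
  obtain ⟨C₁, hC₁, h₁⟩ := eventually_norm_trivializationAt_lt E
    (fun x : M => TangentSpace (𝓡 n) x) x₀
  obtain ⟨C₂, hC₂, h₂⟩ := eventually_norm_symmL_trivializationAt_lt E
    (fun x : M => TangentSpace (𝓡 n) x) x₀
  have h₃ : ∀ᶠ x in 𝓝 x₀, ρ x < ρ x₀ + 1 := hρ.eventually_lt continuousAt_const (by simp)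
  have h₄ : ∀ᶠ x in 𝓝 x₀, ρ x₀ / 2 < ρ x := continuousAt_const.eventually_lt hρ (by linarith)
  have hev := ((h₁.and h₂).and (h₃.and h₄))
  have hsymm : Tendsto e.symm (𝓝 (e x₀)) (𝓝 x₀) := e.tendsto_symm hx₀
  obtain ⟨r, hr, hball⟩ := Metric.eventually_nhds_iff_ball.1
    ((hsymm.eventually hev).and (e.open_target.mem_nhds (e.map_source hx₀)))
  -- a common bound for the frame, its inverse, the density and its inverse
  set C : ℝ := C₁ + C₂ + (ρ x₀ + 1) + 2 / ρ x₀ with hC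
  have hCpos : 0 < 2 / ρ x₀ := by positivity
  have hsub : coordBall n x₀ r ⊆ e.target := fun y hy => (hball y hy).2
  have hec : ContinuousOn e.symm (coordBall n x₀ r) := e.continuousOn_symm.mono hsub
  have hem : AEMeasurable e.symm (volume.restrict (coordBall n x₀ r)) :=
    hec.aemeasurable Metric.isOpen_ball.measurableSet
  have hB : MeasurableSet (chartBall n x₀ r) := (isOpen_chartBall n x₀ r).measurableSet
  have hset : ∀ A : Set M, e.target ∩ e.symm ⁻¹' (A ∩ chartBall n x₀ r) =
      e.symm ⁻¹' A ∩ coordBall n x₀ r := by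
    intro A
    ext y
    constructor
    · rintro ⟨hy, hyA, -, hyb⟩
      refine ⟨hyA, ?_⟩
      change e (e.symm y) ∈ Metric.ball (e x₀) r at hyb
      rwa [e.right_inv hy] at hyb
    · rintro ⟨hyA, hyb⟩
      refine ⟨hsub hyb, hyA, e.map_target (hsub hyb), ?_⟩
      change e (e.symm y) ∈ Metric.ball (e x₀) r
      rwa [e.right_inv (hsub hyb)]
  have hmeas : ∀ A, MeasurableSet A → MeasurableSet (e.symm ⁻¹' A ∩ coordBall n x₀ r) := by
    intro A hA
    have h5 := measurableSet_ball.subtype_image (hec.domRestrict.measurable hA)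
    convert h5 using 1
    ext y
    simp [and_comm]
  have hμA : ∀ A, MeasurableSet A → μ.restrict (chartBall n x₀ r) A =
      ∫⁻ y in e.symm ⁻¹' A ∩ coordBall n x₀ r, ENNReal.ofReal (ρ (e.symm y)) := by
    intro A hA
    rw [Measure.restrict_apply hA, hdens e (chart_mem_atlas _ _) _ (hA.inter hB)
      (fun x hx => hx.2.1), hset]
    refine setLIntegral_congr_fun (hmeas A hA) fun y hy => ?_
    simp only [hρe y (hsub hy.2)]
  have hmap : ∀ A, MeasurableSet A → (volume.restrict (coordBall n x₀ r)).map e.symm A =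
      volume (e.symm ⁻¹' A ∩ coordBall n x₀ r) := by
    intro A hA
    rw [Measure.map_apply_of_aemeasurable hem hA, Measure.restrict_apply' measurableSet_ball]
  have hle : μ.restrict (chartBall n x₀ r) ≤
      C.toNNReal • (volume.restrict (coordBall n x₀ r)).map e.symm := by
    refine Measure.le_iff.2 fun A hA => ?_
    rw [hμA A hA, Measure.smul_apply, hmap A hA]
    refine (setLIntegral_mono' (hmeas A hA) (g := fun _ => (C.toNNReal : ℝ≥0∞))
      fun y hy => ?_).trans (setLIntegral_const _ _).le
    refine ENNReal.ofReal_le_ofReal ?_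
    have := (hball y hy.2).1.2.1
    linarith
  have hge : (volume.restrict (coordBall n x₀ r)).map e.symm ≤
      C.toNNReal • μ.restrict (chartBall n x₀ r) := by
    refine Measure.le_iff.2 fun A hA => ?_
    rw [Measure.smul_apply, hμA A hA, hmap A hA]
    change _ ≤ (C.toNNReal : ℝ≥0∞) * _
    rw [← lintegral_const_mul' _ _ ENNReal.coe_ne_top, ← setLIntegral_one]
    refine setLIntegral_mono' (hmeas A hA) fun y hy => ?_
    change 1 ≤ ENNReal.ofReal C * _
    rw [← ENNReal.ofReal_mul (by linarith), ← ENNReal.ofReal_one]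
    refine ENNReal.ofReal_le_ofReal ?_
    have h5 := (hball y hy.2).1.2.2
    calc (1 : ℝ) = 2 / ρ x₀ * (ρ x₀ / 2) := by field_simp
      _ ≤ C * ρ (e.symm y) := by gcongr; linarith
  refine ⟨r, C.toNNReal, hr, hsub, ?_, ?_, ?_, ?_⟩
  · intro y hy φ hφ
    rw [fderiv_comp_chartAt_symm n hφ x₀ (hsub hy)]
    have h6 : ‖frameAt n x₀ (e.symm y)‖ₑ ≤ (C.toNNReal : ℝ≥0∞) := by
      rw [← ofReal_norm]
      exact ENNReal.ofReal_le_ofReal (by have := (hball y hy).1.1.2; linarith)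
    refine (ContinuousLinearMap.opENorm_comp_le _ _).trans ?_
    rw [mul_comm]
    gcongr
  · intro y hy φ hφ
    rw [fderiv_comp_chartAt_symm n hφ x₀ (hsub hy)]
    have hb : e.symm y ∈ (trivializationAt E (fun x : M => TangentSpace (𝓡 n) x) x₀).baseSet := by
      simpa using e.map_target (hsub hy)
    have h6 : ‖(trivializationAt E (fun x : M => TangentSpace (𝓡 n) x) x₀).continuousLinearMapAt ℝ
        (e.symm y)‖ₑ ≤ (C.toNNReal : ℝ≥0∞) := by
      rw [← ofReal_norm]
      exact ENNReal.ofReal_le_ofReal (by have := (hball y hy).1.1.1; linarith)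
    have h7 : mvfderiv (𝓡 n) φ (e.symm y) =
        ((mvfderiv (𝓡 n) φ (e.symm y)).comp (frameAt n x₀ (e.symm y))).comp
          ((trivializationAt E (fun x : M => TangentSpace (𝓡 n) x) x₀).continuousLinearMapAt ℝ
            (e.symm y)) := by
      ext w
      simp only [ContinuousLinearMap.comp_apply, frameAt]
      rw [Trivialization.symmL_continuousLinearMapAt _ hb]
    calc ‖mvfderiv (𝓡 n) φ (e.symm y)‖ₑ ≤ _ :=
          (congrArg enorm h7).trans_le (ContinuousLinearMap.opENorm_comp_le _ _)
      _ ≤ _ := by rw [mul_comm]; gcongr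
  · intro F hF
    refine (lintegral_mono' hle le_rfl).trans_eq ?_
    rw [lintegral_smul_measure, lintegral_map' hF.aemeasurable hem]
    rfl
  · intro F hF
    rw [← lintegral_map' hF.aemeasurable hem]
    refine (lintegral_mono' hge le_rfl).trans_eq ?_
    rw [lintegral_smul_measure]
    rfl

end Chart

section ComparisonBallMeasure

variable {n : ℕ} {M : Type*} [MetricSpace M] [ChartedSpace (EuclideanSpace ℝ (Fin n)) M]
  [RiemannianBundle (fun x : M => TangentSpace (𝓡 n) x)] [MeasurableSpace M] {μ : Measure M}
  {x₀ : M} {r : ℝ} {C : NNReal}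

namespace IsComparisonBall

theorem measure_lt_top (h : IsComparisonBall n μ x₀ r C) : μ (chartBall n x₀ r) < ⊤ := by
  have h1 := h.lintegral_le (fun _ => 1) measurable_const
  simp only [lintegral_one, Measure.restrict_apply, MeasurableSet.univ, univ_inter] at h1
  exact h1.trans_lt (ENNReal.mul_lt_top ENNReal.coe_lt_top measure_ball_lt_top)

theorem measure_inter_pos [OpensMeasurableSpace M] (h : IsComparisonBall n μ x₀ r C) {U : Set M} (hU : IsOpen U)
    (hne : (U ∩ chartBall n x₀ r).Nonempty) : 0 < μ (U ∩ chartBall n x₀ r) := by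
  set e := chartAt (EuclideanSpace ℝ (Fin n)) x₀
  have h1 := h.le_lintegral (U.indicator fun _ => 1) (measurable_const.indicator hU.measurableSet)
  rw [lintegral_indicator hU.measurableSet, Measure.restrict_restrict hU.measurableSet,
    setLIntegral_one] at h1
  set V := coordBall n x₀ r ∩ e.symm ⁻¹' U
  have hV : IsOpen V := (e.continuousOn_symm.mono h.subset_target).isOpen_inter_preimage
    Metric.isOpen_ball hU
  have hVne : V.Nonempty := by
    obtain ⟨x, hxU, hxs, hxb⟩ := hne
    exact ⟨e x, hxb, by rwa [mem_preimage, e.left_inv hxs]⟩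
  have h2 : volume V ≤ ∫⁻ y in coordBall n x₀ r, U.indicator (fun _ => 1) (e.symm y) := by
    rw [← setLIntegral_one, ← lintegral_indicator hV.measurableSet,
      ← lintegral_indicator measurableSet_ball]
    refine lintegral_mono fun y => ?_
    by_cases hy : y ∈ V
    · rw [indicator_of_mem hy, indicator_of_mem hy.1,
        indicator_of_mem (show e.symm y ∈ U from hy.2)]
    · rw [indicator_of_notMem hy]
      exact zero_le
  have h3 := (hV.measure_pos volume hVne).trans_le (h2.trans h1)
  exact pos_iff_ne_zero.2 (right_ne_zero_of_mul h3.ne')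

end IsComparisonBall

end ComparisonBallMeasure

/-! ### The Poincaré inequality in Euclidean balls -/

section Poincare

theorem sq_lintegral_mul_le {α : Type*} [MeasurableSpace α] (μ : Measure α) {f g : α → ℝ≥0∞}
    (hf : AEMeasurable f μ) (hg : AEMeasurable g μ) :
    (∫⁻ x, f x * g x ∂μ) ^ 2 ≤ (∫⁻ x, f x ^ 2 ∂μ) * ∫⁻ x, g x ^ 2 ∂μ := by
  have h := ENNReal.lintegral_mul_le_Lp_mul_Lq μ Real.HolderConjugate.two_two hf hg
  simp only [ENNReal.rpow_two] at h
  have h2 : ∀ a : ℝ≥0∞, (a ^ (1 / 2 : ℝ)) ^ 2 = a := fun a => by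
    rw [← ENNReal.rpow_two, ← ENNReal.rpow_mul]; simp
  calc (∫⁻ x, f x * g x ∂μ) ^ 2 ≤ _ := pow_le_pow_left' h 2
    _ = _ := by rw [mul_pow, h2, h2]

theorem add_sq_le_two_mul (a b : ℝ≥0∞) : (a + b) ^ 2 ≤ 2 * (a ^ 2 + b ^ 2) := by
  rcases eq_or_ne a ⊤ with rfl | ha
  · simp
  rcases eq_or_ne b ⊤ with rfl | hb
  · simp
  lift a to NNReal using ha
  lift b to NNReal using hb
  exact_mod_cast add_sq_le (a := a) (b := b)

theorem enorm_add_sq_le (a b : ℝ) : ‖a + b‖ₑ ^ 2 ≤ 2 * (‖a‖ₑ ^ 2 + ‖b‖ₑ ^ 2) :=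
  (pow_le_pow_left' (enorm_add_le a b) 2).trans (add_sq_le_two_mul _ _)


variable {E : Type*} [NormedAddCommGroup E] [NormedSpace ℝ E] [MeasurableSpace E] [BorelSpace E]

/-- The square of an increment is bounded by the integral of the square of the derivative. -/
theorem enorm_sub_sq_le_lintegral_lineMap {u : E → ℝ} {s : Set E} (hs : IsOpen s)
    (hc : Convex ℝ s) (hu : ContDiffOn ℝ 1 u s) {x y : E} (hx : x ∈ s) (hy : y ∈ s) :
    ‖u y - u x‖ₑ ^ 2 ≤ ‖y - x‖ₑ ^ 2 *
      ∫⁻ t in Icc (0 : ℝ) 1, ‖fderiv ℝ u (AffineMap.lineMap x y t)‖ₑ ^ 2 := by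
  set γ : ℝ → E := fun t => AffineMap.lineMap x y t with hγ
  have hγs : MapsTo γ (Icc 0 1) s := fun t ht => hc.lineMap_mem hx hy ht
  have hγd : ContDiff ℝ 1 γ := by
    simp only [hγ, AffineMap.lineMap_apply_module']
    fun_prop
  have h1 := enorm_sub_le_lintegral_deriv_of_contDiffOn_Icc (hu.comp hγd.contDiffOn hγs)
    zero_le_one
  have h2 : ∫⁻ t in Icc (0 : ℝ) 1, ‖deriv (u ∘ γ) t‖ₑ ≤
      ∫⁻ t in Icc (0 : ℝ) 1, ‖fderiv ℝ u (γ t)‖ₑ * ‖y - x‖ₑ := by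
    refine setLIntegral_mono' measurableSet_Icc fun t ht => ?_
    have h3 : HasDerivAt γ (y - x) t := by
      simpa [hγ] using (AffineMap.hasDerivAt_lineMap (a := x) (b := y) (x := t))
    have h4 : HasFDerivAt u (fderiv ℝ u (γ t)) (γ t) :=
      ((hu.contDiffAt (hs.mem_nhds (hγs ht))).differentiableAt (by simp)).hasFDerivAt
    rw [(h4.comp_hasDerivAt t h3).deriv]
    exact ContinuousLinearMap.le_opENorm _ _
  have hm : Measurable fun t => ‖fderiv ℝ u (γ t)‖ₑ :=
    ((measurable_fderiv ℝ u).comp hγd.continuous.measurable).enorm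
  have h5 := sq_lintegral_mul_le (volume.restrict (Icc (0 : ℝ) 1)) hm.aemeasurable
    (aemeasurable_const (b := ‖y - x‖ₑ))
  rw [lintegral_const] at h5
  simp only [MeasurableSet.univ, Measure.restrict_apply, univ_inter, Real.volume_Icc, sub_zero,
    ENNReal.ofReal_one, mul_one] at h5
  have h6 : ‖u y - u x‖ₑ ≤ ∫⁻ t in Icc (0 : ℝ) 1, ‖fderiv ℝ u (γ t)‖ₑ * ‖y - x‖ₑ := by
    refine le_trans (le_of_eq ?_) (h1.trans h2)
    simp [hγ]
  calc ‖u y - u x‖ₑ ^ 2 ≤ _ := pow_le_pow_left' h6 2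
    _ ≤ _ := h5
    _ = _ := mul_comm _ _

variable [FiniteDimensional ℝ E] (ν : Measure E) [ν.IsAddHaarMeasure]

theorem lintegral_comp_add_smul_le {G : E → ℝ≥0∞} (hG : Measurable G) (a : E) {t : ℝ}
    (ht : 1 / 2 ≤ t) :
    ∫⁻ y, G (a + t • y) ∂ν ≤ 2 ^ Module.finrank ℝ E * ∫⁻ y, G y ∂ν := by
  have ht0 : 0 < t := by linarith
  have h1 : ∫⁻ y, G (a + t • y) ∂ν = ∫⁻ y, G (a + y) ∂(ν.map (t • ·)) := by
    rw [lintegral_map (by fun_prop) (by fun_prop)]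
  rw [h1, Measure.map_addHaar_smul ν ht0.ne', lintegral_smul_measure,
    lintegral_add_left_eq_self G a, smul_eq_mul]
  gcongr
  rw [abs_of_nonneg (by positivity), ← inv_pow, ENNReal.ofReal_pow (by positivity)]
  gcongr
  rw [show (2 : ℝ≥0∞) = ENNReal.ofReal 2 by simp]
  refine ENNReal.ofReal_le_ofReal ?_
  rw [inv_le_comm₀ ht0 two_pos]
  linarith

/-- The two-point form of the Poincaré inequality in a ball. Each point `(1 - t) x + t y` of a
segment is a dilation by a factor at least `1 / 2` of one of its endpoints. -/
theorem lintegral_lintegral_enorm_sub_sq_le {u : E → ℝ} {c : E} {r : ℝ}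
    (hu : ContDiffOn ℝ 1 u (Metric.ball c r)) :
    ∫⁻ x in Metric.ball c r, ∫⁻ y in Metric.ball c r, ‖u y - u x‖ₑ ^ 2 ∂ν ∂ν ≤
      ENNReal.ofReal (2 * r) ^ 2 * (2 ^ Module.finrank ℝ E * ν (Metric.ball c r)) *
        ∫⁻ y in Metric.ball c r, ‖fderiv ℝ u y‖ₑ ^ 2 ∂ν := by
  set B := Metric.ball c r
  have hB : MeasurableSet B := measurableSet_ball
  have hBc : Convex ℝ B := convex_ball c r
  set G : E → ℝ≥0∞ := B.indicator fun z => ‖fderiv ℝ u z‖ₑ ^ 2 with hG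
  have hGm : Measurable G := ((measurable_fderiv ℝ u).enorm.pow_const 2).indicator hB
  have hGi : ∫⁻ z, G z ∂ν = ∫⁻ y in B, ‖fderiv ℝ u y‖ₑ ^ 2 ∂ν := lintegral_indicator hB _
  have hlm : ∀ (x y : E) (t : ℝ), (AffineMap.lineMap x y t : E) = (1 - t) • x + t • y :=
    fun x y t => AffineMap.lineMap_apply_module x y t
  have hcont : Continuous fun p : (E × E) × ℝ => (1 - p.2) • p.1.1 + p.2 • p.1.2 := by fun_prop
  have hG3 : Measurable fun p : (E × E) × ℝ => G ((1 - p.2) • p.1.1 + p.2 • p.1.2) :=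
    hGm.comp hcont.measurable
  have h1 : ∀ x ∈ B, ∀ y ∈ B, ‖u y - u x‖ₑ ^ 2 ≤ ENNReal.ofReal (2 * r) ^ 2 *
      ∫⁻ t in Icc (0 : ℝ) 1, G ((1 - t) • x + t • y) := by
    intro x hx y hy
    refine (enorm_sub_sq_le_lintegral_lineMap Metric.isOpen_ball hBc hu hx hy).trans ?_
    gcongr ?_ ^ 2 * ?_
    · rw [← ofReal_norm, ← dist_eq_norm]
      refine ENNReal.ofReal_le_ofReal ?_
      have h2 := dist_triangle_right y x c
      rw [Metric.mem_ball] at hx hy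
      linarith
    · refine le_of_eq (setLIntegral_congr_fun measurableSet_Icc fun t ht => ?_)
      have h3 : (1 - t) • x + t • y ∈ B := by
        rw [← hlm]; exact hBc.lineMap_mem hx hy ht
      simp only [hlm, hG, indicator_of_mem h3]
  have h2 : ∀ t ∈ Icc (0 : ℝ) 1, ∫⁻ x in B, ∫⁻ y in B, G ((1 - t) • x + t • y) ∂ν ∂ν ≤
      2 ^ Module.finrank ℝ E * ν B * ∫⁻ z, G z ∂ν := by
    intro t ht
    rcases le_total (1 / 2) t with h | h
    · calc ∫⁻ x in B, ∫⁻ y in B, G ((1 - t) • x + t • y) ∂ν ∂ν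
          ≤ ∫⁻ _ in B, 2 ^ Module.finrank ℝ E * ∫⁻ z, G z ∂ν ∂ν :=
            lintegral_mono fun x => (setLIntegral_le_lintegral _ _).trans
              (lintegral_comp_add_smul_le ν hGm _ h)
        _ = _ := by rw [setLIntegral_const]; ring
    · rw [lintegral_lintegral_swap]
      · calc ∫⁻ y in B, ∫⁻ x in B, G ((1 - t) • x + t • y) ∂ν ∂ν
            ≤ ∫⁻ _ in B, 2 ^ Module.finrank ℝ E * ∫⁻ z, G z ∂ν ∂ν := by
              refine lintegral_mono fun y => (setLIntegral_le_lintegral _ _).trans ?_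
              simp only [add_comm ((1 - t) • _)]
              exact lintegral_comp_add_smul_le ν hGm _ (by linarith)
          _ = _ := by rw [setLIntegral_const]; ring
      · exact (hGm.comp (by fun_prop :
          Measurable fun p : E × E => (1 - t) • p.1 + t • p.2)).aemeasurable
  calc ∫⁻ x in B, ∫⁻ y in B, ‖u y - u x‖ₑ ^ 2 ∂ν ∂ν
      ≤ ∫⁻ x in B, ∫⁻ y in B, ENNReal.ofReal (2 * r) ^ 2 *
          (∫⁻ t in Icc (0 : ℝ) 1, G ((1 - t) • x + t • y)) ∂ν ∂ν :=
        setLIntegral_mono' hB fun x hx => setLIntegral_mono' hB fun y hy => h1 x hx y hy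
    _ = ENNReal.ofReal (2 * r) ^ 2 * ∫⁻ x in B, ∫⁻ y in B,
          (∫⁻ t in Icc (0 : ℝ) 1, G ((1 - t) • x + t • y)) ∂ν ∂ν := by
        have hf : ENNReal.ofReal (2 * r) ^ 2 ≠ ⊤ := by finiteness
        simp_rw [lintegral_const_mul' _ _ hf]
    _ = ENNReal.ofReal (2 * r) ^ 2 * ∫⁻ t in Icc (0 : ℝ) 1, (∫⁻ x in B, ∫⁻ y in B,
          G ((1 - t) • x + t • y) ∂ν ∂ν) := by
        congr 1
        have h3 : ∀ x, ∫⁻ y in B, (∫⁻ t in Icc (0 : ℝ) 1, G ((1 - t) • x + t • y)) ∂ν =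
            ∫⁻ t in Icc (0 : ℝ) 1, ∫⁻ y in B, G ((1 - t) • x + t • y) ∂ν := fun x =>
          lintegral_lintegral_swap (hG3.comp (by fun_prop :
            Measurable fun p : E × ℝ => ((x, p.1), p.2))).aemeasurable
        simp_rw [h3]
        refine lintegral_lintegral_swap (Measurable.aemeasurable ?_)
        exact Measurable.lintegral_prod_right' (f := fun p : (E × ℝ) × E =>
          G ((1 - p.1.2) • p.1.1 + p.1.2 • p.2)) (hG3.comp (by fun_prop :
            Measurable fun p : (E × ℝ) × E => ((p.1.1, p.2), p.1.2)))
    _ ≤ ENNReal.ofReal (2 * r) ^ 2 * ∫⁻ _ in Icc (0 : ℝ) 1,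
          2 ^ Module.finrank ℝ E * ν B * ∫⁻ z, G z ∂ν := by
        exact mul_le_mul' le_rfl (setLIntegral_mono' measurableSet_Icc h2)
    _ = _ := by
        rw [setLIntegral_const, hGi]
        simp
        ring

end Poincare

/-! ### Closability of the gradient in Euclidean balls -/

section EuclideanClosability

theorem enorm_sq_eq_ofReal (a : ℝ) : ‖a‖ₑ ^ 2 = ENNReal.ofReal (a ^ 2) := by
  rw [← ofReal_norm, ← ENNReal.ofReal_pow (norm_nonneg _), Real.norm_eq_abs, sq_abs]

theorem exists_contMDiff_cutoff {E H M : Type*} [NormedAddCommGroup E] [NormedSpace ℝ E]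
    [FiniteDimensional ℝ E] [TopologicalSpace H] (I : ModelWithCorners ℝ E H) [TopologicalSpace M]
    [ChartedSpace H M] [IsManifold I ∞ M] [T2Space M] [LocallyCompactSpace M] [SigmaCompactSpace M]
    {K U : Set M} (hK : IsCompact K) (hU : IsOpen U) (hKU : K ⊆ U) :
    ∃ χ : M → ℝ, ContMDiff I 𝓘(ℝ, ℝ) ∞ χ ∧ HasCompactSupport χ ∧ tsupport χ ⊆ U ∧
      (∀ x, χ x ∈ Icc (0 : ℝ) 1) ∧ ∀ᶠ x in 𝓝ˢ K, χ x = 1 := by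
  obtain ⟨L, hL, hKL, hLU⟩ := exists_compact_between hK hU hKU
  obtain ⟨f, hf1, hf0, hf⟩ := exists_contMDiffMap_one_nhds_of_subset_interior I (n := ⊤)
    hK.isClosed hKL
  have hsupp : tsupport f ⊆ L := closure_minimal (fun x hx => by
    by_contra h
    exact hx (hf0 x h)) hL.isClosed
  exact ⟨f, f.contMDiff, hL.of_isClosed_subset isClosed_closure hsupp, hsupp.trans hLU, hf, hf1⟩

variable {E : Type*} [NormedAddCommGroup E] [NormedSpace ℝ E]

theorem contDiff_mul_of_tsupport_subset {η g : E → ℝ} {s : Set E} (hs : IsOpen s)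
    (hη : ContDiff ℝ ∞ η) (hηs : tsupport η ⊆ s) (hg : ContDiffOn ℝ ∞ g s) :
    ContDiff ℝ ∞ fun x => η x * g x := by
  refine contDiff_iff_contDiffAt.2 fun x => ?_
  by_cases hx : x ∈ tsupport η
  · exact hη.contDiffAt.mul (hg.contDiffAt (hs.mem_nhds (hηs hx)))
  · refine contDiffAt_const (c := (0 : ℝ)) |>.congr_of_eventuallyEq ?_
    filter_upwards [notMem_tsupport_iff_eventuallyEq.1 hx] with y hy
    simp [hy]

variable [FiniteDimensional ℝ E] [MeasurableSpace E] [BorelSpace E] (ν : Measure E)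
  [ν.IsAddHaarMeasure]

/-- Integration by parts against a fixed test function `p` shows that the derivatives of a
sequence that tends to `0` in `L²` tend to `0` weakly. -/
theorem tendsto_integral_mul_fderiv_apply {s : Set E} (hs : IsOpen s) {p : E → ℝ}
    (hp : ContDiff ℝ ∞ p) (hpc : HasCompactSupport p) (hps : tsupport p ⊆ s) {u : ℕ → E → ℝ}
    (hu : ∀ j, ContDiffOn ℝ ∞ (u j) s)
    (hu0 : Tendsto (fun j => ∫⁻ x in s, ‖u j x‖ₑ ^ 2 ∂ν) atTop (𝓝 0)) (v : E) :
    Tendsto (fun j => ∫ x, p x * fderiv ℝ (u j) x v ∂ν) atTop (𝓝 0) := by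
  have hp' : ContDiff ℝ ∞ fun x => fderiv ℝ p x v :=
    (hp.fderiv_right (m := ∞) (by simp)).clm_apply contDiff_const
  have hsupp : tsupport (fun x => fderiv ℝ p x v) ⊆ tsupport p :=
    (closure_minimal (fun x hx => by
      by_contra hxs
      have h0 : p =ᶠ[𝓝 x] fun _ => 0 := notMem_tsupport_iff_eventuallyEq.1 hxs
      exact hx (by simp [h0.fderiv_eq])) isClosed_closure)
  have hpc' : HasCompactSupport fun x => fderiv ℝ p x v := hpc.of_isClosed_subset
    isClosed_closure hsupp
  have hu' : ∀ j, ContDiffOn ℝ ∞ (fun x => fderiv ℝ (u j) x v) s := fun j =>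
    ((hu j).fderiv_of_isOpen hs (by simp)).clm_apply contDiffOn_const
  have hint : ∀ (a g : E → ℝ), ContDiff ℝ ∞ a → HasCompactSupport a → tsupport a ⊆ s →
      ContDiffOn ℝ ∞ g s → Integrable (fun x => a x * g x) ν := fun a g ha hac has hg =>
    (contDiff_mul_of_tsupport_subset hs ha has hg).continuous.integrable_of_hasCompactSupport
      hac.mul_right
  have hibp : ∀ j, ∫ x, p x * fderiv ℝ (u j) x v ∂ν = - ∫ x, fderiv ℝ p x v * u j x ∂ν := by
    intro j
    refine integral_mul_fderiv_eq_neg_fderiv_mul_of_integrable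
      (hint _ _ hp' hpc' (hsupp.trans hps) (hu j)) (hint _ _ hp hpc hps (hu' j))
      (hint _ _ hp hpc hps (hu j)) (fun x _ => (hp.differentiable (by simp)) x) fun x hx => ?_
    exact ((hu j).contDiffAt (hs.mem_nhds (hps hx))).differentiableAt (by simp)
  have hpL : ∫⁻ x in s, ‖fderiv ℝ p x v‖ₑ ^ 2 ∂ν ≠ ⊤ := by
    have h1 : Integrable (fun x => fderiv ℝ p x v * fderiv ℝ p x v) ν :=
      (hp'.mul hp').continuous.integrable_of_hasCompactSupport hpc'.mul_right
    refine ((setLIntegral_le_lintegral _ _).trans_lt ?_).ne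
    simpa only [HasFiniteIntegral, ← sq, enorm_pow] using h1.2
  have hbound : ∀ j, ‖∫ x, p x * fderiv ℝ (u j) x v ∂ν‖ₑ ^ 2 ≤
      (∫⁻ x in s, ‖fderiv ℝ p x v‖ₑ ^ 2 ∂ν) * ∫⁻ x in s, ‖u j x‖ₑ ^ 2 ∂ν := by
    intro j
    have h2 : ∫ x, fderiv ℝ p x v * u j x ∂ν = ∫ x in s, fderiv ℝ p x v * u j x ∂ν := by
      refine (setIntegral_eq_integral_of_forall_compl_eq_zero fun x hx => ?_).symm
      rw [image_eq_zero_of_notMem_tsupport fun h => hx (hps (hsupp h)), zero_mul]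
    rw [hibp, enorm_neg, h2]
    calc ‖∫ x in s, fderiv ℝ p x v * u j x ∂ν‖ₑ ^ 2
        ≤ (∫⁻ x in s, ‖fderiv ℝ p x v‖ₑ * ‖u j x‖ₑ ∂ν) ^ 2 := by
          refine pow_le_pow_left' ((enorm_integral_le_lintegral_enorm _).trans_eq ?_) 2
          simp_rw [enorm_mul]
      _ ≤ _ := sq_lintegral_mul_le _ hp'.continuous.enorm.aemeasurable
          ((hu j).continuousOn.aemeasurable hs.measurableSet).enorm
  have h3 : Tendsto (fun j => ‖∫ x, p x * fderiv ℝ (u j) x v ∂ν‖ₑ ^ 2) atTop (𝓝 0) := by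
    refine tendsto_of_tendsto_of_tendsto_of_le_of_le tendsto_const_nhds ?_ (fun _ => zero_le)
      hbound
    simpa using ENNReal.Tendsto.const_mul hu0 (Or.inr hpL)
  have h4 : Tendsto (fun j => (∫ x, p x * fderiv ℝ (u j) x v ∂ν) ^ 2) atTop (𝓝 0) := by
    simp_rw [enorm_sq_eq_ofReal] at h3
    have := (ENNReal.continuousAt_toReal ENNReal.zero_ne_top).tendsto.comp h3
    simpa [Function.comp_def, ENNReal.toReal_ofReal (sq_nonneg _)] using this
  have h5 := (Real.continuous_sqrt.tendsto 0).comp h4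
  rw [tendsto_zero_iff_norm_tendsto_zero]
  simpa [Function.comp_def, Real.sqrt_sq_eq_abs] using h5

/-- If `u j` tends to `0` in `L²` and the derivatives in direction `v` form an `L²` Cauchy
sequence, then they tend to `0` locally in `L²`. This follows from the inequality
`a² ≤ (a - b)² + 2 a b` for the derivatives `a` of `u k` and `b` of `u j`, on letting `j` tend to
infinity. -/
theorem tendsto_lintegral_fderiv_apply {s K : Set E} (hs : IsOpen s) (hK : IsCompact K)
    (hKs : K ⊆ s) {u : ℕ → E → ℝ} (hu : ∀ j, ContDiffOn ℝ ∞ (u j) s)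
    (hu0 : Tendsto (fun j => ∫⁻ x in s, ‖u j x‖ₑ ^ 2 ∂ν) atTop (𝓝 0)) (v : E)
    (hc : ∀ ε : ℝ≥0∞, 0 < ε → ∃ N, ∀ j ≥ N, ∀ k ≥ N,
      ∫⁻ x in s, ‖fderiv ℝ (u k) x v - fderiv ℝ (u j) x v‖ₑ ^ 2 ∂ν ≤ ε) :
    Tendsto (fun j => ∫⁻ x in K, ‖fderiv ℝ (u j) x v‖ₑ ^ 2 ∂ν) atTop (𝓝 0) := by
  obtain ⟨η, hηs, hη⟩ : ∃ η : E → ℝ, (tsupport η ⊆ s ∧ HasCompactSupport η) ∧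
      ContDiff ℝ ∞ η ∧ range η ⊆ Icc 0 1 ∧ ∀ x ∈ K, η x = 1 := by
    obtain ⟨η, h1, h2, h3, h4, h5⟩ := exists_contMDiff_cutoff 𝓘(ℝ, E) hK hs hKs
    exact ⟨η, ⟨h3, h2⟩, h1.contDiff, range_subset_iff.2 h4, fun x hx => h5.self_of_nhdsSet x hx⟩
  set a : ℕ → E → ℝ := fun j x => fderiv ℝ (u j) x v with ha
  have hu' : ∀ j, ContDiffOn ℝ ∞ (a j) s := fun j =>
    ((hu j).fderiv_of_isOpen hs (by simp)).clm_apply contDiffOn_const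
  have hη0 : ∀ x, 0 ≤ η x := fun x => (hη.2.1 (mem_range_self x)).1
  have hη1 : ∀ x, η x ≤ 1 := fun x => (hη.2.1 (mem_range_self x)).2
  have hint : ∀ g, ContDiffOn ℝ ∞ g s → Integrable (fun x => η x * g x) ν := fun g hg =>
    (contDiff_mul_of_tsupport_subset hs hη.1 hηs.1 hg).continuous.integrable_of_hasCompactSupport
      hηs.2.mul_right
  rw [ENNReal.tendsto_atTop_zero]
  intro ε hε
  obtain ⟨N, hN⟩ := hc ε hε
  refine ⟨N, fun k hk => ?_⟩
  have hKη : ∫⁻ x in K, ‖a k x‖ₑ ^ 2 ∂ν ≤ ENNReal.ofReal (∫ x, η x * (a k x * a k x) ∂ν) := by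
    rw [ofReal_integral_eq_lintegral_ofReal (hint _ ((hu' k).mul (hu' k)))
      (.of_forall fun x => mul_nonneg (hη0 x) (mul_self_nonneg _))]
    refine (setLIntegral_mono' hK.measurableSet fun x hx => ?_).trans
      (setLIntegral_le_lintegral K _)
    rw [hη.2.2 x hx, one_mul, enorm_sq_eq_ofReal, sq]
  refine hKη.trans ?_
  have hlim : Tendsto (fun j => ENNReal.ofReal (2 * ∫ x, η x * a k x * a j x ∂ν)) atTop (𝓝 0) := by
    have h1 := tendsto_integral_mul_fderiv_apply ν hs
      (contDiff_mul_of_tsupport_subset hs hη.1 hηs.1 (hu' k)) hηs.2.mul_right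
      ((tsupport_mul_subset_left).trans hηs.1) hu hu0 v
    have h2 := ENNReal.tendsto_ofReal (h1.const_mul 2)
    simpa using h2
  have hkey : ∀ j ≥ N, ENNReal.ofReal (∫ x, η x * (a k x * a k x) ∂ν) ≤
      ε + ENNReal.ofReal (2 * ∫ x, η x * a k x * a j x ∂ν) := by
    intro j hj
    have i1 := hint _ (((hu' k).sub (hu' j)).mul ((hu' k).sub (hu' j)))
    have i2 := hint _ ((hu' k).mul (hu' j))
    have h1 : ENNReal.ofReal (∫ x, η x * ((a k x - a j x) * (a k x - a j x)) ∂ν) ≤ ε := by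
      refine le_trans ?_ (hN j hj k hk)
      rw [ofReal_integral_eq_lintegral_ofReal i1
        (.of_forall fun x => mul_nonneg (hη0 x) (mul_self_nonneg _)), ← lintegral_indicator
          hs.measurableSet]
      refine lintegral_mono fun x => ?_
      by_cases hx : x ∈ s
      · rw [indicator_of_mem hx, enorm_sq_eq_ofReal]
        refine ENNReal.ofReal_le_ofReal ?_
        rw [sq]
        exact mul_le_of_le_one_left (mul_self_nonneg _) (hη1 x)
      · rw [image_eq_zero_of_notMem_tsupport fun h => hx (hηs.1 h)]
        simp
    refine le_trans ?_ (add_le_add_left h1 _)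
    refine le_trans (ENNReal.ofReal_le_ofReal ?_) ENNReal.ofReal_add_le
    simp_rw [mul_assoc]
    rw [← integral_const_mul, ← integral_add i1 (i2.const_mul 2)]
    refine integral_mono (hint _ ((hu' k).mul (hu' k))) (i1.add (i2.const_mul 2)) fun x => ?_
    have := mul_nonneg (hη0 x) (mul_self_nonneg (a j x))
    nlinarith
  have hlim' := (tendsto_const_nhds (x := ε)).add hlim
  rw [add_zero] at hlim'
  exact ge_of_tendsto hlim' (eventually_atTop.2 ⟨N, hkey⟩)

theorem enorm_clm_sq_le {n : ℕ} (L : EuclideanSpace ℝ (Fin n) →L[ℝ] ℝ) :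
    ‖L‖ₑ ^ 2 ≤ n * ∑ i, ‖L (EuclideanSpace.single i 1)‖ₑ ^ 2 := by
  have h1 : ‖L‖ ≤ ∑ i, ‖L (EuclideanSpace.single i 1)‖ := by
    refine L.opNorm_le_bound (Finset.sum_nonneg fun i _ => norm_nonneg _) fun v => ?_
    have hv : v = ∑ i, v i • EuclideanSpace.single i (1 : ℝ) := by
      simpa using ((EuclideanSpace.basisFun (Fin n) ℝ).sum_repr v).symm
    calc ‖L v‖ = ‖∑ i, v i * L (EuclideanSpace.single i 1)‖ := by
          conv_lhs => rw [hv]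
          simp
      _ ≤ ∑ i, ‖v i * L (EuclideanSpace.single i 1)‖ := norm_sum_le _ _
      _ ≤ ∑ i, ‖L (EuclideanSpace.single i 1)‖ * ‖v‖ := by
          refine Finset.sum_le_sum fun i _ => ?_
          rw [norm_mul, mul_comm]
          gcongr
          exact PiLp.norm_apply_le v i
      _ = _ := by rw [Finset.sum_mul]
  have h2 : ‖L‖ ^ 2 ≤ n * ∑ i, ‖L (EuclideanSpace.single i 1)‖ ^ 2 := by
    refine (pow_le_pow_left₀ (norm_nonneg _) h1 2).trans ?_
    simpa using sq_sum_le_card_mul_sum_sq (s := Finset.univ)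
      (f := fun i => ‖L (EuclideanSpace.single i 1)‖)
  rw [← ofReal_norm, ← ENNReal.ofReal_pow (norm_nonneg _)]
  refine (ENNReal.ofReal_le_ofReal h2).trans_eq ?_
  rw [ENNReal.ofReal_mul (by positivity), ENNReal.ofReal_natCast,
    ENNReal.ofReal_sum_of_nonneg fun i _ => sq_nonneg _]
  simp_rw [ENNReal.ofReal_pow (norm_nonneg _), ofReal_norm]

/-- Closability of the gradient in an open subset of Euclidean space. -/
theorem tendsto_lintegral_fderiv {n : ℕ} {s K : Set (EuclideanSpace ℝ (Fin n))} (hs : IsOpen s)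
    (hK : IsCompact K) (hKs : K ⊆ s) {u : ℕ → EuclideanSpace ℝ (Fin n) → ℝ}
    (hu : ∀ j, ContDiffOn ℝ ∞ (u j) s)
    (hu0 : Tendsto (fun j => ∫⁻ x in s, ‖u j x‖ₑ ^ 2) atTop (𝓝 0))
    (hc : ∀ ε : ℝ≥0∞, 0 < ε → ∃ N, ∀ j ≥ N, ∀ k ≥ N,
      ∫⁻ x in s, ‖fderiv ℝ (u k) x - fderiv ℝ (u j) x‖ₑ ^ 2 ≤ ε) :
    Tendsto (fun j => ∫⁻ x in K, ‖fderiv ℝ (u j) x‖ₑ ^ 2) atTop (𝓝 0) := by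
  have h1 : ∀ i : Fin n, Tendsto (fun j => ∫⁻ x in K,
      ‖fderiv ℝ (u j) x (EuclideanSpace.single i 1)‖ₑ ^ 2) atTop (𝓝 0) := by
    intro i
    refine tendsto_lintegral_fderiv_apply volume hs hK hKs hu hu0 _ fun ε hε => ?_
    obtain ⟨N, hN⟩ := hc ε hε
    refine ⟨N, fun j hj k hk => le_trans (lintegral_mono fun x => ?_) (hN j hj k hk)⟩
    refine pow_le_pow_left' ?_ 2
    rw [← sub_apply]
    refine (ContinuousLinearMap.le_opENorm _ _).trans_eq ?_
    rw [← ofReal_norm (EuclideanSpace.single i (1 : ℝ))]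
    simp
  have h2 : ∀ j, ∫⁻ x in K, ‖fderiv ℝ (u j) x‖ₑ ^ 2 ≤ n * ∑ i, ∫⁻ x in K,
      ‖fderiv ℝ (u j) x (EuclideanSpace.single i 1)‖ₑ ^ 2 := by
    intro j
    rw [← lintegral_finsetSum _ fun i _ => (((measurable_fderiv ℝ (u j)).apply_continuousLinearMap
      _).enorm.pow_const 2), ← lintegral_const_mul' _ _ (ENNReal.natCast_ne_top n)]
    exact lintegral_mono fun x => enorm_clm_sq_le _
  refine tendsto_of_tendsto_of_tendsto_of_le_of_le tendsto_const_nhds ?_ (fun _ => zero_le) h2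
  have h3 := ENNReal.Tendsto.const_mul (tendsto_finsetSum Finset.univ fun i _ => h1 i)
    (Or.inr (ENNReal.natCast_ne_top n))
  simpa using h3

end EuclideanClosability

/-! ### Energies and closability of the gradient on the manifold -/

section ManifoldEnergy

variable (n : ℕ) {M : Type*} [MetricSpace M] [ChartedSpace (EuclideanSpace ℝ (Fin n)) M]

theorem mvfderiv_eq_zero_of_notMem_tsupport {φ : M → ℝ} {x : M} (hx : x ∉ tsupport φ) :
    mvfderiv (𝓡 n) φ x = 0 := by
  have h0 : φ =ᶠ[𝓝 x] fun _ => 0 := notMem_tsupport_iff_eventuallyEq.1 hx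
  have h2 : mfderiv (𝓡 n) 𝓘(ℝ, ℝ) φ x = 0 := by
    rw [h0.mfderiv_eq, mfderiv_const]
    rfl
  ext v
  simp [mvfderiv, h2]

theorem mvfderiv_sub_of_contMDiff {φ ψ : M → ℝ} (hφ : ContMDiff (𝓡 n) 𝓘(ℝ, ℝ) ∞ φ)
    (hψ : ContMDiff (𝓡 n) 𝓘(ℝ, ℝ) ∞ ψ) (x : M) :
    mvfderiv (𝓡 n) (φ - ψ) x = mvfderiv (𝓡 n) φ x - mvfderiv (𝓡 n) ψ x :=
  mvfderiv_sub ((hφ.mdifferentiable (by simp)) x) ((hψ.mdifferentiable (by simp)) x)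

variable [RiemannianBundle (fun x : M => TangentSpace (𝓡 n) x)]

theorem norm_mvfderiv_nonneg (φ : M → ℝ) (x : M) : 0 ≤ ‖mvfderiv (𝓡 n) φ x‖ :=
  ContinuousLinearMap.opNorm_nonneg _

theorem ofReal_norm_mvfderiv (φ : M → ℝ) (x : M) :
    ENNReal.ofReal ‖mvfderiv (𝓡 n) φ x‖ = ‖mvfderiv (𝓡 n) φ x‖ₑ :=
  ofReal_norm (E := TangentSpace (𝓡 n) x →L[ℝ] ℝ) _

theorem norm_mvfderiv_sq (φ : M → ℝ) (x : M) :
    ‖mvfderiv (𝓡 n) φ x‖ ^ 2 = cotangentInner n (mvfderiv (𝓡 n) φ x) (mvfderiv (𝓡 n) φ x) := by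
  simp [cotangentInner]

theorem energy_nonneg [MeasurableSpace M] (μ : Measure M) (φ : M → ℝ) : 0 ≤ energy n μ φ :=
  integral_nonneg fun _ => sq_nonneg _

variable [IsManifold (𝓡 n) ∞ M]

variable [IsContMDiffRiemannianBundle (𝓡 n) ∞ (EuclideanSpace ℝ (Fin n))
    (fun x : M => TangentSpace (𝓡 n) x)]

theorem continuous_enorm_mvfderiv {φ : M → ℝ} (hφ : ContMDiff (𝓡 n) 𝓘(ℝ, ℝ) ∞ φ) :
    Continuous fun x : M => ‖mvfderiv (𝓡 n) φ x‖ₑ := by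
  have h1 := (continuous_cotangentInner n hφ hφ).sqrt
  rw [show (fun x => √(cotangentInner n (mvfderiv (𝓡 n) φ x) (mvfderiv (𝓡 n) φ x))) =
    fun x => ‖mvfderiv (𝓡 n) φ x‖ from funext fun x => by
      rw [← norm_mvfderiv_sq]
      exact Real.sqrt_sq (norm_mvfderiv_nonneg n φ x)] at h1
  simp_rw [← ofReal_norm_mvfderiv]
  exact ENNReal.continuous_ofReal.comp h1

variable [MeasurableSpace M] [BorelSpace M] (μ : Measure M) [IsWeightedMeasure n μ]

theorem ofReal_energy {φ : M → ℝ} (hφ : φ ∈ testFunctions n M) :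
    ENNReal.ofReal (energy n μ φ) = ∫⁻ x, ‖mvfderiv (𝓡 n) φ x‖ₑ ^ 2 ∂μ := by
  have h1 := testFunctions_integrable_cotangentInner n μ hφ hφ
  rw [← funext fun x => norm_mvfderiv_sq n φ x] at h1
  rw [energy, ofReal_integral_eq_lintegral_ofReal h1 (.of_forall fun x => sq_nonneg _)]
  simp_rw [ENNReal.ofReal_pow (norm_mvfderiv_nonneg n φ _), ofReal_norm_mvfderiv]

variable {n μ}

namespace IsComparisonBall

variable {x₀ : M} {r : ℝ} {C : NNReal}

/-- The two-point Poincaré inequality in a comparison ball. -/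
theorem exists_poincare (h : IsComparisonBall n μ x₀ r C) :
    ∃ K : ℝ≥0∞, K ≠ ⊤ ∧ ∀ φ ∈ testFunctions n M,
    ∫⁻ x in chartBall n x₀ r, ∫⁻ y in chartBall n x₀ r, ‖φ y - φ x‖ₑ ^ 2 ∂μ ∂μ ≤
      K * ENNReal.ofReal (energy n μ φ) := by
  set e := chartAt (EuclideanSpace ℝ (Fin n)) x₀ with he
  set B := coordBall n x₀ r
  set P : ℝ≥0∞ := ENNReal.ofReal (2 * r) ^ 2 *
    (2 ^ Module.finrank ℝ (EuclideanSpace ℝ (Fin n)) * volume B) with hP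
  have hPtop : P ≠ ⊤ := ENNReal.mul_ne_top (by finiteness)
    (ENNReal.mul_ne_top (by finiteness) measure_ball_lt_top.ne)
  refine ⟨C * (C * (P * (C ^ 2 * C))), ENNReal.mul_ne_top (by finiteness) (ENNReal.mul_ne_top
    (by finiteness) (ENNReal.mul_ne_top hPtop (by finiteness))), fun φ hφ => ?_⟩
  have hφm : Measurable φ := hφ.1.continuous.measurable
  have hφ2 : Measurable fun p : M × M => ‖φ p.2 - φ p.1‖ₑ ^ 2 :=
    (((hφm.comp measurable_snd).sub (hφm.comp measurable_fst)).enorm.pow_const 2)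
  have hu : ContDiffOn ℝ 1 (φ ∘ e.symm) B := fun y hy =>
    ((contDiffAt_comp_chartAt_symm n hφ.1 x₀ (h.subset_target hy)).of_le (by simp)).contDiffWithinAt
  have hmv : Measurable fun x => ‖mvfderiv (𝓡 n) φ x‖ₑ ^ 2 :=
    (continuous_enorm_mvfderiv n hφ.1).measurable.pow_const 2
  rw [ofReal_energy n μ hφ]
  calc ∫⁻ x in chartBall n x₀ r, ∫⁻ y in chartBall n x₀ r, ‖φ y - φ x‖ₑ ^ 2 ∂μ ∂μ
      ≤ ∫⁻ x in chartBall n x₀ r, (C * ∫⁻ y in B, ‖φ (e.symm y) - φ x‖ₑ ^ 2) ∂μ :=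
        lintegral_mono fun x => h.lintegral_le _ (hφ2.comp measurable_prodMk_left)
    _ = C * ∫⁻ x in chartBall n x₀ r, (∫⁻ y in B, ‖φ (e.symm y) - φ x‖ₑ ^ 2) ∂μ :=
        lintegral_const_mul' _ _ (by finiteness)
    _ ≤ C * (C * ∫⁻ x in B, ∫⁻ y in B, ‖φ (e.symm y) - φ (e.symm x)‖ₑ ^ 2) := by
        refine mul_le_mul' le_rfl (h.lintegral_le
          (fun x => ∫⁻ y in B, ‖φ (e.symm y) - φ x‖ₑ ^ 2) ?_)
        -- `e.symm` is only measurable on `B`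
        classical
        have hw : Measurable (B.piecewise (φ ∘ e.symm) 0) :=
          hu.continuousOn.measurable_piecewise continuousOn_const measurableSet_ball
        have hwe : ∀ x, ∫⁻ y in B, ‖φ (e.symm y) - φ x‖ₑ ^ 2 =
            ∫⁻ y in B, ‖B.piecewise (φ ∘ e.symm) 0 y - φ x‖ₑ ^ 2 := fun x =>
          setLIntegral_congr_fun measurableSet_ball fun y hy => by
            simp only [piecewise_eq_of_mem _ _ _ hy, Function.comp_apply]
        simp_rw [hwe]
        exact Measurable.lintegral_prod_right' (f := fun p : M × EuclideanSpace ℝ (Fin n) =>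
          ‖B.piecewise (φ ∘ e.symm) 0 p.2 - φ p.1‖ₑ ^ 2)
          (((hw.comp measurable_snd).sub (hφm.comp measurable_fst)).enorm.pow_const 2)
    _ ≤ C * (C * (P * ∫⁻ y in B, ‖fderiv ℝ (φ ∘ e.symm) y‖ₑ ^ 2)) := by
        gcongr
        exact lintegral_lintegral_enorm_sub_sq_le volume hu
    _ ≤ C * (C * (P * (C ^ 2 * ∫⁻ y in B, ‖mvfderiv (𝓡 n) φ (e.symm y)‖ₑ ^ 2))) := by
        gcongr
        rw [← lintegral_const_mul' _ _ (by finiteness)]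
        refine setLIntegral_mono' measurableSet_ball fun y hy => ?_
        rw [← mul_pow]
        exact pow_le_pow_left' (h.enorm_fderiv_le y hy φ hφ.1) 2
    _ ≤ C * (C * (P * (C ^ 2 * (C * ∫⁻ x, ‖mvfderiv (𝓡 n) φ x‖ₑ ^ 2 ∂μ)))) := by
        gcongr
        exact (h.le_lintegral _ hmv).trans (mul_le_mul' le_rfl (setLIntegral_le_lintegral _ _))
    _ = _ := by ring

/-- Closability of the differential in a comparison ball. -/
theorem tendsto_lintegral_mvfderiv (h : IsComparisonBall n μ x₀ r C) {φ : ℕ → M → ℝ}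
    (hφ : ∀ j, φ j ∈ testFunctions n M)
    (hφ0 : Tendsto (fun j => ∫⁻ x, ‖φ j x‖ₑ ^ 2 ∂μ) atTop (𝓝 0))
    (hc : ∀ ε : ℝ≥0∞, 0 < ε → ∃ N, ∀ j ≥ N, ∀ k ≥ N,
      ENNReal.ofReal (energy n μ (φ k - φ j)) ≤ ε) :
    Tendsto (fun j => ∫⁻ x in chartBall n x₀ (r / 2), ‖mvfderiv (𝓡 n) (φ j) x‖ₑ ^ 2 ∂μ)
      atTop (𝓝 0) := by
  set e := chartAt (EuclideanSpace ℝ (Fin n)) x₀ with he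
  set B := coordBall n x₀ r with hB
  set B' := Metric.closedBall (e x₀) (r / 2) with hB'
  have hBB : B' ⊆ B := Metric.closedBall_subset_ball (by linarith [h.pos])
  have hu : ∀ j, ContDiffOn ℝ ∞ (φ j ∘ e.symm) B := fun j y hy =>
    (contDiffAt_comp_chartAt_symm n (hφ j).1 x₀ (h.subset_target hy)).contDiffWithinAt
  have hmv : ∀ ψ ∈ testFunctions n M, Measurable fun x => ‖mvfderiv (𝓡 n) ψ x‖ₑ ^ 2 := fun ψ hψ =>
    (continuous_enorm_mvfderiv n hψ.1).measurable.pow_const 2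
  have hC : ((C : ℝ≥0∞)) ≠ ⊤ := ENNReal.coe_ne_top
  have hgrad : ∀ ψ ∈ testFunctions n M, ∫⁻ y in B, ‖fderiv ℝ (ψ ∘ e.symm) y‖ₑ ^ 2 ≤
      C ^ 2 * C * ENNReal.ofReal (energy n μ ψ) := by
    intro ψ hψ
    rw [ofReal_energy n μ hψ]
    calc ∫⁻ y in B, ‖fderiv ℝ (ψ ∘ e.symm) y‖ₑ ^ 2
        ≤ ∫⁻ y in B, C ^ 2 * ‖mvfderiv (𝓡 n) ψ (e.symm y)‖ₑ ^ 2 := by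
          refine setLIntegral_mono' measurableSet_ball fun y hy => ?_
          rw [← mul_pow]
          exact pow_le_pow_left' (h.enorm_fderiv_le y hy ψ hψ.1) 2
      _ = C ^ 2 * ∫⁻ y in B, ‖mvfderiv (𝓡 n) ψ (e.symm y)‖ₑ ^ 2 :=
          lintegral_const_mul' _ _ (by finiteness)
      _ ≤ C ^ 2 * (C * ∫⁻ x, ‖mvfderiv (𝓡 n) ψ x‖ₑ ^ 2 ∂μ) := by
          gcongr
          exact (h.le_lintegral _ (hmv ψ hψ)).trans
            (mul_le_mul' le_rfl (setLIntegral_le_lintegral _ _))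
      _ = _ := by ring
  have hlim := tendsto_lintegral_fderiv Metric.isOpen_ball (isCompact_closedBall _ _) hBB hu
    (by
      have h1 := ENNReal.Tendsto.const_mul hφ0 (Or.inr hC)
      rw [mul_zero] at h1
      refine tendsto_of_tendsto_of_tendsto_of_le_of_le tendsto_const_nhds h1 (fun _ => zero_le)
        fun j => ?_
      exact (h.le_lintegral (fun x => ‖φ j x‖ₑ ^ 2)
        ((hφ j).1.continuous.measurable.enorm.pow_const 2)).trans
          (mul_le_mul' le_rfl (setLIntegral_le_lintegral _ _)))
    (by
      intro ε hε
      obtain ⟨δ, hδ, hδε⟩ : ∃ δ : ℝ≥0∞, 0 < δ ∧ C ^ 2 * C * δ ≤ ε := by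
        rcases eq_or_ne (C ^ 2 * C : ℝ≥0∞) 0 with h0 | h0
        · exact ⟨1, one_pos, by rw [h0, zero_mul]; exact hε.le⟩
        · exact ⟨ε / (C ^ 2 * C), ENNReal.div_pos hε.ne' (by finiteness),
            ENNReal.mul_div_le⟩
      obtain ⟨N, hN⟩ := hc δ hδ
      refine ⟨N, fun j hj k hk => ?_⟩
      refine le_trans ?_ ((hgrad _ (sub_mem (hφ k) (hφ j))).trans
        ((mul_le_mul' le_rfl (hN j hj k hk)).trans hδε))
      refine le_of_eq (setLIntegral_congr_fun measurableSet_ball fun y hy => ?_)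
      have hd : ∀ i, DifferentiableAt ℝ (φ i ∘ e.symm) y := fun i =>
        ((hu i).contDiffAt (Metric.isOpen_ball.mem_nhds hy)).differentiableAt (by simp)
      have h2 : (φ k - φ j) ∘ e.symm = φ k ∘ e.symm - φ j ∘ e.symm := rfl
      simp only [h2, fderiv_sub (hd k) (hd j)])
  have h3 := ENNReal.Tendsto.const_mul hlim (Or.inr (show (C * C ^ 2 : ℝ≥0∞) ≠ ⊤ by finiteness))
  rw [mul_zero] at h3
  refine tendsto_of_tendsto_of_tendsto_of_le_of_le tendsto_const_nhds h3 (fun _ => zero_le)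
    fun j => ?_
  have hm : MeasurableSet (chartBall n x₀ (r / 2)) := (isOpen_chartBall n x₀ _).measurableSet
  have hsub : chartBall n x₀ (r / 2) ⊆ chartBall n x₀ r :=
    chartBall_mono n x₀ (by linarith [h.pos])
  have h4 := h.lintegral_le ((chartBall n x₀ (r / 2)).indicator
    fun x => ‖mvfderiv (𝓡 n) (φ j) x‖ₑ ^ 2) ((hmv _ (hφ j)).indicator hm)
  rw [lintegral_indicator hm, Measure.restrict_restrict hm, inter_eq_left.2 hsub] at h4
  refine h4.trans ?_
  rw [mul_assoc]
  refine mul_le_mul' le_rfl ?_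
  rw [← lintegral_const_mul' _ _ (by finiteness), ← lintegral_indicator measurableSet_ball,
    ← lintegral_indicator Metric.isClosed_closedBall.measurableSet]
  refine lintegral_mono fun y => ?_
  by_cases hy : y ∈ B
  · rw [indicator_of_mem hy]
    by_cases hy' : e.symm y ∈ chartBall n x₀ (r / 2)
    · have hyB : y ∈ B' := by
        have h5 : e (e.symm y) ∈ Metric.ball (e x₀) (r / 2) := hy'.2
        rw [e.right_inv (h.subset_target hy)] at h5
        exact Metric.ball_subset_closedBall h5
      rw [indicator_of_mem hy', indicator_of_mem hyB, ← mul_pow]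
      exact pow_le_pow_left' (h.enorm_mvfderiv_le y hy _ (hφ j).1) 2
    · rw [indicator_of_notMem hy']
      exact zero_le
  · rw [indicator_of_notMem hy]
    exact zero_le

end IsComparisonBall

end ManifoldEnergy

/-! ### Closability of the energy form -/

section GlobalEstimates

variable {n : ℕ} {M : Type*} [MetricSpace M] [ChartedSpace (EuclideanSpace ℝ (Fin n)) M]
  [IsManifold (𝓡 n) ∞ M] [RiemannianBundle (fun x : M => TangentSpace (𝓡 n) x)]
  [IsContMDiffRiemannianBundle (𝓡 n) ∞ (EuclideanSpace ℝ (Fin n))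
    (fun x : M => TangentSpace (𝓡 n) x)]
  [MeasurableSpace M] [BorelSpace M] {μ : Measure M} [IsWeightedMeasure n μ]

theorem enorm_mvfderiv_sq_le_sub (n : ℕ) {M : Type*} [MetricSpace M]
    [ChartedSpace (EuclideanSpace ℝ (Fin n)) M]
    [RiemannianBundle (fun x : M => TangentSpace (𝓡 n) x)] {φ ψ : M → ℝ}
    (hφ : ContMDiff (𝓡 n) 𝓘(ℝ, ℝ) ∞ φ) (hψ : ContMDiff (𝓡 n) 𝓘(ℝ, ℝ) ∞ ψ) (x : M) :
    ‖mvfderiv (𝓡 n) φ x‖ₑ ^ 2 ≤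
      2 * (‖mvfderiv (𝓡 n) (φ - ψ) x‖ₑ ^ 2 + ‖mvfderiv (𝓡 n) ψ x‖ₑ ^ 2) := by
  have h1 : ‖mvfderiv (𝓡 n) φ x‖ ≤ ‖mvfderiv (𝓡 n) (φ - ψ) x‖ + ‖mvfderiv (𝓡 n) ψ x‖ := by
    have h2 : mvfderiv (𝓡 n) φ x = mvfderiv (𝓡 n) (φ - ψ) x + mvfderiv (𝓡 n) ψ x := by
      rw [mvfderiv_sub_of_contMDiff n hφ hψ, sub_add_cancel]
    exact (congrArg norm h2).trans_le (ContinuousLinearMap.opNorm_add_le _ _)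
  have h3 := norm_mvfderiv_nonneg n (φ - ψ) x
  have h4 := norm_mvfderiv_nonneg n ψ x
  simp_rw [← ofReal_norm_mvfderiv]
  refine (pow_le_pow_left' ((ENNReal.ofReal_le_ofReal h1).trans_eq
    (ENNReal.ofReal_add h3 h4)) 2).trans ?_
  exact add_sq_le_two_mul _ _

theorem enorm_mvfderiv_eq_zero (n : ℕ) {M : Type*} [MetricSpace M]
    [ChartedSpace (EuclideanSpace ℝ (Fin n)) M]
    [RiemannianBundle (fun x : M => TangentSpace (𝓡 n) x)] {φ : M → ℝ} {x : M}
    (hx : x ∉ tsupport φ) : ‖mvfderiv (𝓡 n) φ x‖ₑ = 0 := by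
  rw [← ofReal_norm_mvfderiv, mvfderiv_eq_zero_of_notMem_tsupport n hx,
    ContinuousLinearMap.opNorm_zero, ENNReal.ofReal_zero]

/-- Closability of the energy form: a sequence of test functions that tends to `0` in `L²` and is
a Cauchy sequence for the energy has energies tending to `0`. -/
theorem tendsto_energy_of_cauchy {φ : ℕ → M → ℝ} (hφ : ∀ j, φ j ∈ testFunctions n M)
    (hφ0 : Tendsto (fun j => ∫⁻ x, ‖φ j x‖ₑ ^ 2 ∂μ) atTop (𝓝 0))
    (hc : ∀ ε : ℝ≥0∞, 0 < ε → ∃ N, ∀ j ≥ N, ∀ k ≥ N,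
      ENNReal.ofReal (energy n μ (φ k - φ j)) ≤ ε) :
    Tendsto (fun j => ENNReal.ofReal (energy n μ (φ j))) atTop (𝓝 0) := by
  -- the differentials tend to `0` in `L²` of compact sets, and the Cauchy property makes this
  -- uniform in the compact set
  have hloc : ∀ K : Set M, IsCompact K →
      Tendsto (fun j => ∫⁻ x in K, ‖mvfderiv (𝓡 n) (φ j) x‖ₑ ^ 2 ∂μ) atTop (𝓝 0) := by
    intro K hK
    refine hK.induction_on (p := fun s =>
      Tendsto (fun j => ∫⁻ x in s, ‖mvfderiv (𝓡 n) (φ j) x‖ₑ ^ 2 ∂μ) atTop (𝓝 0)) ?_ ?_ ?_ ?_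
    · simp
    · intro s t hst ht
      exact tendsto_of_tendsto_of_tendsto_of_le_of_le tendsto_const_nhds ht (fun _ => zero_le)
        fun j => lintegral_mono_set hst
    · intro s t hs ht
      have h1 := hs.add ht
      rw [add_zero] at h1
      exact tendsto_of_tendsto_of_tendsto_of_le_of_le tendsto_const_nhds h1 (fun _ => zero_le)
        fun j => lintegral_union_le _ _ _
    · intro x _
      obtain ⟨r, C, h⟩ := exists_isComparisonBall n μ x
      exact ⟨chartBall n x (r / 2), mem_nhdsWithin_of_mem_nhds
        ((isOpen_chartBall n x _).mem_nhds (mem_chartBall_self n x (by linarith [h.pos]))),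
        h.tendsto_lintegral_mvfderiv hφ hφ0 hc⟩
  rw [ENNReal.tendsto_atTop_zero]
  intro ε hε
  obtain ⟨N, hN⟩ := hc (ε / 2) (ENNReal.half_pos hε.ne')
  refine ⟨N, fun k hk => ?_⟩
  rw [ofReal_energy n μ (hφ k)]
  have hK : ∫⁻ x, ‖mvfderiv (𝓡 n) (φ k) x‖ₑ ^ 2 ∂μ =
      ∫⁻ x in tsupport (φ k), ‖mvfderiv (𝓡 n) (φ k) x‖ₑ ^ 2 ∂μ := by
    rw [← lintegral_indicator (isClosed_tsupport _).measurableSet]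
    refine lintegral_congr fun x => ?_
    by_cases hx : x ∈ tsupport (φ k)
    · rw [indicator_of_mem hx]
    · rw [indicator_of_notMem hx, enorm_mvfderiv_eq_zero n hx, zero_pow two_ne_zero]
  rw [hK]
  have h1 : ∀ j ≥ N, ∫⁻ x in tsupport (φ k), ‖mvfderiv (𝓡 n) (φ k) x‖ₑ ^ 2 ∂μ ≤
      ε + 2 * ∫⁻ x in tsupport (φ k), ‖mvfderiv (𝓡 n) (φ j) x‖ₑ ^ 2 ∂μ := by
    intro j hj
    have h2 := hN j hj k hk
    rw [ofReal_energy n μ (sub_mem (hφ k) (hφ j))] at h2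
    calc _ ≤ ∫⁻ x in tsupport (φ k), 2 * (‖mvfderiv (𝓡 n) (φ k - φ j) x‖ₑ ^ 2 +
          ‖mvfderiv (𝓡 n) (φ j) x‖ₑ ^ 2) ∂μ :=
          lintegral_mono fun x => enorm_mvfderiv_sq_le_sub n (hφ k).1 (hφ j).1 x
      _ = 2 * (∫⁻ x in tsupport (φ k), ‖mvfderiv (𝓡 n) (φ k - φ j) x‖ₑ ^ 2 ∂μ +
          ∫⁻ x in tsupport (φ k), ‖mvfderiv (𝓡 n) (φ j) x‖ₑ ^ 2 ∂μ) := by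
          rw [lintegral_const_mul' _ _ (by finiteness), lintegral_add_right _
            ((continuous_enorm_mvfderiv n (hφ j).1).measurable.pow_const 2)]
      _ ≤ 2 * (ε / 2 + ∫⁻ x in tsupport (φ k), ‖mvfderiv (𝓡 n) (φ j) x‖ₑ ^ 2 ∂μ) := by
          gcongr
          exact (setLIntegral_le_lintegral _ _).trans h2
      _ = _ := by rw [mul_add, ENNReal.mul_div_cancel (by simp) (by simp)]
  have h2 := (tendsto_const_nhds (x := ε)).add (ENNReal.Tendsto.const_mul
    (hloc _ (hφ k).2) (Or.inr (show (2 : ℝ≥0∞) ≠ ⊤ by simp)))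
  rw [mul_zero, add_zero] at h2
  exact ge_of_tendsto h2 (eventually_atTop.2 ⟨N, h1⟩)

/-! ### Oscillation estimates on compact sets -/

/-- The deviation of `φ` from `c` on `B` is controlled by its deviation from `c` on another set `V`
and its oscillation between `B` and `V`. -/
theorem measure_mul_lintegral_enorm_sub_sq_le {α : Type*} [MeasurableSpace α] (μ : Measure α)
    [SFinite μ] {φ : α → ℝ} (hφ : Measurable φ) (B V : Set α) (c : ℝ) :
    μ V * ∫⁻ x in B, ‖φ x - c‖ₑ ^ 2 ∂μ ≤ 2 * (∫⁻ x in B, ∫⁻ y in V, ‖φ y - φ x‖ₑ ^ 2 ∂μ ∂μ +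
      μ B * ∫⁻ y in V, ‖φ y - c‖ₑ ^ 2 ∂μ) := by
  have hm : Measurable fun p : α × α => ‖φ p.2 - φ p.1‖ₑ ^ 2 :=
    (((hφ.comp measurable_snd).sub (hφ.comp measurable_fst)).enorm.pow_const 2)
  have hmc : Measurable fun y => ‖φ y - c‖ₑ ^ 2 := (hφ.sub_const c).enorm.pow_const 2
  have h1 : ∀ x, μ V * ‖φ x - c‖ₑ ^ 2 ≤
      2 * (∫⁻ y in V, ‖φ y - φ x‖ₑ ^ 2 ∂μ + ∫⁻ y in V, ‖φ y - c‖ₑ ^ 2 ∂μ) := by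
    intro x
    rw [mul_comm, ← setLIntegral_const, ← lintegral_add_right _ hmc,
      ← lintegral_const_mul' _ _ (by finiteness)]
    refine lintegral_mono fun y => ?_
    have h2 := enorm_add_sq_le (φ x - φ y) (φ y - c)
    rwa [sub_add_sub_cancel, ← neg_sub (φ y) (φ x), enorm_neg] at h2
  rw [← lintegral_const_mul _ hmc]
  refine (lintegral_mono fun x => h1 x).trans_eq ?_
  rw [lintegral_const_mul' _ _ (by finiteness), lintegral_add_right _ measurable_const,
    lintegral_const]
  simp [mul_comm]

theorem measure_mul_enorm_sub_average_sq_le {α : Type*} [MeasurableSpace α] {μ : Measure α}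
    {U : Set α} (hU0 : μ U ≠ 0) (hU : μ U ≠ ⊤) {φ : α → ℝ} (hφ : Measurable φ)
    (hφi : IntegrableOn φ U μ) (x : α) :
    μ U * ‖φ x - ⨍ y in U, φ y ∂μ‖ₑ ^ 2 ≤ ∫⁻ y in U, ‖φ y - φ x‖ₑ ^ 2 ∂μ := by
  have h0 : (0 : ℝ) < μ.real U := ENNReal.toReal_pos hU0 hU
  have h1 : ∫ y in U, (φ y - φ x) ∂μ = μ.real U * ((⨍ y in U, φ y ∂μ) - φ x) := by
    have : IsFiniteMeasure (μ.restrict U) := ⟨by simpa using hU.lt_top⟩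
    rw [integral_sub hφi (integrable_const _), setAverage_eq, integral_const]
    simp
    field_simp
  have h2 := sq_lintegral_mul_le (μ.restrict U) ((hφ.sub_const (φ x)).enorm.aemeasurable)
    (aemeasurable_const (b := (1 : ℝ≥0∞)))
  simp only [mul_one, one_pow, lintegral_one, Measure.restrict_apply, MeasurableSet.univ,
    univ_inter] at h2
  have h3 : (μ U * ‖φ x - ⨍ y in U, φ y ∂μ‖ₑ) ^ 2 ≤
      (∫⁻ y in U, ‖φ y - φ x‖ₑ ^ 2 ∂μ) * μ U := by
    refine le_trans ?_ h2
    refine pow_le_pow_left' (le_trans (le_of_eq ?_) (enorm_integral_le_lintegral_enorm _)) 2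
    rw [h1, enorm_mul, ← neg_sub (φ x), enorm_neg, Real.enorm_of_nonneg h0.le,
      ofReal_measureReal hU]
  rw [mul_pow, sq (μ U), mul_assoc, mul_comm _ (μ U)] at h3
  exact (ENNReal.mul_le_mul_iff_right hU0 hU).1 h3

/-- On a connected manifold, the deviation of a test function from its mean on a fixed ball is
controlled by the energy in `L²` of each compact set: the set of points near which this holds is
open, and it is closed by the Poincaré inequality in comparison balls. -/
theorem exists_lintegral_sub_average_le [PreconnectedSpace M] [SecondCountableTopology M]
    {x₀ : M} {r : ℝ} {C : NNReal} (h₀ : IsComparisonBall n μ x₀ r C) {K : Set M} (hK : IsCompact K) :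
    ∃ A : ℝ≥0∞, A ≠ ⊤ ∧ ∀ φ ∈ testFunctions n M,
      ∫⁻ x in K, ‖φ x - ⨍ y in chartBall n x₀ r, φ y ∂μ‖ₑ ^ 2 ∂μ ≤
        A * ENNReal.ofReal (energy n μ φ) := by
  have := IsWeightedMeasure.isLocallyFiniteMeasure n μ
  set U₀ := chartBall n x₀ r with hU₀
  -- `Q U` is the claim for the set `U`
  let Q : Set M → Prop := fun U => ∃ A : ℝ≥0∞, A ≠ ⊤ ∧ ∀ φ ∈ testFunctions n M,
      ∫⁻ x in U, ‖φ x - ⨍ y in U₀, φ y ∂μ‖ₑ ^ 2 ∂μ ≤ A * ENNReal.ofReal (energy n μ φ)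
  have hdiv : ∀ {a b c E : ℝ≥0∞}, a ≠ 0 → a ≠ ⊤ → a * b ≤ c * E → b ≤ c / a * E := by
    intro a b c E h0 h1 h2
    rw [ENNReal.mul_div_right_comm.symm, ENNReal.le_div_iff_mul_le (Or.inl h0) (Or.inl h1),
      mul_comm]
    exact h2
  have hμ₀ : μ U₀ ≠ 0 := by
    have := h₀.measure_inter_pos isOpen_univ ⟨x₀, mem_univ _, mem_chartBall_self n x₀ h₀.pos⟩
    rw [univ_inter] at this
    exact this.ne'
  have hQmono : ∀ s t, s ⊆ t → Q t → Q s := fun s t hst ⟨A, hA, h⟩ =>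
    ⟨A, hA, fun φ hφ => (lintegral_mono_set hst).trans (h φ hφ)⟩
  have hQ₀ : Q U₀ := by
    obtain ⟨A, hA, h⟩ := h₀.exists_poincare
    refine ⟨A / μ U₀, ENNReal.div_ne_top hA hμ₀, fun φ hφ => ?_⟩
    have hφm := hφ.1.continuous.measurable
    refine hdiv hμ₀ h₀.measure_lt_top.ne (le_trans ?_ (h φ hφ))
    rw [← lintegral_const_mul _ ((hφm.sub_const _).enorm.pow_const 2)]
    exact lintegral_mono fun x => measure_mul_enorm_sub_average_sq_le hμ₀ h₀.measure_lt_top.ne hφm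
      (hφ.1.continuous.integrable_of_hasCompactSupport hφ.2).integrableOn x
  let S : Set M := {x | ∃ U ∈ 𝓝 x, Q U}
  have hSo : IsOpen S := by
    refine isOpen_iff_mem_nhds.2 fun x ⟨U, hU, hQ⟩ => ?_
    obtain ⟨V, hVU, hVo, hxV⟩ := mem_nhds_iff.1 hU
    exact mem_of_superset (hVo.mem_nhds hxV) fun y hy => ⟨U, mem_of_superset (hVo.mem_nhds hy) hVU, hQ⟩
  have hSc : IsClosed S := by
    refine isClosed_of_closure_subset fun x hx => ?_
    obtain ⟨s, D, h⟩ := exists_isComparisonBall n μ x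
    set B := chartBall n x s
    have hBx : B ∈ 𝓝 x := (isOpen_chartBall n x s).mem_nhds (mem_chartBall_self n x h.pos)
    obtain ⟨y, hyB, U, hU, hQU⟩ := mem_closure_iff_nhds.1 hx B hBx
    obtain ⟨V, hVU, hVo, hyV⟩ := mem_nhds_iff.1 hU
    have hVpos := h.measure_inter_pos hVo ⟨y, hyV, hyB⟩
    have hVtop : μ (V ∩ B) ≠ ⊤ := ((measure_mono inter_subset_right).trans_lt h.measure_lt_top).ne
    obtain ⟨A₁, hA₁, h₁⟩ := h.exists_poincare
    obtain ⟨A₂, hA₂, h₂⟩ := hQmono _ _ (inter_subset_left.trans hVU) hQU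
    refine ⟨B, hBx, 2 * (A₁ + μ B * A₂) / μ (V ∩ B), ENNReal.div_ne_top (ENNReal.mul_ne_top
      (by simp) (ENNReal.add_ne_top.2 ⟨hA₁, ENNReal.mul_ne_top h.measure_lt_top.ne hA₂⟩))
      hVpos.ne', fun φ hφ => ?_⟩
    refine hdiv hVpos.ne' hVtop ((measure_mul_lintegral_enorm_sub_sq_le μ
      hφ.1.continuous.measurable B (V ∩ B) _).trans ?_)
    rw [mul_assoc, add_mul, mul_assoc]
    gcongr
    · refine le_trans (lintegral_mono fun x => ?_) (h₁ φ hφ)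
      exact lintegral_mono_set inter_subset_right
    · exact h₂ φ hφ
  have hS : S = univ := IsClopen.eq_univ ⟨hSc, hSo⟩
    ⟨x₀, U₀, (isOpen_chartBall n x₀ r).mem_nhds (mem_chartBall_self n x₀ h₀.pos), hQ₀⟩
  refine hK.induction_on (p := Q) ⟨0, by simp, by simp⟩ hQmono ?_ ?_
  · rintro s t ⟨A₁, hA₁, h₁⟩ ⟨A₂, hA₂, h₂⟩
    refine ⟨A₁ + A₂, ENNReal.add_ne_top.2 ⟨hA₁, hA₂⟩, fun φ hφ => ?_⟩
    rw [add_mul]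
    exact (lintegral_union_le _ _ _).trans (add_le_add (h₁ φ hφ) (h₂ φ hφ))
  · intro x _
    obtain ⟨U, hU, hQ⟩ : x ∈ S := hS ▸ mem_univ x
    exact ⟨U, mem_nhdsWithin_of_mem_nhds hU, hQ⟩

end GlobalEstimates

/-! ### Truncations of test functions -/

/-- A smooth version of `s ↦ min (max s 0) 1` whose slope exceeds `1` by an arbitrarily small
amount. -/
theorem exists_smooth_truncation {ε : ℝ} (hε : 0 < ε) :
    ∃ G : ℝ → ℝ, ContDiff ℝ ∞ G ∧ (∀ s ≤ 0, G s = 0) ∧ (∀ s, 1 ≤ s → G s = 1) ∧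
      (∀ s, G s ∈ Icc (0 : ℝ) 1) ∧ (∀ s, |deriv G s| ≤ 1 + ε) ∧
      ∀ s, s ∉ Icc (0 : ℝ) 1 → deriv G s = 0 := by
  have h2 : (0 : ℝ) < 1 / (2 * (1 + ε)) := by positivity
  -- the slope is a bump function supported in `[0, 1]`, normalized to have integral `1`; before the
  -- normalization it is `1` on an interval of length `1 / (1 + ε)`, which bounds the slope
  let b : ContDiffBump (1 / 2 : ℝ) := ⟨1 / (2 * (1 + ε)), 1 / 2, h2, by
    rw [div_lt_div_iff₀ (by positivity) (by positivity)]
    linarith⟩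
  let g := b.normed volume
  have hg : ContDiff ℝ ∞ g := b.contDiff_normed
  have hgi : Integrable g volume := b.integrable_normed
  have hg0 : ∀ s, 0 ≤ g s := b.nonneg_normed
  have hgs : ∀ s, s ∉ Ioo (0 : ℝ) 1 → g s = 0 := by
    intro s hs
    by_contra h
    have h3 : s ∈ Function.support (b.normed volume) := h
    rw [b.support_normed_eq, Real.ball_eq_Ioo] at h3
    exact hs ⟨by simpa [b] using h3.1, by have := h3.2; norm_num [b] at this; exact this⟩
  have hgb : ∀ s, g s ≤ 1 + ε := by
    intro s
    refine (b.normed_le_div_measure_closedBall_rIn volume s).trans (le_of_eq ?_)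
    rw [Measure.real, Real.volume_closedBall, ENNReal.toReal_ofReal (by positivity)]
    simp only [b]
    field_simp
  let G : ℝ → ℝ := fun s => ∫ t in (0 : ℝ)..s, g t
  have hd : ∀ s, HasDerivAt G (g s) s := fun s =>
    intervalIntegral.integral_hasDerivAt_right (hgi.intervalIntegrable)
      (hg.continuous.stronglyMeasurableAtFilter _ _) hg.continuous.continuousAt
  have hdG : deriv G = g := funext fun s => (hd s).deriv
  have hG0 : ∀ s ≤ 0, G s = 0 := by
    intro s hs
    refine (intervalIntegral.integral_congr (g := fun _ => 0) fun t ht => ?_).trans (by simp)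
    rw [uIcc_of_ge hs] at ht
    exact hgs t fun h => absurd ht.2 (not_le.2 h.1)
  have hG1 : ∀ s, 1 ≤ s → G s = 1 := by
    intro s hs
    have h3 : ∫ t in Ioc 0 s, g t = ∫ t, g t := by
      refine setIntegral_eq_integral_of_forall_compl_eq_zero fun t ht => hgs t fun h => ht ?_
      exact ⟨h.1, h.2.le.trans hs⟩
    change ∫ t in (0 : ℝ)..s, g t = 1
    rw [intervalIntegral.integral_of_le (zero_le_one.trans hs), h3]
    exact b.integral_normed
  have hmono : Monotone G := monotone_of_deriv_nonneg (fun s => (hd s).differentiableAt)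
    fun s => hdG ▸ hg0 s
  refine ⟨G, contDiff_infty_iff_deriv.2 ⟨fun s => (hd s).differentiableAt, hdG ▸ hg⟩, hG0, hG1,
    fun s => ⟨?_, ?_⟩, fun s => ?_, fun s hs => ?_⟩
  · rcases le_total s 0 with h | h
    · exact (hG0 s h).ge
    · exact (hG0 0 le_rfl).ge.trans (hmono h)
  · rcases le_total s 1 with h | h
    · exact (hmono h).trans (hG1 1 le_rfl).le
    · exact (hG1 s h).le
  · rw [hdG, abs_of_nonneg (hg0 s)]
    exact hgb s
  · rw [hdG]
    exact hgs s fun h => hs ⟨h.1.le, h.2.le⟩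

section ChainRule

variable (n : ℕ) {M : Type*} [MetricSpace M] [ChartedSpace (EuclideanSpace ℝ (Fin n)) M]

theorem mvfderiv_real_comp {G : ℝ → ℝ} {φ : M → ℝ} {x : M} (hG : DifferentiableAt ℝ G (φ x))
    (hφ : MDifferentiableAt (𝓡 n) 𝓘(ℝ, ℝ) φ x) :
    mvfderiv (𝓡 n) (G ∘ φ) x = deriv G (φ x) • mvfderiv (𝓡 n) φ x := by
  ext v
  have h1 := mvfderiv_comp_apply (x := x) (v := v) hG.mdifferentiableAt hφ
  refine h1.trans ?_
  have h2 : mvfderiv 𝓘(ℝ, ℝ) G (φ x) = fderiv ℝ G (φ x) := by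
    simp [mvfderiv, mfderiv_eq_fderiv]
    rfl
  rw [h2]
  have h3 : ∀ w : ℝ, fderiv ℝ G (φ x) w = deriv G (φ x) * w := fun w => by
    have h4 := (fderiv ℝ G (φ x)).map_smul w 1
    rw [smul_eq_mul, mul_one, fderiv_apply_one_eq_deriv, smul_eq_mul] at h4
    rw [h4, mul_comm]
  exact h3 _

theorem comp_mem_testFunctions {G : ℝ → ℝ} (hG : ContDiff ℝ ∞ G) (hG0 : G 0 = 0) {φ : M → ℝ}
    (hφ : φ ∈ testFunctions n M) : G ∘ φ ∈ testFunctions n M :=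
  ⟨hG.contMDiff.comp hφ.1, hφ.2.comp_left hG0⟩

theorem mul_mem_testFunctions {φ ψ : M → ℝ} (hφ : φ ∈ testFunctions n M)
    (hψ : ContMDiff (𝓡 n) 𝓘(ℝ, ℝ) ∞ ψ) : φ * ψ ∈ testFunctions n M :=
  ⟨hφ.1.mul hψ, hφ.2.mul_right⟩

variable [RiemannianBundle (fun x : M => TangentSpace (𝓡 n) x)]

/-- Homogeneity of the norm of covectors, read off from the scalar product that defines it. -/
theorem norm_smul_cotangent {x : M} (c : ℝ) (α : TangentSpace (𝓡 n) x →L[ℝ] ℝ) :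
    ‖c • α‖ = |c| * ‖α‖ := by
  have h2 : ∀ β : TangentSpace (𝓡 n) x →L[ℝ] ℝ, ‖β‖ ^ 2 = cotangentInner n β β := fun β => by
    simp [cotangentInner]
  refine (sq_eq_sq₀ (ContinuousLinearMap.opNorm_nonneg _)
    (mul_nonneg (abs_nonneg c) (ContinuousLinearMap.opNorm_nonneg _))).1 ?_
  rw [mul_pow, h2, h2, cotangentInner_smul_left, cotangentInner_comm, cotangentInner_smul_left,
    sq_abs]
  ring

theorem enorm_mvfderiv_real_comp {G : ℝ → ℝ} {φ : M → ℝ} (hG : Differentiable ℝ G)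
    (hφ : ContMDiff (𝓡 n) 𝓘(ℝ, ℝ) ∞ φ) (x : M) :
    ‖mvfderiv (𝓡 n) (G ∘ φ) x‖ₑ = ‖deriv G (φ x)‖ₑ * ‖mvfderiv (𝓡 n) φ x‖ₑ := by
  rw [← ofReal_norm_mvfderiv, ← ofReal_norm_mvfderiv,
    mvfderiv_real_comp n (hG _) ((hφ.mdifferentiable (by simp)) x),
    norm_smul_cotangent,
    ENNReal.ofReal_mul (abs_nonneg _), Real.enorm_eq_ofReal_abs]

/-- The differential of `ψ + η (1 - ψ) = 1 - (1 - η) (1 - ψ)`. -/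
theorem enorm_mvfderiv_add_mul_sq_le {ψ η : M → ℝ} (hψ : ContMDiff (𝓡 n) 𝓘(ℝ, ℝ) ∞ ψ)
    (hη : ContMDiff (𝓡 n) 𝓘(ℝ, ℝ) ∞ η) (x : M) (hη1 : η x ∈ Icc (0 : ℝ) 1) :
    ‖mvfderiv (𝓡 n) (ψ + η * (1 - ψ)) x‖ₑ ^ 2 ≤
      2 * (‖mvfderiv (𝓡 n) ψ x‖ₑ ^ 2 + ‖ψ x - 1‖ₑ ^ 2 * ‖mvfderiv (𝓡 n) η x‖ₑ ^ 2) := by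
  have hdψ := (hψ.mdifferentiable (by simp)) x
  have hdη := (hη.mdifferentiable (by simp)) x
  have hd1 : MDifferentiableAt (𝓡 n) 𝓘(ℝ, ℝ) (1 - ψ) x := mdifferentiableAt_const.sub hdψ
  have h1 : mvfderiv (𝓡 n) (ψ + η * (1 - ψ)) x =
      (1 - η x) • mvfderiv (𝓡 n) ψ x + (1 - ψ x) • mvfderiv (𝓡 n) η x := by
    have h2 : mvfderiv (𝓡 n) (1 - ψ) x = - mvfderiv (𝓡 n) ψ x := by
      have h3 := mvfderiv_sub (I := 𝓡 n) (g := fun _ : M => (1 : ℝ)) (x := x)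
        mdifferentiableAt_const hdψ
      rw [mvfderiv_const, zero_sub] at h3
      exact h3
    rw [mvfderiv_add hdψ (hdη.mul hd1), mvfderiv_mul hdη hd1, h2]
    ext v
    simp
    ring
  have h2 : ‖mvfderiv (𝓡 n) (ψ + η * (1 - ψ)) x‖ ≤
      ‖mvfderiv (𝓡 n) ψ x‖ + |ψ x - 1| * ‖mvfderiv (𝓡 n) η x‖ := by
    rw [h1]
    refine (ContinuousLinearMap.opNorm_add_le _ _).trans ?_
    rw [norm_smul_cotangent, norm_smul_cotangent, abs_sub_comm (1 : ℝ) (ψ x)]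
    refine add_le_add_left (mul_le_of_le_one_left (norm_mvfderiv_nonneg n ψ x) ?_) _
    exact abs_le.2 ⟨by linarith [hη1.2], by linarith [hη1.1]⟩
  rw [← mul_pow, ← ofReal_norm_mvfderiv n η, Real.enorm_eq_ofReal_abs,
    ← ENNReal.ofReal_mul (abs_nonneg _), ← ofReal_norm_mvfderiv, ← ofReal_norm_mvfderiv]
  refine (pow_le_pow_left' ((ENNReal.ofReal_le_ofReal h2).trans_eq
    (ENNReal.ofReal_add (norm_mvfderiv_nonneg n ψ x)
      (mul_nonneg (abs_nonneg _) (norm_mvfderiv_nonneg n η x)))) 2).trans ?_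
  exact add_sq_le_two_mul _ _

theorem energy_smul [MeasurableSpace M] (μ : Measure M) (c : ℝ) {φ : M → ℝ}
    (hφ : φ ∈ testFunctions n M) : energy n μ (c • φ) = c ^ 2 * energy n μ φ := by
  rw [← energyForm_self, energyForm_smul_left n μ c hφ, ← energyForm_self, sq, mul_assoc]
  congr 1
  rw [← energyForm_smul_left n μ c hφ]
  simp only [energyForm, cotangentInner_comm n (mvfderiv (𝓡 n) (c • φ) _)]

end ChainRule

/-! ### Consequences of non-parabolicity -/

section Parabolicity

variable {n : ℕ} {M : Type*} [MetricSpace M] [ChartedSpace (EuclideanSpace ℝ (Fin n)) M]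
  [RiemannianBundle (fun x : M => TangentSpace (𝓡 n) x)] [MeasurableSpace M] {μ : Measure M}

theorem isParabolic_of_forall_isCompact [SecondCountableTopology M]
    (h : ∀ K : Set M, IsCompact K → ∀ ε : ℝ, 0 < ε → ∃ χ ∈ testFunctions n M,
      (∀ x, 0 ≤ χ x ∧ χ x ≤ 1) ∧ (∀ x ∈ K, χ x = 1) ∧ energy n μ χ ≤ ε) : IsParabolic n μ := by
  have : LocallyCompactSpace M := Manifold.locallyCompact_of_finiteDimensional (𝓡 n)
  let K := CompactExhaustion.choice M
  choose χ hχ hχ1 hχK hχE using fun j : ℕ => h (K j) (K.isCompact j) (1 / ((j : ℝ) + 1)) (by positivity)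
  refine ⟨χ, hχ, hχ1, fun L hL => ?_, ?_⟩
  · obtain ⟨j, hj⟩ := K.exists_superset_of_isCompact hL
    rw [Metric.tendstoUniformlyOn_iff]
    intro ε hε
    filter_upwards [eventually_ge_atTop j] with k hk x hx
    rw [hχK k x (K.subset hk (hj hx)), dist_self]
    exact hε
  · exact tendsto_of_tendsto_of_tendsto_of_le_of_le tendsto_const_nhds
      tendsto_one_div_add_atTop_nhds_zero_nat (fun j => energy_nonneg n μ _) hχE

theorem exists_enorm_mvfderiv_sq_le {M : Type*} [MetricSpace M]
    [ChartedSpace (EuclideanSpace ℝ (Fin n)) M] [IsManifold (𝓡 n) ∞ M]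
    [RiemannianBundle (fun x : M => TangentSpace (𝓡 n) x)]
    [IsContMDiffRiemannianBundle (𝓡 n) ∞ (EuclideanSpace ℝ (Fin n))
      (fun x : M => TangentSpace (𝓡 n) x)] {η : M → ℝ} (hη : η ∈ testFunctions n M) :
    ∃ L : ℝ≥0∞, L ≠ ⊤ ∧ ∀ x, ‖mvfderiv (𝓡 n) η x‖ₑ ^ 2 ≤ L := by
  rcases (tsupport η).eq_empty_or_nonempty with h | h
  · exact ⟨0, by simp, fun x => by rw [enorm_mvfderiv_eq_zero n (by simp [h])]; simp⟩
  · obtain ⟨y, -, hy⟩ := IsCompact.exists_isMaxOn (f := fun x => ‖mvfderiv (𝓡 n) η x‖ₑ ^ 2) hη.2 h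
      (((ENNReal.continuous_pow 2).comp (continuous_enorm_mvfderiv n hη.1)).continuousOn)
    refine ⟨‖mvfderiv (𝓡 n) η y‖ₑ ^ 2, ?_, fun x => ?_⟩
    · rw [← ofReal_norm_mvfderiv]
      finiteness
    · by_cases hx : x ∈ tsupport η
      · exact hy hx
      · rw [enorm_mvfderiv_eq_zero n hx]
        simp

variable [IsManifold (𝓡 n) ∞ M] [IsContMDiffRiemannianBundle (𝓡 n) ∞ (EuclideanSpace ℝ (Fin n))
    (fun x : M => TangentSpace (𝓡 n) x)] [BorelSpace M] [IsWeightedMeasure n μ]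
  [SecondCountableTopology M] [PreconnectedSpace M]

/-- On a non-parabolic manifold the mean of a test function on a fixed ball is controlled by its
energy. Otherwise there are test functions `ψ` of mean `1` and arbitrarily small energy, and for a
cutoff function `η` a truncation of `ψ + η (1 - ψ)` contradicts non-parabolicity. -/
theorem exists_enorm_average_sq_le (hM : ¬ IsParabolic n μ) {x₀ : M} {r : ℝ} {C : NNReal}
    (h₀ : IsComparisonBall n μ x₀ r C) :
    ∃ A : ℝ≥0∞, A ≠ ⊤ ∧ ∀ φ ∈ testFunctions n M,
      ‖⨍ y in chartBall n x₀ r, φ y ∂μ‖ₑ ^ 2 ≤ A * ENNReal.ofReal (energy n μ φ) := by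
  have : LocallyCompactSpace M := Manifold.locallyCompact_of_finiteDimensional (𝓡 n)
  by_contra! hcon
  refine hM (isParabolic_of_forall_isCompact fun K hK ε hε => ?_)
  obtain ⟨η, hη, hηc, -, hη1, hηK⟩ := exists_contMDiff_cutoff (𝓡 n) hK isOpen_univ (subset_univ K)
  have hηt : η ∈ testFunctions n M := ⟨hη, hηc⟩
  obtain ⟨A', hA', hP⟩ := exists_lintegral_sub_average_le h₀ (K := tsupport η) hηc
  obtain ⟨L, hL, hηL⟩ := exists_enorm_mvfderiv_sq_le (n := n) hηt
  obtain ⟨G, hG, hG0, hG1, hG01, hG', -⟩ := exists_smooth_truncation one_pos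
  have hε' : ENNReal.ofReal ε ≠ 0 := (ENNReal.ofReal_pos.2 hε).ne'
  -- the energy of the truncated function will be at most `8 (1 + L A') E(ψ)`
  set A : ℝ≥0∞ := 8 * (1 + L * A') / ENNReal.ofReal ε with hA
  have hAε : 8 * (1 + L * A') = ENNReal.ofReal ε * A := by
    rw [hA, ENNReal.mul_div_cancel hε' ENNReal.ofReal_ne_top]
  obtain ⟨φ, hφ, hφA⟩ := hcon A (ENNReal.div_ne_top (by finiteness) hε')
  set m := ⨍ y in chartBall n x₀ r, φ y ∂μ with hm
  have hm0 : m ≠ 0 := by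
    intro h
    rw [h] at hφA
    simp at hφA
  set ψ : M → ℝ := m⁻¹ • φ with hψ
  have hψt : ψ ∈ testFunctions n M := Submodule.smul_mem _ _ hφ
  have hψm : ⨍ y in chartBall n x₀ r, ψ y ∂μ = 1 := by
    rw [setAverage_eq] at hm ⊢
    simp only [hψ, Pi.smul_apply]
    rw [integral_smul, smul_comm, ← hm, smul_eq_mul, inv_mul_cancel₀ hm0]
  have hψE : A * ENNReal.ofReal (energy n μ ψ) ≤ 1 := by
    have h1 : ‖m⁻¹‖ₑ ^ 2 * ‖m‖ₑ ^ 2 = 1 := by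
      rw [← mul_pow, ← enorm_mul, inv_mul_cancel₀ hm0]
      simp
    rw [hψ, energy_smul n μ _ hφ, ENNReal.ofReal_mul (sq_nonneg _), ← enorm_sq_eq_ofReal, ← h1,
      mul_left_comm]
    gcongr
  have hχ₀ : ψ + η * (1 - ψ) ∈ testFunctions n M :=
    add_mem hψt (mul_mem_testFunctions n hηt (contMDiff_const.sub hψt.1))
  refine ⟨G ∘ (ψ + η * (1 - ψ)), comp_mem_testFunctions n hG (hG0 0 le_rfl) hχ₀,
    fun x => hG01 _, fun x hx => hG1 _ ?_, ?_⟩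
  · simp [hηK.self_of_nhdsSet x hx]
  rw [← ENNReal.ofReal_le_ofReal_iff hε.le,
    ofReal_energy n μ (comp_mem_testFunctions n hG (hG0 0 le_rfl) hχ₀)]
  set χ : M → ℝ := G ∘ (ψ + η * (1 - ψ)) with hχ
  have hbound : ∀ x, ‖mvfderiv (𝓡 n) χ x‖ₑ ^ 2 ≤
      8 * (‖mvfderiv (𝓡 n) ψ x‖ₑ ^ 2 +
        (tsupport η).indicator (fun x => L * ‖ψ x - 1‖ₑ ^ 2) x) := by
    intro x
    rw [hχ, enorm_mvfderiv_real_comp n (hG.differentiable (by simp)) hχ₀.1, mul_pow]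
    have h1 : ‖deriv G ((ψ + η * (1 - ψ)) x)‖ₑ ^ 2 ≤ 4 := by
      rw [enorm_sq_eq_ofReal, show (4 : ℝ≥0∞) = ENNReal.ofReal 4 by simp]
      refine ENNReal.ofReal_le_ofReal ?_
      have := hG' ((ψ + η * (1 - ψ)) x)
      rw [← sq_abs]
      nlinarith [abs_nonneg (deriv G ((ψ + η * (1 - ψ)) x))]
    refine (mul_le_mul' h1 (enorm_mvfderiv_add_mul_sq_le n hψt.1 hη x (hη1 x))).trans ?_
    rw [← mul_assoc, show (4 : ℝ≥0∞) * 2 = 8 by norm_num]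
    refine mul_le_mul' le_rfl (add_le_add le_rfl ?_)
    by_cases hx : x ∈ tsupport η
    · rw [indicator_of_mem hx, mul_comm]
      exact mul_le_mul' (hηL x) le_rfl
    · rw [enorm_mvfderiv_eq_zero n hx]
      simp
  have hmeas : MeasurableSet (tsupport η) := (isClosed_tsupport η).measurableSet
  calc ∫⁻ x, ‖mvfderiv (𝓡 n) χ x‖ₑ ^ 2 ∂μ
      ≤ ∫⁻ x, 8 * (‖mvfderiv (𝓡 n) ψ x‖ₑ ^ 2 +
        (tsupport η).indicator (fun x => L * ‖ψ x - 1‖ₑ ^ 2) x) ∂μ := lintegral_mono hbound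
    _ = 8 * (ENNReal.ofReal (energy n μ ψ) + L * ∫⁻ x in tsupport η, ‖ψ x - 1‖ₑ ^ 2 ∂μ) := by
        rw [lintegral_const_mul' _ _ (by simp), lintegral_add_left
          ((continuous_enorm_mvfderiv n hψt.1).measurable.pow_const 2),
          lintegral_indicator hmeas, lintegral_const_mul' _ _ hL, ofReal_energy n μ hψt]
    _ ≤ 8 * (ENNReal.ofReal (energy n μ ψ) + L * (A' * ENNReal.ofReal (energy n μ ψ))) := by
        have := hP ψ hψt
        rw [hψm] at this
        gcongr
    _ = ENNReal.ofReal ε * (A * ENNReal.ofReal (energy n μ ψ)) := by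
        rw [← mul_assoc (ENNReal.ofReal ε), ← hAε]
        ring
    _ ≤ ENNReal.ofReal ε := mul_le_of_le_one_right' hψE

/-- On a non-parabolic manifold the energy controls the `L²` norm on compact sets, since it controls
both the mean and the deviation from the mean. -/
theorem exists_setLIntegral_enorm_sq_le (hM : ¬ IsParabolic n μ) {K : Set M} (hK : IsCompact K) :
    ∃ A : ℝ≥0∞, A ≠ ⊤ ∧ ∀ φ ∈ testFunctions n M,
      ∫⁻ x in K, ‖φ x‖ₑ ^ 2 ∂μ ≤ A * ENNReal.ofReal (energy n μ φ) := by
  have := IsWeightedMeasure.isLocallyFiniteMeasure n μ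
  rcases isEmpty_or_nonempty M with hE | ⟨⟨x₀⟩⟩
  · exact ⟨0, by simp, fun φ _ => by simp [Subsingleton.elim K ∅]⟩
  obtain ⟨r, C, h₀⟩ := exists_isComparisonBall n μ x₀
  obtain ⟨A₁, hA₁, h₁⟩ := exists_enorm_average_sq_le hM h₀
  obtain ⟨A₂, hA₂, h₂⟩ := exists_lintegral_sub_average_le h₀ hK
  refine ⟨2 * (A₂ + A₁ * μ K), by have := hK.measure_lt_top (μ := μ).ne; finiteness,
    fun φ hφ => ?_⟩
  set m := ⨍ y in chartBall n x₀ r, φ y ∂μ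
  calc ∫⁻ x in K, ‖φ x‖ₑ ^ 2 ∂μ ≤ ∫⁻ x in K, 2 * (‖φ x - m‖ₑ ^ 2 + ‖m‖ₑ ^ 2) ∂μ := by
        refine lintegral_mono fun x => ?_
        have := enorm_add_sq_le (φ x - m) m
        rwa [sub_add_cancel] at this
    _ = 2 * (∫⁻ x in K, ‖φ x - m‖ₑ ^ 2 ∂μ + ‖m‖ₑ ^ 2 * μ K) := by
        rw [lintegral_const_mul' _ _ (by simp), lintegral_add_right _ measurable_const,
          setLIntegral_const]
    _ ≤ 2 * (A₂ * ENNReal.ofReal (energy n μ φ) +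
          (A₁ * ENNReal.ofReal (energy n μ φ)) * μ K) := by
        gcongr
        · exact h₂ φ hφ
        · exact h₁ φ hφ
    _ = _ := by ring

/-- On a non-parabolic manifold there is a measure `ν` with the same null sets as `μ`, bounded
below by a multiple of `μ` on each compact set, that satisfies a Hardy inequality. -/
theorem exists_hardy_measure (hM : ¬ IsParabolic n μ) :
    ∃ ν : Measure M, (∀ φ ∈ testFunctions n M, ∫⁻ x, ‖φ x‖ₑ ^ 2 ∂ν ≤
      ENNReal.ofReal (energy n μ φ)) ∧ ν ≪ μ ∧ μ ≪ ν ∧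
      ∀ K : Set M, IsCompact K → ∃ c : ℝ≥0∞, c ≠ ⊤ ∧ μ.restrict K ≤ c • ν := by
  have : LocallyCompactSpace M := Manifold.locallyCompact_of_finiteDimensional (𝓡 n)
  let K := CompactExhaustion.choice M
  choose A hA hAK using fun j : ℕ => exists_setLIntegral_enorm_sq_le (n := n) hM (K.isCompact j)
  obtain ⟨δ, hδ, hδA⟩ := ENNReal.exists_pos_tsum_mul_lt_of_countable one_ne_zero A hA
  have hδ0 : ∀ j, (δ j : ℝ≥0∞) ≠ 0 := fun j => by simpa using (hδ j).ne'
  let ν : Measure M := Measure.sum fun j => (δ j : ℝ≥0∞) • μ.restrict (K j)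
  have hle : ∀ L : Set M, IsCompact L → ∃ c : ℝ≥0∞, c ≠ ⊤ ∧ μ.restrict L ≤ c • ν := by
    intro L hL
    obtain ⟨j, hj⟩ := K.exists_superset_of_isCompact hL
    refine ⟨(δ j : ℝ≥0∞)⁻¹, ENNReal.inv_ne_top.2 (hδ0 j), ?_⟩
    calc μ.restrict L ≤ μ.restrict (K j) := Measure.restrict_mono hj le_rfl
      _ = (δ j : ℝ≥0∞)⁻¹ • (δ j : ℝ≥0∞) • μ.restrict (K j) := by
          rw [smul_smul, ENNReal.inv_mul_cancel (hδ0 j) ENNReal.coe_ne_top, one_smul]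
      _ ≤ (δ j : ℝ≥0∞)⁻¹ • ν := by
          gcongr
          exact Measure.le_sum (fun j => (δ j : ℝ≥0∞) • μ.restrict (K j)) j
  refine ⟨ν, fun φ hφ => ?_, ?_, fun s hs => ?_, hle⟩
  · rw [lintegral_sum_measure]
    calc ∑' j, ∫⁻ x, ‖φ x‖ₑ ^ 2 ∂((δ j : ℝ≥0∞) • μ.restrict (K j))
        ≤ ∑' j, A j * δ j * ENNReal.ofReal (energy n μ φ) := by
          refine ENNReal.tsum_le_tsum fun j => ?_
          rw [lintegral_smul_measure, smul_eq_mul, mul_comm (A j), mul_assoc]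
          gcongr
          exact hAK j φ hφ
      _ = (∑' j, A j * δ j) * ENNReal.ofReal (energy n μ φ) := ENNReal.tsum_mul_right
      _ ≤ _ := mul_le_of_le_one_left' hδA.le
  · exact Measure.absolutelyContinuous_sum_left fun j =>
      (Measure.absolutelyContinuous_of_le Measure.restrict_le_self).smul_left _
  · have h1 : ∀ j, μ (s ∩ K j) = 0 := by
      intro j
      obtain ⟨c, -, hc⟩ := hle (K j) (K.isCompact j)
      refine le_antisymm ?_ zero_le
      calc μ (s ∩ K j) ≤ μ.restrict (K j) s := Measure.le_restrict_apply _ _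
        _ ≤ (c • ν) s := hc s
        _ = 0 := by simp [hs]
    have h2 : s = ⋃ j, s ∩ K j := by rw [← inter_iUnion, K.iUnion_eq, inter_univ]
    rw [h2]
    exact measure_iUnion_null h1

end Parabolicity

/-! ### From the capacity condition to the trace inequality -/

section Capacity

/-- The weight that each value of a function receives in the integrated capacity estimate. -/
theorem lintegral_truncation_weight_le (a : ℝ) (ha : 0 ≤ a) :
    ∫⁻ t in Ioi (0 : ℝ), (Ici a).indicator
      (fun t => ENNReal.ofReal (4 * a ^ 2 / t ^ 4)) t * ENNReal.ofReal (2 * t) ≤ 4 := by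
  rcases ha.eq_or_lt with rfl | ha
  · simp
  have h1 : ∀ t, (Ici a).indicator (fun t => ENNReal.ofReal (4 * a ^ 2 / t ^ 4)) t *
      ENNReal.ofReal (2 * t) =
      (Ici a).indicator (fun t => ENNReal.ofReal (8 * a ^ 2 * t ^ (-3 : ℝ))) t := by
    intro t
    by_cases ht : t ∈ Ici a
    · have ht0 : 0 < t := ha.trans_le ht
      rw [indicator_of_mem ht, indicator_of_mem ht, ← ENNReal.ofReal_mul (by positivity),
        Real.rpow_neg ht0.le]
      congr 1
      norm_cast
      field_simp
      ring
    · rw [indicator_of_notMem ht, indicator_of_notMem ht, zero_mul]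
  simp_rw [h1]
  calc ∫⁻ t in Ioi (0 : ℝ), (Ici a).indicator
        (fun t => ENNReal.ofReal (8 * a ^ 2 * t ^ (-3 : ℝ))) t
      ≤ ∫⁻ t, (Ici a).indicator (fun t => ENNReal.ofReal (8 * a ^ 2 * t ^ (-3 : ℝ))) t :=
        setLIntegral_le_lintegral _ _
    _ = ∫⁻ t in Ioi a, ENNReal.ofReal (8 * a ^ 2 * t ^ (-3 : ℝ)) := by
        rw [lintegral_indicator measurableSet_Ici]
        exact setLIntegral_congr Ioi_ae_eq_Ici.symm
    _ = ENNReal.ofReal (∫ t in Ioi a, 8 * a ^ 2 * t ^ (-3 : ℝ)) := by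
        rw [ofReal_integral_eq_lintegral_ofReal
          ((integrableOn_Ioi_rpow_of_lt (by norm_num) ha).const_mul _)]
        filter_upwards [ae_restrict_mem measurableSet_Ioi] with t ht
        have ht0 : 0 < t := ha.trans ht
        change 0 ≤ 8 * a ^ 2 * t ^ (-3 : ℝ)
        positivity
    _ = 4 := by
        rw [integral_const_mul, integral_Ioi_rpow_of_lt (by norm_num) ha,
          show (4 : ℝ≥0∞) = ENNReal.ofReal 4 by simp]
        congr 1
        rw [show (-3 : ℝ) + 1 = -2 by norm_num, Real.rpow_neg ha.le]
        norm_cast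
        field_simp
        norm_num

variable {n : ℕ} {M : Type*} [MetricSpace M] [ChartedSpace (EuclideanSpace ℝ (Fin n)) M]
  [RiemannianBundle (fun x : M => TangentSpace (𝓡 n) x)] [MeasurableSpace M] {μ : Measure M}

theorem capacity_le {U : Set M} {φ : M → ℝ} (hφ : φ ∈ testFunctions n M) (hU : ∀ x ∈ U, φ x = 1) :
    capacity n μ U ≤ energy n μ φ :=
  csInf_le ⟨0, by rintro _ ⟨ψ, -, -, rfl⟩; exact energy_nonneg n μ ψ⟩ ⟨φ, hφ, hU, rfl⟩

variable [IsManifold (𝓡 n) ∞ M] [IsContMDiffRiemannianBundle (𝓡 n) ∞ (EuclideanSpace ℝ (Fin n))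
    (fun x : M => TangentSpace (𝓡 n) x)] [BorelSpace M] [IsWeightedMeasure n μ]

/-- Comparison of the capacity of a superlevel set of `φ` with the energy of a truncation of
`φ² / t²`. The excess slope `ε` of the truncation is removed by letting it tend to `0`. -/
theorem ofReal_capacity_lt_abs_le {φ : M → ℝ} (hφ : φ ∈ testFunctions n M) {t : ℝ} (ht : 0 < t) :
    ENNReal.ofReal (capacity n μ {x | t < |φ x|}) ≤
      ∫⁻ x, (Ici |φ x|).indicator (fun t => ENNReal.ofReal (4 * |φ x| ^ 2 / t ^ 4)) t *
        ‖mvfderiv (𝓡 n) φ x‖ₑ ^ 2 ∂μ := by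
  set F := ∫⁻ x, (Ici |φ x|).indicator (fun t => ENNReal.ofReal (4 * |φ x| ^ 2 / t ^ 4)) t *
        ‖mvfderiv (𝓡 n) φ x‖ₑ ^ 2 ∂μ
  have key : ∀ ε : ℝ, 0 < ε → ENNReal.ofReal (capacity n μ {x | t < |φ x|}) ≤
      ENNReal.ofReal ((1 + ε) ^ 2) * F := by
    intro ε hε
    obtain ⟨G, hG, hG0, hG1, -, hG', hGs⟩ := exists_smooth_truncation hε
    let H : ℝ → ℝ := fun s => G (s ^ 2 / t ^ 2)
    have hH : ContDiff ℝ ∞ H := hG.comp (by fun_prop)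
    have hH0 : H 0 = 0 := by simpa [H] using hG0 0 le_rfl
    have hH' : ∀ s, deriv H s = deriv G (s ^ 2 / t ^ 2) * (2 * s / t ^ 2) := by
      intro s
      have h1 : HasDerivAt (fun s : ℝ => s ^ 2 / t ^ 2) (2 * s / t ^ 2) s := by
        simpa using (hasDerivAt_pow 2 s).div_const (t ^ 2)
      exact (((hG.differentiable (by simp)) _).hasDerivAt.comp s h1).deriv
    have hHφ := comp_mem_testFunctions n hH hH0 hφ
    have hcap : capacity n μ {x | t < |φ x|} ≤ energy n μ (H ∘ φ) := by
      refine capacity_le hHφ fun x hx => hG1 _ ?_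
      rw [one_le_div (by positivity), ← sq_abs (φ x)]
      exact pow_le_pow_left₀ ht.le (le_of_lt hx) 2
    refine (ENNReal.ofReal_le_ofReal hcap).trans ?_
    rw [ofReal_energy n μ hHφ, ← lintegral_const_mul' _ _ (by finiteness)]
    refine lintegral_mono fun x => ?_
    dsimp only
    rw [enorm_mvfderiv_real_comp n (hH.differentiable (by simp)) hφ.1, mul_pow, ← mul_assoc]
    refine mul_le_mul' ?_ le_rfl
    rw [hH', enorm_sq_eq_ofReal]
    by_cases hx : t ∈ Ici |φ x|
    · rw [indicator_of_mem hx, ← ENNReal.ofReal_mul (by positivity)]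
      refine ENNReal.ofReal_le_ofReal ?_
      rw [mul_pow, sq_abs]
      have h1 : (2 * φ x / t ^ 2) ^ 2 = 4 * φ x ^ 2 / t ^ 4 := by
        field_simp
        ring
      rw [h1, ← sq_abs (deriv G _)]
      gcongr
      exact hG' _
    · have h1 : φ x ^ 2 / t ^ 2 ∉ Icc (0 : ℝ) 1 := by
        intro h
        have h2 := h.2
        rw [div_le_one (by positivity), sq_le_sq, abs_of_pos ht] at h2
        exact hx h2
      rw [hGs _ h1]
      simp
  have h1 : Tendsto (fun ε : ℝ => ENNReal.ofReal ((1 + ε) ^ 2) * F) (𝓝[>] 0) (𝓝 (1 * F)) := by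
    refine ENNReal.Tendsto.mul_const ?_ (Or.inl one_ne_zero)
    refine tendsto_nhdsWithin_of_tendsto_nhds ?_
    have h2 : Continuous fun ε : ℝ => ENNReal.ofReal ((1 + ε) ^ 2) :=
      ENNReal.continuous_ofReal.comp (by fun_prop)
    simpa using h2.tendsto 0
  rw [one_mul] at h1
  exact ge_of_tendsto h1 (eventually_nhdsWithin_of_forall key)

/-- The capacity condition implies the trace inequality: integrate the capacity estimate for the
superlevel sets of `φ` over all levels. -/
theorem traceInequality_of_capacityCondition [SecondCountableTopology M] {q : M → ℝ}
    (hq : LocallyIntegrable q μ) (hq0 : ∀ᵐ x ∂μ, 0 ≤ q x) {C : ℝ} (hC : 0 ≤ C)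
    (h : CapacityCondition n μ q C) : TraceInequality n μ q (4 * C) := by
  intro φ hφ
  have := IsWeightedMeasure.isLocallyFiniteMeasure n μ
  have hφm : Measurable φ := hφ.1.continuous.measurable
  have hqm : AEMeasurable (fun x => ENNReal.ofReal (q x)) μ :=
    hq.aestronglyMeasurable.aemeasurable.ennreal_ofReal
  have hdm : Measurable fun x => ‖mvfderiv (𝓡 n) φ x‖ₑ ^ 2 :=
    (continuous_enorm_mvfderiv n hφ.1).measurable.pow_const 2
  -- the measure `q dμ`
  set κ := μ.withDensity fun x => ENNReal.ofReal (q x)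
  have hlevel : ∀ t : ℝ, 0 < t → κ {x | t < |φ x|} ≤ ENNReal.ofReal C *
      ∫⁻ x, (Ici |φ x|).indicator (fun t => ENNReal.ofReal (4 * |φ x| ^ 2 / t ^ 4)) t *
        ‖mvfderiv (𝓡 n) φ x‖ₑ ^ 2 ∂μ := by
    intro t ht
    have hU : IsOpen {x | t < |φ x|} := isOpen_lt continuous_const hφ.1.continuous.abs
    have hUs : {x | t < |φ x|} ⊆ tsupport φ := fun x hx => subset_tsupport _ fun h0 => by
      rw [mem_ofPred_eq, h0, abs_zero] at hx
      exact lt_asymm hx ht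
    have hqU : IntegrableOn q {x | t < |φ x|} μ := (hq.integrableOn_isCompact hφ.2).mono_set hUs
    rw [withDensity_apply _ hU.measurableSet,
      ← ofReal_integral_eq_lintegral_ofReal hqU (ae_restrict_of_ae hq0)]
    refine (ENNReal.ofReal_le_ofReal (h _ hU (hφ.2.isBounded.subset hUs))).trans ?_
    rw [ENNReal.ofReal_mul hC]
    gcongr
    exact ofReal_capacity_lt_abs_le hφ ht
  have hmain : ∫⁻ x, ENNReal.ofReal (q x * φ x ^ 2) ∂μ ≤
      ENNReal.ofReal (4 * C * energy n μ φ) := by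
    calc ∫⁻ x, ENNReal.ofReal (q x * φ x ^ 2) ∂μ
        = ∫⁻ x, ENNReal.ofReal (|φ x| ^ (2 : ℝ)) ∂κ := by
          rw [lintegral_withDensity_eq_lintegral_mul₀ hqm
            (by have := hφm.abs; fun_prop)]
          refine lintegral_congr_ae ?_
          filter_upwards [hq0] with x hx
          rw [Pi.mul_apply, ← ENNReal.ofReal_mul hx]
          norm_cast
          rw [sq_abs]
      _ = ENNReal.ofReal 2 * ∫⁻ t in Ioi (0 : ℝ), κ {x | t < |φ x|} *
            ENNReal.ofReal (t ^ ((2 : ℝ) - 1)) :=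
          lintegral_rpow_eq_lintegral_meas_lt_mul κ (.of_forall fun x => abs_nonneg _)
            hφm.abs.aemeasurable two_pos
      _ = ∫⁻ t in Ioi (0 : ℝ), κ {x | t < |φ x|} * ENNReal.ofReal (2 * t) := by
          rw [← lintegral_const_mul' _ _ (by simp)]
          refine lintegral_congr fun t => ?_
          rw [show (2 : ℝ) - 1 = 1 by norm_num, Real.rpow_one, ENNReal.ofReal_mul two_pos.le]
          ring
      _ ≤ ∫⁻ t in Ioi (0 : ℝ), ENNReal.ofReal C * ∫⁻ x, ‖mvfderiv (𝓡 n) φ x‖ₑ ^ 2 *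
            ((Ici |φ x|).indicator (fun t => ENNReal.ofReal (4 * |φ x| ^ 2 / t ^ 4)) t *
              ENNReal.ofReal (2 * t)) ∂μ := by
          refine setLIntegral_mono' measurableSet_Ioi fun t ht => ?_
          refine (mul_le_mul' (hlevel t ht) le_rfl).trans_eq ?_
          rw [mul_assoc, ← lintegral_mul_const' _ _ ENNReal.ofReal_ne_top]
          congr 1
          refine lintegral_congr fun x => ?_
          ring
      _ = ENNReal.ofReal C * ∫⁻ x, (∫⁻ t in Ioi (0 : ℝ), ‖mvfderiv (𝓡 n) φ x‖ₑ ^ 2 *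
            ((Ici |φ x|).indicator (fun t => ENNReal.ofReal (4 * |φ x| ^ 2 / t ^ 4)) t *
              ENNReal.ofReal (2 * t))) ∂μ := by
          rw [lintegral_const_mul' _ _ (by simp), lintegral_lintegral_swap]
          refine Measurable.aemeasurable ?_
          have h1 : Measurable fun p : ℝ × M => (Ici |φ p.2|).indicator
              (fun t => ENNReal.ofReal (4 * |φ p.2| ^ 2 / t ^ 4)) p.1 := by
            have h2 : MeasurableSet {p : ℝ × M | |φ p.2| ≤ p.1} :=
              measurableSet_le (hφm.comp measurable_snd).abs measurable_fst
            have h3 : Measurable fun p : ℝ × M => ENNReal.ofReal (4 * |φ p.2| ^ 2 / p.1 ^ 4) := by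
              have := hφm.abs
              fun_prop
            exact h3.indicator h2
          exact (hdm.comp measurable_snd).mul (h1.mul (by fun_prop))
      _ ≤ ENNReal.ofReal C * ∫⁻ x, ‖mvfderiv (𝓡 n) φ x‖ₑ ^ 2 * 4 ∂μ := by
          refine mul_le_mul' le_rfl (lintegral_mono fun x => ?_)
          have h1 : ‖mvfderiv (𝓡 n) φ x‖ₑ ^ 2 ≠ ⊤ := by
            rw [← ofReal_norm_mvfderiv]
            finiteness
          rw [lintegral_const_mul' _ _ h1]
          exact mul_le_mul' le_rfl (lintegral_truncation_weight_le _ (abs_nonneg _))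
      _ = ENNReal.ofReal (4 * C * energy n μ φ) := by
          rw [lintegral_mul_const' _ _ (by simp), ← ofReal_energy n μ hφ,
            ENNReal.ofReal_mul (by positivity), ENNReal.ofReal_mul (by positivity)]
          simp
          ring
  rw [integral_eq_lintegral_of_nonneg_ae]
  · exact ENNReal.toReal_le_of_le_ofReal (by have := energy_nonneg n μ φ; positivity) hmain
  · filter_upwards [hq0] with x hx
    exact mul_nonneg hx (sq_nonneg _)
  · exact hq.aestronglyMeasurable.mul (hφ.1.continuous.pow 2).aestronglyMeasurable

end Capacity

/-! ### The Sobolev space as a space of functions -/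

section LpTwo

variable {α : Type*} [MeasurableSpace α] {ν : Measure α}

theorem eLpNorm_two_sq (f : α → ℝ) : eLpNorm f 2 ν ^ 2 = ∫⁻ x, ‖f x‖ₑ ^ 2 ∂ν := by
  have h := eLpNorm_nnreal_pow_eq_lintegral (μ := ν) (f := f) (p := 2) two_ne_zero
  have h2 : ((2 : NNReal) : ℝ) = ((2 : ℕ) : ℝ) := by norm_num
  rw [h2] at h
  simpa only [ENNReal.rpow_natCast] using! h

theorem ofReal_norm_sq_Lp_two (f : Lp ℝ 2 ν) :
    ENNReal.ofReal (‖f‖ ^ 2) = ∫⁻ x, ‖f x‖ₑ ^ 2 ∂ν := by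
  rw [← eLpNorm_two_sq, ENNReal.ofReal_pow (norm_nonneg _), Lp.norm_def,
    ENNReal.ofReal_toReal (Lp.eLpNorm_ne_top f)]

theorem exists_subseq_tendsto_ae_of_tendsto_Lp {F : ℕ → Lp ℝ 2 ν} {f : Lp ℝ 2 ν}
    (h : Tendsto F atTop (𝓝 f)) : ∃ s : ℕ → ℕ, StrictMono s ∧
      ∀ᵐ x ∂ν, Tendsto (fun k => F (s k) x) atTop (𝓝 (f x)) :=
  (tendstoInMeasure_of_tendsto_Lp h).exists_seq_tendsto_ae

end LpTwo

section TestSpace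

variable {n : ℕ} {M : Type*} [MetricSpace M] [ChartedSpace (EuclideanSpace ℝ (Fin n)) M]
  [IsManifold (𝓡 n) ∞ M] [RiemannianBundle (fun x : M => TangentSpace (𝓡 n) x)]
  [IsContMDiffRiemannianBundle (𝓡 n) ∞ (EuclideanSpace ℝ (Fin n))
    (fun x : M => TangentSpace (𝓡 n) x)]
  [MeasurableSpace M] [BorelSpace M] {μ : Measure M} [IsWeightedMeasure n μ]

theorem TestSpace.coeFn_toLp (φ : TestSpace n μ) :
    TestSpace.toLp n μ φ =ᵐ[μ] TestSpace.toFun n μ φ :=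
  (testFunctions_memLp n μ (TestSpace.toFun_mem n μ φ)).coeFn_toLp

theorem TestSpace.ofReal_norm_toLp_sq (φ : TestSpace n μ) :
    ENNReal.ofReal (‖TestSpace.toLp n μ φ‖ ^ 2) = ∫⁻ x, ‖TestSpace.toFun n μ φ x‖ₑ ^ 2 ∂μ := by
  rw [ofReal_norm_sq_Lp_two]
  refine lintegral_congr_ae ?_
  filter_upwards [TestSpace.coeFn_toLp φ] with x hx
  rw [hx]

theorem TestSpace.norm_sq (φ : TestSpace n μ) :
    ‖φ‖ ^ 2 = ‖TestSpace.toLp n μ φ‖ ^ 2 + energy n μ (TestSpace.toFun n μ φ) := by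
  have h1 : ‖TestSpace.toLp n μ φ‖ ^ 2 =
      ∫ x, TestSpace.toFun n μ φ x * TestSpace.toFun n μ φ x ∂μ := by
    rw [← real_inner_self_eq_norm_sq, L2.inner_def]
    refine integral_congr_ae ?_
    filter_upwards [TestSpace.coeFn_toLp φ] with x hx
    simp [hx, sq]
  rw [h1, ← energyForm_self]
  exact (real_inner_self_eq_norm_sq φ).symm

theorem sobolevToLp_coe (φ : TestSpace n μ) :
    sobolevToLp n μ (φ : SobolevSpace n μ) = TestSpace.toLp n μ φ :=
  ContinuousLinearMap.fromCompletion_apply_coe _ _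

theorem SobolevSpace.exists_tendsto (h : SobolevSpace n μ) :
    ∃ φ : ℕ → TestSpace n μ, Tendsto (fun j => (φ j : SobolevSpace n μ)) atTop (𝓝 h) := by
  obtain ⟨s, hs, hs'⟩ := mem_closure_iff_seq_limit.1
    (UniformSpace.Completion.denseRange_coe (α := TestSpace n μ) h)
  choose φ hφ using hs
  exact ⟨φ, by simpa only [hφ] using hs'⟩

/-- The energy form on `W_0^{1,2}(M)` is `‖h‖² - ‖S h‖²`. -/
theorem tendsto_energy_coe {φ : ℕ → TestSpace n μ} {h : SobolevSpace n μ}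
    (hφ : Tendsto (fun j => (φ j : SobolevSpace n μ)) atTop (𝓝 h)) :
    Tendsto (fun j => energy n μ (TestSpace.toFun n μ (φ j))) atTop
      (𝓝 (‖h‖ ^ 2 - ‖sobolevToLp n μ h‖ ^ 2)) := by
  have h1 := (hφ.norm.pow 2).sub ((((sobolevToLp n μ).continuous.tendsto h).comp hφ).norm.pow 2)
  refine h1.congr fun j => ?_
  rw [Function.comp_apply, sobolevToLp_coe, UniformSpace.Completion.norm_coe, TestSpace.norm_sq]
  ring

theorem norm_sobolevToLp_le : ‖sobolevToLp n μ‖ ≤ 1 := by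
  refine ContinuousLinearMap.opNorm_le_bound _ zero_le_one fun h => ?_
  obtain ⟨φ, hφ⟩ := SobolevSpace.exists_tendsto h
  have h1 := ge_of_tendsto' (tendsto_energy_coe hφ) fun j => energy_nonneg n μ _
  rw [one_mul]
  exact (abs_le_of_sq_le_sq' (by linarith) (norm_nonneg _)).2

/-- `W_0^{1,2}(M)` is a space of functions: this is the closability of the energy form. -/
theorem sobolevToLp_eq_zero {h : SobolevSpace n μ} (h0 : sobolevToLp n μ h = 0) : h = 0 := by
  obtain ⟨φ, hφ⟩ := SobolevSpace.exists_tendsto h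
  have h1 := tendsto_energy_coe hφ
  rw [h0, norm_zero, zero_pow two_ne_zero, sub_zero] at h1
  have h2 : Tendsto (fun j => ∫⁻ x, ‖TestSpace.toFun n μ (φ j) x‖ₑ ^ 2 ∂μ) atTop (𝓝 0) := by
    have h3 := (((sobolevToLp n μ).continuous.tendsto h).comp hφ).norm.pow 2
    rw [h0, norm_zero, zero_pow two_ne_zero] at h3
    have h4 := ENNReal.tendsto_ofReal h3
    rw [ENNReal.ofReal_zero] at h4
    refine h4.congr fun j => ?_
    rw [Function.comp_apply, sobolevToLp_coe, TestSpace.ofReal_norm_toLp_sq]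
  have h3 : Tendsto (fun j => ENNReal.ofReal (energy n μ (TestSpace.toFun n μ (φ j)))) atTop
      (𝓝 0) := by
    refine tendsto_energy_of_cauchy (fun j => TestSpace.toFun_mem n μ (φ j)) h2 fun ε hε => ?_
    rcases eq_or_ne ε ⊤ with rfl | hε'
    · exact ⟨0, fun _ _ _ _ => le_top⟩
    have hε0 : 0 < ε.toReal := ENNReal.toReal_pos hε.ne' hε'
    obtain ⟨N, hN⟩ := Metric.cauchySeq_iff.1 hφ.cauchySeq (√ε.toReal) (Real.sqrt_pos.2 hε0)
    refine ⟨N, fun j hj k hk => ENNReal.ofReal_le_of_le_toReal ?_⟩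
    have h4 := (hN k hk j hj).le
    rw [dist_eq_norm, ← UniformSpace.Completion.coe_sub, UniformSpace.Completion.norm_coe] at h4
    have h5 := TestSpace.norm_sq (φ k - φ j)
    rw [map_sub (TestSpace.toFun n μ)] at h5
    have h6 := pow_le_pow_left₀ (norm_nonneg _) h4 2
    rw [Real.sq_sqrt hε0.le] at h6
    have h7 := sq_nonneg ‖TestSpace.toLp n μ (φ k - φ j)‖
    linarith
  have h4 := ENNReal.tendsto_ofReal h1
  have h5 := tendsto_nhds_unique h4 h3
  rw [ENNReal.ofReal_eq_zero] at h5
  exact norm_eq_zero.1 (pow_eq_zero_iff two_ne_zero |>.1 (le_antisymm h5 (sq_nonneg _)))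

variable [SecondCountableTopology M]

theorem exists_mem_testFunctions_eLpNorm_sub_le {f : M → ℝ} (hf : MemLp f 2 μ) {δ : ℝ≥0∞}
    (hδ : δ ≠ 0) : ∃ ψ ∈ testFunctions n M, eLpNorm (f - ψ) 2 μ ≤ δ := by
  have := IsWeightedMeasure.isLocallyFiniteMeasure n μ
  have : LocallyCompactSpace M := Manifold.locallyCompact_of_finiteDimensional (𝓡 n)
  have hδ2 : δ / 2 ≠ 0 := (ENNReal.half_pos hδ).ne'
  obtain ⟨g, hgc, hfg, hg, -⟩ := hf.exists_hasCompactSupport_eLpNorm_sub_le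
    ENNReal.ofNat_ne_top hδ2
  have hfin : μ (tsupport g) ^ (1 / (2 : ℝ≥0∞).toReal) ≠ ⊤ :=
    ENNReal.rpow_ne_top_of_nonneg (by simp) (IsCompact.measure_lt_top hgc).ne
  obtain ⟨c, hc, hcδ⟩ : ∃ c : ℝ, 0 < c ∧
      ENNReal.ofReal c * μ (tsupport g) ^ (1 / (2 : ℝ≥0∞).toReal) ≤ δ / 2 := by
    have h1 : Tendsto (fun c : ℝ => ENNReal.ofReal c *
        μ (tsupport g) ^ (1 / (2 : ℝ≥0∞).toReal)) (𝓝[>] 0)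
        (𝓝 (0 * μ (tsupport g) ^ (1 / (2 : ℝ≥0∞).toReal))) := by
      refine ENNReal.Tendsto.mul_const (tendsto_nhdsWithin_of_tendsto_nhds ?_) (Or.inr hfin)
      simpa using ENNReal.continuous_ofReal.tendsto 0
    rw [zero_mul] at h1
    obtain ⟨c, h2, h3⟩ := ((h1.eventually_le_const (pos_iff_ne_zero.2 hδ2)).and
      self_mem_nhdsWithin).exists
    exact ⟨c, h3, h2⟩
  obtain ⟨⟨ψ, hψc⟩, hψg, hψs⟩ := hg.exists_contMDiff_approx (𝓡 n) ⊤ (ε := fun _ => c)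
    continuous_const fun _ => hc
  refine ⟨ψ, ⟨hψc, hgc.mono hψs⟩, ?_⟩
  have h1 : eLpNorm (g - ψ) 2 μ ≤ δ / 2 := (eLpNorm_sub_le_of_dist_bdd μ ENNReal.ofNat_ne_top
    (isClosed_tsupport g).measurableSet hc.le (fun x => by rw [dist_comm]; exact (hψg x).le)
    (subset_tsupport g) (hψs.trans (subset_tsupport g))).trans hcδ
  rw [← sub_add_sub_cancel f g ψ]
  refine (eLpNorm_add_le (hf.1.sub hg.aestronglyMeasurable)
    (hg.aestronglyMeasurable.sub hψc.continuous.aestronglyMeasurable) one_le_two).trans ?_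
  exact (add_le_add hfg h1).trans_eq (ENNReal.add_halves δ)

theorem denseRange_toLp : DenseRange (TestSpace.toLp n μ) := by
  intro f
  rw [EMetric.mem_closure_iff]
  intro ε hε
  obtain ⟨δ, hδ, hδε⟩ := exists_between hε
  obtain ⟨ψ, hψ, hfψ⟩ := exists_mem_testFunctions_eLpNorm_sub_le (n := n) (Lp.memLp f) hδ.ne'
  let φ : TestSpace n μ := ⟨ψ, hψ⟩
  have hφ : TestSpace.toLp n μ φ =ᵐ[μ] ψ := TestSpace.coeFn_toLp φ
  refine ⟨TestSpace.toLp n μ φ, mem_range_self _, lt_of_le_of_lt ?_ hδε⟩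
  rw [Lp.edist_def]
  refine (eLpNorm_congr_ae ?_).trans_le hfψ
  filter_upwards [hφ] with x hx
  simp [hx]

variable [PreconnectedSpace M]

/-- The energy is positive definite on `W_0^{1,2}(M)` if the manifold is non-parabolic. -/
theorem eq_zero_of_norm_sobolevToLp_eq (hM : ¬ IsParabolic n μ) {h : SobolevSpace n μ}
    (h0 : ‖sobolevToLp n μ h‖ = ‖h‖) : h = 0 := by
  obtain ⟨ν, hν, -, hμν, -⟩ := exists_hardy_measure hM
  refine sobolevToLp_eq_zero ?_
  obtain ⟨φ, hφ⟩ := SobolevSpace.exists_tendsto h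
  have h1 := tendsto_energy_coe hφ
  rw [h0, sub_self] at h1
  have h2 : Tendsto (fun j => TestSpace.toLp n μ (φ j)) atTop (𝓝 (sobolevToLp n μ h)) := by
    refine (((sobolevToLp n μ).continuous.tendsto h).comp hφ).congr fun j => ?_
    rw [Function.comp_apply, sobolevToLp_coe]
  obtain ⟨s, hs, hae⟩ := exists_subseq_tendsto_ae_of_tendsto_Lp h2
  have h3 : Tendsto (fun j => ENNReal.ofReal (energy n μ (TestSpace.toFun n μ (φ (s j))))) atTop
      (𝓝 0) := by
    simpa using ENNReal.tendsto_ofReal (h1.comp hs.tendsto_atTop)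
  have h4 : ∫⁻ x, liminf (fun j => ‖TestSpace.toFun n μ (φ (s j)) x‖ₑ ^ 2) atTop ∂ν = 0 := by
    refine le_antisymm ((lintegral_liminf_le fun j => ?_).trans ?_) zero_le
    · exact ((TestSpace.toFun_mem n μ (φ (s j))).1.continuous.measurable.enorm.pow_const 2)
    · rw [← h3.liminf_eq]
      exact liminf_le_liminf (.of_forall fun j => hν _ (TestSpace.toFun_mem n μ (φ (s j))))
  have h5 := hμν.ae_le ((lintegral_eq_zero_iff (Measurable.liminf fun j =>
    (TestSpace.toFun_mem n μ (φ (s j))).1.continuous.measurable.enorm.pow_const 2)).1 h4)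
  refine Lp.ext ?_
  have h6 : ∀ᵐ x ∂μ, ∀ j, TestSpace.toLp n μ (φ (s j)) x = TestSpace.toFun n μ (φ (s j)) x :=
    ae_all_iff.2 fun j => TestSpace.coeFn_toLp (φ (s j))
  filter_upwards [h5, h6, hae, Lp.coeFn_zero ℝ 2 μ] with x hx1 hx2 hx3 hx4
  rw [hx4]
  simp only [hx2] at hx3
  have h7 := (((ENNReal.continuous_pow 2).comp continuous_enorm).tendsto _).comp hx3
  have h8 := h7.liminf_eq.symm.trans hx1
  simpa using h8

end TestSpace

/-! ### The operators `Δ^{1/2}` and `Δ^{-1/2}` -/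

section InverseSquareRoot

variable {n : ℕ} {M : Type*} [MetricSpace M] [ChartedSpace (EuclideanSpace ℝ (Fin n)) M]
  [IsManifold (𝓡 n) ∞ M] [RiemannianBundle (fun x : M => TangentSpace (𝓡 n) x)]
  [IsContMDiffRiemannianBundle (𝓡 n) ∞ (EuclideanSpace ℝ (Fin n))
    (fun x : M => TangentSpace (𝓡 n) x)]
  [MeasurableSpace M] [BorelSpace M] {μ : Measure M} [IsWeightedMeasure n μ]
  [SecondCountableTopology M] [PreconnectedSpace M]

/-- `Δ^{1/2}` is defined on test functions, where its norm is given by the energy, and it has dense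
range. -/
theorem exists_sqrtLaplacian (hM : ¬ IsParabolic n μ) :
    ∃ D : TestSpace n μ →ₗ[ℝ] Lp ℝ 2 μ,
      (∀ φ, ‖D φ‖ ^ 2 = energy n μ (TestSpace.toFun n μ φ)) ∧ DenseRange D ∧
      ∀ φ g, IsSqrtLaplacian n μ (TestSpace.toLp n μ φ) g ↔ g = D φ := by
  have hdense : DenseRange (sobolevToLp n μ) := by
    refine Dense.mono (s₁ := range (TestSpace.toLp n μ)) ?_ denseRange_toLp
    rintro _ ⟨φ, rfl⟩
    exact ⟨(φ : SobolevSpace n μ), sobolevToLp_coe φ⟩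
  obtain ⟨D, hD, hDd, hDs⟩ := exists_sqrt_form_operator (S := sobolevToLp n μ)
    norm_sobolevToLp_le (fun _ => sobolevToLp_eq_zero) hdense
    fun _ => eq_zero_of_norm_sobolevToLp_eq hM
  refine ⟨(D ∘L UniformSpace.Completion.toComplL).toLinearMap, fun φ => ?_, ?_, fun φ g => ?_⟩
  · have h1 := hD φ
    rw [sobolevToLp_coe, UniformSpace.Completion.norm_coe, TestSpace.norm_sq,
      add_sub_cancel_left] at h1
    exact h1
  · exact hDd.comp UniformSpace.Completion.denseRange_coe D.continuous
  · have h1 := hDs φ g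
    rw [sobolevToLp_coe] at h1
    exact h1

/-- Description of `Δ^{-1/2}` on a non-parabolic manifold: the map `Δ^{1/2} φ ↦ φ` extends to a
bounded operator `P` from `L²(μ)` to a weighted space `L²(ν)`, and `P f` is `Δ^{-1/2} f`. -/
theorem exists_invSqrtLaplacian (hM : ¬ IsParabolic n μ) :
    ∃ (D : TestSpace n μ →ₗ[ℝ] Lp ℝ 2 μ) (ν : Measure M) (P : Lp ℝ 2 μ →L[ℝ] Lp ℝ 2 ν),
      (∀ φ, ‖D φ‖ ^ 2 = energy n μ (TestSpace.toFun n μ φ)) ∧ DenseRange D ∧ μ ≪ ν ∧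
      (∀ φ, P (D φ) =ᵐ[μ] TestSpace.toFun n μ φ) ∧
      ∀ (f : Lp ℝ 2 μ) (u : M → ℝ), IsInvSqrtLaplacian n μ f u ↔ u =ᵐ[μ] P f := by
  have : LocallyCompactSpace M := Manifold.locallyCompact_of_finiteDimensional (𝓡 n)
  obtain ⟨D, hD, hDd, hDs⟩ := exists_sqrtLaplacian hM
  obtain ⟨ν, hν, hνμ, hμν, hνK⟩ := exists_hardy_measure hM
  have hmem : ∀ φ : TestSpace n μ, MemLp (TestSpace.toFun n μ φ) 2 ν := fun φ => by
    refine ⟨(TestSpace.toFun_mem n μ φ).1.continuous.measurable.aestronglyMeasurable, ?_⟩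
    have h1 := (hν _ (TestSpace.toFun_mem n μ φ)).trans_lt ENNReal.ofReal_lt_top
    rw [← eLpNorm_two_sq] at h1
    exact (ENNReal.pow_lt_top_iff.1 h1).resolve_right two_ne_zero
  let J : TestSpace n μ →ₗ[ℝ] Lp ℝ 2 ν :=
    { toFun := fun φ => (hmem φ).toLp
      map_add' := fun φ ψ => rfl
      map_smul' := fun c φ => rfl }
  have hJ : ∀ φ, J φ =ᵐ[ν] TestSpace.toFun n μ φ := fun φ => (hmem φ).coeFn_toLp
  have hJD : ∀ φ, ‖J φ‖ ≤ 1 * ‖D φ‖ := by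
    intro φ
    rw [one_mul]
    refine (abs_le_of_sq_le_sq' ?_ (norm_nonneg _)).2
    rw [hD, ← ENNReal.ofReal_le_ofReal_iff (energy_nonneg n μ _), ofReal_norm_sq_Lp_two]
    refine (lintegral_congr_ae ?_).trans_le (hν _ (TestSpace.toFun_mem n μ φ))
    filter_upwards [hJ φ] with x hx
    rw [hx]
  set P := J.extendOfNorm D
  have hPD : ∀ φ, P (D φ) = J φ := LinearMap.extendOfNorm_eq hDd ⟨1, hJD⟩
  -- convergence in `L²(ν)` implies convergence in `L²` of compact sets
  have hloc : ∀ {φ : ℕ → TestSpace n μ} {f : Lp ℝ 2 μ}, Tendsto (fun k => D (φ k)) atTop (𝓝 f) →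
      ∀ K, IsCompact K → Tendsto (fun k => eLpNorm (fun x => TestSpace.toFun n μ (φ k) x - P f x) 2
        (μ.restrict K)) atTop (𝓝 0) := by
    intro φ f hφ K hK
    obtain ⟨c, hc, hcK⟩ := hνK K hK
    have h1 : Tendsto (fun k => eLpNorm (P (D (φ k)) - P f : M → ℝ) 2 ν) atTop (𝓝 0) :=
      (Lp.tendsto_Lp_iff_tendsto_eLpNorm' _ _).1 ((P.continuous.tendsto f).comp hφ)
    have hc' : c ^ (1 / (2 : ℝ≥0∞)).toReal ≠ ⊤ := ENNReal.rpow_ne_top_of_nonneg (by simp) hc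
    have h2 := ENNReal.Tendsto.const_mul h1 (Or.inr hc')
    rw [mul_zero] at h2
    refine tendsto_of_tendsto_of_tendsto_of_le_of_le tendsto_const_nhds h2 (fun _ => zero_le)
      fun k => ?_
    refine (eLpNorm_mono_measure _ hcK).trans_eq ?_
    rw [eLpNorm_smul_measure_of_ne_top (by simp), smul_eq_mul]
    congr 1
    refine eLpNorm_congr_ae ?_
    filter_upwards [hJ (φ k)] with x hx
    rw [Pi.sub_apply, hPD, hx]
  refine ⟨D, ν, P, hD, hDd, hμν, fun φ => hPD φ ▸ hμν.ae_eq (hJ φ), fun f u => ⟨?_, fun hu => ?_⟩⟩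
  · rintro ⟨hu, φ, g, hg, hgf, hK⟩
    have hgD : g = fun k => D (φ k) := funext fun k => (hDs _ _).1 (hg k)
    rw [hgD] at hgf
    have hPm : AEStronglyMeasurable (P f) μ := (Lp.aestronglyMeasurable (P f)).mono_ac hμν
    have h1 : ∀ K, IsCompact K → u =ᵐ[μ.restrict K] P f := by
      intro K hKc
      have h2 := (hK K hKc).add (hloc hgf K hKc)
      rw [add_zero] at h2
      have h3 : ∀ k, eLpNorm (u - P f : M → ℝ) 2 (μ.restrict K) ≤
          eLpNorm (fun x => TestSpace.toFun n μ (φ k) x - u x) 2 (μ.restrict K) +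
          eLpNorm (fun x => TestSpace.toFun n μ (φ k) x - P f x) 2 (μ.restrict K) := by
        intro k
        have hφm : AEStronglyMeasurable (TestSpace.toFun n μ (φ k)) (μ.restrict K) :=
          (TestSpace.toFun_mem n μ (φ k)).1.continuous.measurable.aestronglyMeasurable
        have h4 := eLpNorm_sub_le (hφm.sub hPm.restrict) (hφm.sub hu.restrict) one_le_two
        rw [sub_sub_sub_cancel_left] at h4
        rw [add_comm]
        exact h4
      have h4 : eLpNorm (u - P f : M → ℝ) 2 (μ.restrict K) = 0 :=
        le_antisymm (ge_of_tendsto' h2 h3) zero_le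
      rw [eLpNorm_eq_zero_iff (hu.sub hPm).restrict two_ne_zero] at h4
      filter_upwards [h4] with x hx
      exact sub_eq_zero.1 hx
    have h2 : ∀ᵐ x ∂μ.restrict (⋃ j, CompactExhaustion.choice M j), u x = P f x :=
      (ae_restrict_iUnion_iff _ _).2 fun j => h1 _ ((CompactExhaustion.choice M).isCompact j)
    rwa [(CompactExhaustion.choice M).iUnion_eq, Measure.restrict_univ] at h2
  · obtain ⟨s, hs, hs'⟩ := mem_closure_iff_seq_limit.1 (hDd f)
    choose φ hφ using hs
    refine ⟨((Lp.aestronglyMeasurable (P f)).mono_ac hμν).congr hu.symm, φ, s,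
      fun k => (hDs _ _).2 (hφ k).symm, hs', fun K hK => ?_⟩
    refine (hloc (φ := φ) (f := f) (by simpa only [hφ] using hs') K hK).congr fun k => ?_
    refine eLpNorm_congr_ae ?_
    filter_upwards [ae_restrict_of_ae hu] with x hx
    rw [hx]

end InverseSquareRoot

/-! ### The implications between the conditions -/

section Implications

variable {n : ℕ} {M : Type*} [MetricSpace M] [ChartedSpace (EuclideanSpace ℝ (Fin n)) M]
  [IsManifold (𝓡 n) ∞ M] [RiemannianBundle (fun x : M => TangentSpace (𝓡 n) x)]
  [MeasurableSpace M] {μ : Measure M}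

/-- Bounds by the energies of all admissible functions pass to the capacity. Since bounded sets are
relatively compact there are admissible functions, so that the infimum is not a junk value. -/
theorem le_mul_capacity [ProperSpace M] {U : Set M} (hU : Bornology.IsBounded U) {a c : ℝ}
    (hc : 0 ≤ c) (h : ∀ φ ∈ testFunctions n M, (∀ x ∈ U, φ x = 1) → a ≤ c * energy n μ φ) :
    a ≤ c * capacity n μ U := by
  obtain ⟨χ, hχ, hχc, -, -, hχU⟩ := exists_contMDiff_cutoff (𝓡 n) hU.isCompact_closure isOpen_univ
    (subset_univ _)
  have hχU' : ∀ x ∈ U, χ x = 1 := fun x hx => hχU.self_of_nhdsSet x (subset_closure hx)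
  rcases hc.eq_or_lt with rfl | hc
  · simpa using h χ ⟨hχ, hχc⟩ hχU'
  rw [← div_le_iff₀' hc]
  refine le_csInf ⟨_, χ, ⟨hχ, hχc⟩, hχU', rfl⟩ ?_
  rintro _ ⟨φ, hφ, hφU, rfl⟩
  rw [div_le_iff₀' hc]
  exact h φ hφ hφU

theorem LocallyIntegrable.integrableOn_isBounded {α : Type*} [MetricSpace α] [ProperSpace α]
    [MeasurableSpace α] {κ : Measure α} {q : α → ℝ} (hq : LocallyIntegrable q κ) {U : Set α}
    (hU : Bornology.IsBounded U) : IntegrableOn q U κ :=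
  (hq.integrableOn_isCompact hU.isCompact_closure).mono_set subset_closure

theorem integral_sq_eq_norm_sq {α : Type*} [MeasurableSpace α] {κ : Measure α} (w : Lp ℝ 2 κ) :
    ∫ x, w x ^ 2 ∂κ = ‖w‖ ^ 2 := by
  rw [← real_inner_self_eq_norm_sq, L2.inner_def]
  exact integral_congr_ae (.of_forall fun x => by simp)

theorem memLp_two_sqrt_mul {α : Type*} [MeasurableSpace α] {μ : Measure α} {q g : α → ℝ}
    (hq : AEStronglyMeasurable q μ)
    (hq0 : ∀ᵐ x ∂μ, 0 ≤ q x) (hg : AEStronglyMeasurable g μ)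
    (h : Integrable (fun x => q x * g x ^ 2) μ) : MemLp (fun x => √(q x) * g x) 2 μ := by
  refine (memLp_two_iff_integrable_sq
    ((Real.continuous_sqrt.comp_aestronglyMeasurable hq).mul hg)).2 (h.congr ?_)
  filter_upwards [hq0] with x hx
  rw [Pi.mul_apply, mul_pow, Real.sq_sqrt hx]

theorem norm_toLp_sqrt_mul_sq {α : Type*} [MeasurableSpace α] {μ : Measure α} {q g : α → ℝ}
    (hq0 : ∀ᵐ x ∂μ, 0 ≤ q x)
    (h : MemLp (fun x => √(q x) * g x) 2 μ) : ‖h.toLp‖ ^ 2 = ∫ x, q x * g x ^ 2 ∂μ := by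
  rw [← integral_sq_eq_norm_sq]
  refine integral_congr_ae ?_
  filter_upwards [hq0, h.coeFn_toLp] with x hx hx'
  rw [hx', mul_pow, Real.sq_sqrt hx]

variable [IsContMDiffRiemannianBundle (𝓡 n) ∞ (EuclideanSpace ℝ (Fin n))
    (fun x : M => TangentSpace (𝓡 n) x)] [BorelSpace M] [IsWeightedMeasure n μ]
  [SecondCountableTopology M] [PreconnectedSpace M]

/-- The trace inequality bounds the operator `Δ^{1/2} φ ↦ √q φ`, whose continuous extension is
`√q Δ^{-1/2}`. -/
theorem exists_isSqrtMulInvSqrtLaplacian (hM : ¬ IsParabolic n μ) {q : M → ℝ}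
    (hq : LocallyIntegrable q μ) (hq0 : ∀ᵐ x ∂μ, 0 ≤ q x) {C : ℝ} (hC : 0 ≤ C)
    (h : TraceInequality n μ q C) :
    ∃ T : Lp ℝ 2 μ →L[ℝ] Lp ℝ 2 μ, IsSqrtMulInvSqrtLaplacian n μ q T ∧ ‖T‖ ^ 2 ≤ C := by
  obtain ⟨D, ν, P, hD, hDd, hμν, hPD, hP⟩ := exists_invSqrtLaplacian hM
  have hint : ∀ φ : TestSpace n μ, Integrable (fun x => q x * TestSpace.toFun n μ φ x ^ 2) μ := by
    intro φ
    have hφ := TestSpace.toFun_mem n μ φ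
    have hc : HasCompactSupport fun x => TestSpace.toFun n μ φ x ^ 2 :=
      hφ.2.mono fun x hx h0 => hx (by simp [h0])
    refine (hq.integrable_smul_left_of_hasCompactSupport (hφ.1.continuous.pow 2) hc).congr ?_
    exact .of_forall fun x => mul_comm _ _
  have hmem : ∀ φ : TestSpace n μ, MemLp (fun x => √(q x) * TestSpace.toFun n μ φ x) 2 μ :=
    fun φ => memLp_two_sqrt_mul hq.aestronglyMeasurable hq0
      (TestSpace.toFun_mem n μ φ).1.continuous.measurable.aestronglyMeasurable (hint φ)
  let J : TestSpace n μ →ₗ[ℝ] Lp ℝ 2 μ :=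
    { toFun := fun φ => (hmem φ).toLp
      map_add' := fun φ ψ => by
        rw [← MemLp.toLp_add]
        refine MemLp.toLp_congr _ _ (.of_forall fun x => ?_)
        simp [mul_add]
      map_smul' := fun c φ => by
        rw [← MemLp.toLp_const_smul]
        refine MemLp.toLp_congr _ _ (.of_forall fun x => ?_)
        simp [mul_left_comm] }
  have hJ : ∀ φ, J φ =ᵐ[μ] fun x => √(q x) * TestSpace.toFun n μ φ x :=
    fun φ => (hmem φ).coeFn_toLp
  have hJD : ∀ φ, ‖J φ‖ ≤ √C * ‖D φ‖ := by
    intro φ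
    refine (abs_le_of_sq_le_sq' ?_ (by positivity)).2
    rw [mul_pow, Real.sq_sqrt hC, hD]
    exact (norm_toLp_sqrt_mul_sq hq0 (hmem φ)).trans_le (h _ (TestSpace.toFun_mem n μ φ))
  have hTD : ∀ φ, J.extendOfNorm D (D φ) = J φ := LinearMap.extendOfNorm_eq hDd ⟨_, hJD⟩
  refine ⟨J.extendOfNorm D, fun f => ⟨P f, (hP f _).2 .rfl, ?_⟩, ?_⟩
  · obtain ⟨s, hs, hs'⟩ := mem_closure_iff_seq_limit.1 (hDd f)
    choose φ hφ using hs
    have h1 : Tendsto (fun k => J (φ k)) atTop (𝓝 (J.extendOfNorm D f)) := by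
      refine (((J.extendOfNorm D).continuous.tendsto f).comp hs').congr fun k => ?_
      rw [Function.comp_apply, ← hφ, hTD]
    -- `T f` and `P f` are limits almost everywhere along a common subsequence
    obtain ⟨a, ha, ha'⟩ := exists_subseq_tendsto_ae_of_tendsto_Lp h1
    obtain ⟨b, hb, hb'⟩ := exists_subseq_tendsto_ae_of_tendsto_Lp
      (((P.continuous.tendsto f).comp hs').comp ha.tendsto_atTop)
    have h2 : ∀ᵐ x ∂μ, ∀ k, J (φ k) x = √(q x) * TestSpace.toFun n μ (φ k) x :=
      ae_all_iff.2 fun k => hJ (φ k)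
    have h3 : ∀ᵐ x ∂μ, ∀ k, P (s k) x = TestSpace.toFun n μ (φ k) x :=
      ae_all_iff.2 fun k => by rw [← hφ]; exact hPD (φ k)
    filter_upwards [ha', hμν.ae_le hb', h2, h3] with x hx1 hx2 hx3 hx4
    simp only [Function.comp_apply, hx4] at hx2
    simp only [hx3] at hx1
    exact tendsto_nhds_unique (hx1.comp hb.tendsto_atTop) (hx2.const_mul _)
  · have h1 := LinearMap.opNorm_extendOfNorm_le hDd (Real.sqrt_nonneg C) hJD
    exact (pow_le_pow_left₀ (norm_nonneg _) h1 2).trans_eq (Real.sq_sqrt hC)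

/-- Pairing of `Δ^{-1/2}(q 1_U)` with `Δ^{1/2} φ`, for a test function `φ` that is `1` on `U`. -/
theorem sq_setIntegral_le_mul_energy (hM : ¬ IsParabolic n μ) {q : M → ℝ} {U : Set M}
    (hU : MeasurableSet U) {w : Lp ℝ 2 μ} (hw : IsDualInvSqrtLaplacian n μ (U.indicator q) w)
    {φ : M → ℝ} (hφ : φ ∈ testFunctions n M) (hφU : ∀ x ∈ U, φ x = 1) :
    (∫ x in U, q x ∂μ) ^ 2 ≤ ‖w‖ ^ 2 * energy n μ φ := by
  obtain ⟨D, ν, P, hD, hDd, hμν, hPD, hP⟩ := exists_invSqrtLaplacian hM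
  let ψ : TestSpace n μ := ⟨φ, hφ⟩
  have h1 := (hw (D ψ) φ ((hP _ _).2 (hPD ψ).symm)).2
  have h2 : ∫ x, U.indicator q x * φ x ∂μ = ∫ x in U, q x ∂μ := by
    rw [← integral_indicator hU]
    refine integral_congr_ae (.of_forall fun x => ?_)
    by_cases hx : x ∈ U <;> simp [hx, hφU]
  have h3 : energy n μ φ = ‖D ψ‖ ^ 2 := (hD ψ).symm
  rw [← h2, ← h1, h3, ← mul_pow, ← sq_abs]
  exact pow_le_pow_left₀ (abs_nonneg _) (abs_real_inner_le_norm _ _) 2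

variable [ProperSpace M]

/-- If `T = √q Δ^{-1/2}` then `Δ^{-1/2}(q 1_U) = T* (√q 1_U)`. -/
theorem testingCondition_of_isSqrtMulInvSqrtLaplacian (hM : ¬ IsParabolic n μ) {q : M → ℝ}
    (hq : LocallyIntegrable q μ) (hq0 : ∀ᵐ x ∂μ, 0 ≤ q x) {T : Lp ℝ 2 μ →L[ℝ] Lp ℝ 2 μ}
    (hT : IsSqrtMulInvSqrtLaplacian n μ q T) :
    TestingCondition n μ q fun U => ‖T‖ ^ 2 * ∫ x in U, q x ∂μ := by
  obtain ⟨D, ν, P, hD, hDd, hμν, hPD, hP⟩ := exists_invSqrtLaplacian hM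
  intro U hUo hU
  have hUm := hUo.measurableSet
  have hsq : ∀ x, q x * U.indicator (fun _ => (1 : ℝ)) x ^ 2 = U.indicator q x := fun x => by
    by_cases hx : x ∈ U <;> simp [hx]
  have hh : MemLp (fun x => √(q x) * U.indicator (fun _ => (1 : ℝ)) x) 2 μ := by
    refine memLp_two_sqrt_mul hq.aestronglyMeasurable hq0
      (measurable_const.indicator hUm).aestronglyMeasurable ?_
    simp_rw [hsq]
    exact (integrable_indicator_iff hUm).2 (LocallyIntegrable.integrableOn_isBounded hq hU)
  set η : Lp ℝ 2 μ := hh.toLp with hη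
  have hηU : η =ᵐ[μ] fun x => √(q x) * U.indicator (fun _ => (1 : ℝ)) x := hh.coeFn_toLp
  refine ⟨ContinuousLinearMap.adjoint T η, fun f u hu => ?_, ?_⟩
  · obtain ⟨v, hv, hTv⟩ := hT f
    have h1 : (fun x => η x * T f x) =ᵐ[μ] fun x => U.indicator q x * u x := by
      filter_upwards [hηU, hTv, (hP f u).1 hu, (hP f v).1 hv, hq0] with x h1 h2 h3 h4 h5
      rw [h1, h2, h4, ← h3]
      by_cases hx : x ∈ U
      · simp only [indicator_of_mem hx, mul_one]
        rw [← mul_assoc, Real.mul_self_sqrt h5]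
      · simp [hx]
    refine ⟨((Lp.memLp η).integrable_mul (Lp.memLp (T f))).congr h1, ?_⟩
    rw [ContinuousLinearMap.adjoint_inner_left, L2.inner_def, ← integral_congr_ae h1]
    exact integral_congr_ae (.of_forall fun x => by simp [mul_comm])
  · rw [integral_sq_eq_norm_sq]
    have h1 := (ContinuousLinearMap.adjoint T).le_opNorm η
    rw [LinearIsometryEquiv.norm_map] at h1
    refine (pow_le_pow_left₀ (norm_nonneg _) h1 2).trans_eq ?_
    rw [mul_pow, hη, norm_toLp_sqrt_mul_sq hq0 hh]
    simp_rw [hsq]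
    rw [integral_indicator hUm]

theorem testingCondition_capacity_of_testingCondition (hM : ¬ IsParabolic n μ) {q : M → ℝ}
    {C : ℝ} (h : TestingCondition n μ q fun U => C * ∫ x in U, q x ∂μ) :
    TestingCondition n μ q fun U => C ^ 2 * capacity n μ U := by
  intro U hUo hU
  obtain ⟨w, hw, hwU⟩ := h U hUo hU
  refine ⟨w, hw, le_mul_capacity hU (sq_nonneg C) fun φ hφ hφU => ?_⟩
  have h1 := sq_setIntegral_le_mul_energy hM hUo.measurableSet hw hφ hφU
  have hE := energy_nonneg n μ φ
  rw [integral_sq_eq_norm_sq] at hwU ⊢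
  rcases (sq_nonneg ‖w‖).eq_or_lt with h0 | h0
  · rw [← h0]
    positivity
  -- `‖w‖⁴ ≤ C² (∫_U q)² ≤ C² ‖w‖² E(φ)`
  refine le_of_mul_le_mul_left ?_ h0
  calc ‖w‖ ^ 2 * ‖w‖ ^ 2 ≤ (C * ∫ x in U, q x ∂μ) * (C * ∫ x in U, q x ∂μ) :=
        mul_le_mul hwU hwU h0.le (h0.le.trans hwU)
    _ = C ^ 2 * (∫ x in U, q x ∂μ) ^ 2 := by ring
    _ ≤ C ^ 2 * (‖w‖ ^ 2 * energy n μ φ) := by gcongr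
    _ = ‖w‖ ^ 2 * (C ^ 2 * energy n μ φ) := by ring

theorem capacityCondition_of_testingCondition (hM : ¬ IsParabolic n μ) {q : M → ℝ}
    {C : ℝ} (hC : 0 ≤ C) (h : TestingCondition n μ q fun U => C ^ 2 * capacity n μ U) :
    CapacityCondition n μ q C := by
  intro U hUo hU
  obtain ⟨w, hw, hwU⟩ := h U hUo hU
  rw [integral_sq_eq_norm_sq] at hwU
  have hcap : 0 ≤ capacity n μ U := Real.sInf_nonneg (by
    rintro _ ⟨φ, -, -, rfl⟩
    exact energy_nonneg n μ φ)
  have h1 : (∫ x in U, q x ∂μ) ^ 2 ≤ ‖w‖ ^ 2 * capacity n μ U :=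
    le_mul_capacity hU (sq_nonneg _) fun φ hφ hφU =>
      sq_setIntegral_le_mul_energy hM hUo.measurableSet hw hφ hφU
  refine (abs_le_of_sq_le_sq' (h1.trans ?_) (by positivity)).2
  calc ‖w‖ ^ 2 * capacity n μ U ≤ C ^ 2 * capacity n μ U * capacity n μ U := by gcongr
    _ = (C * capacity n μ U) ^ 2 := by ring

end Implications

end

theorem mainTheorem3 (n : ℕ) {M : Type*} [MetricSpace M] [SecondCountableTopology M]
    [ChartedSpace (EuclideanSpace ℝ (Fin n)) M] [IsManifold (𝓡 n) ∞ M]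
    [RiemannianBundle (fun x : M => TangentSpace (𝓡 n) x)]
    [IsContMDiffRiemannianBundle (𝓡 n) ∞ (EuclideanSpace ℝ (Fin n))
      (fun x : M => TangentSpace (𝓡 n) x)]
    [IsRiemannianManifold (𝓡 n) M] [CompleteSpace M]
    [MeasurableSpace M] [BorelSpace M] (μ : Measure M) [IsWeightedMeasure n μ]
    (hM : ¬ IsParabolic n μ)
    (q : M → ℝ) (hq : LocallyIntegrable q μ) (hq0 : ∀ᵐ x ∂μ, 0 ≤ q x) :
    [∃ C₁ : ℝ, 0 ≤ C₁ ∧ TraceInequality n μ q C₁,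
      ∃ T : Lp ℝ 2 μ →L[ℝ] Lp ℝ 2 μ, IsSqrtMulInvSqrtLaplacian n μ q T,
      ∃ C₃ : ℝ, 0 ≤ C₃ ∧ CapacityCondition n μ q C₃,
      ∃ C₄ : ℝ, 0 ≤ C₄ ∧ TestingCondition n μ q fun U => C₄ * ∫ x in U, q x ∂μ,
      ∃ C₅ : ℝ, 0 ≤ C₅ ∧ TestingCondition n μ q fun U => C₅ ^ 2 * capacity n μ U].TFAE ∧
    (∀ C₁ : ℝ, 0 ≤ C₁ → TraceInequality n μ q C₁ →
      ∃ T : Lp ℝ 2 μ →L[ℝ] Lp ℝ 2 μ, IsSqrtMulInvSqrtLaplacian n μ q T ∧ ‖T‖ ^ 2 ≤ C₁) ∧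
    (∀ T : Lp ℝ 2 μ →L[ℝ] Lp ℝ 2 μ, IsSqrtMulInvSqrtLaplacian n μ q T →
      TestingCondition n μ q fun U => ‖T‖ ^ 2 * ∫ x in U, q x ∂μ) ∧
    (∀ C₄ : ℝ, 0 ≤ C₄ → (TestingCondition n μ q fun U => C₄ * ∫ x in U, q x ∂μ) →
      TestingCondition n μ q fun U => C₄ ^ 2 * capacity n μ U) ∧
    (∀ C₅ : ℝ, 0 ≤ C₅ → (TestingCondition n μ q fun U => C₅ ^ 2 * capacity n μ U) →
      CapacityCondition n μ q C₅) ∧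
    (∀ C₃ : ℝ, 0 ≤ C₃ → CapacityCondition n μ q C₃ → TraceInequality n μ q (4 * C₃)) := by
  have : PreconnectedSpace M := preconnectedSpace_of_isRiemannianManifold n M
  have : ProperSpace M := properSpace_of_isRiemannianManifold n M
  have h12 := fun (C₁ : ℝ) (hC : 0 ≤ C₁) (h : TraceInequality n μ q C₁) =>
    exists_isSqrtMulInvSqrtLaplacian hM hq hq0 hC h
  have h24 := fun (T : Lp ℝ 2 μ →L[ℝ] Lp ℝ 2 μ) (hT : IsSqrtMulInvSqrtLaplacian n μ q T) =>
    testingCondition_of_isSqrtMulInvSqrtLaplacian hM hq hq0 hT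
  have h45 := fun (C₄ : ℝ) (_ : 0 ≤ C₄)
      (h : TestingCondition n μ q fun U => C₄ * ∫ x in U, q x ∂μ) =>
    testingCondition_capacity_of_testingCondition hM h
  have h53 := fun (C₅ : ℝ) (hC : 0 ≤ C₅)
      (h : TestingCondition n μ q fun U => C₅ ^ 2 * capacity n μ U) =>
    capacityCondition_of_testingCondition hM hC h
  have h31 := fun (C₃ : ℝ) (hC : 0 ≤ C₃) (h : CapacityCondition n μ q C₃) =>
    traceInequality_of_capacityCondition hq hq0 hC h
  refine ⟨?_, h12, h24, h45, h53, h31⟩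
  tfae_have 1 → 2 := fun ⟨C, hC, h⟩ => (h12 C hC h).imp fun _ h => h.1
  tfae_have 2 → 4 := fun ⟨T, hT⟩ => ⟨‖T‖ ^ 2, sq_nonneg _, h24 T hT⟩
  tfae_have 4 → 5 := fun ⟨C, hC, h⟩ => ⟨C, hC, h45 C hC h⟩
  tfae_have 5 → 3 := fun ⟨C, hC, h⟩ => ⟨C, hC, h53 C hC h⟩
  tfae_have 3 → 1 := fun ⟨C, hC, h⟩ => ⟨4 * C, by positivity, h31 C hC h⟩
  tfae_finish
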